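/- All algebras are associative over $\mathbb{C}$, possibly without unit. An algebra $A$ is non-degenerate if $aA=0$ or $Aa=0$ forces $a=0$, and idempotent if $A^2=A$ (products of subspaces denote linear spans). $M(A)$ is the multiplier algebra, i.e. the algebra of pairs $(l,r)$ of linear maps with $l(ab)=l(a)b$, $r(ab)=a\,r(b)$, $r(a)b=a\,l(b)$. A \emph{weak multiplier Hopf algebra} is a non-degenerate idempotent algebra $A$ with a homomorphism $\Delta:A\to M(A\otimes A)$ such that (a) $T_1(a\otimes b)=\Delta(a)(1\otimes b)$ and $T_2(a\otimes b)=(a\otimes 1)\Delta(b)$ lie in $A\otimes A$, and $\Delta$ is coassociative: $(c\otimes1\otimes1)(\Delta\otimes\iota)(\Delta(a)(1\otimes b))=(\iota\otimes\Delta)((c\otimes1)\Delta(a))(1\otimes1\otimes b)$; (b) $\Delta$ is full: $\Delta(A)(1\otimes A)\subseteq V\otimes A$ implies $V=A$, and $(A\otimes 1)\Delta(A)\subseteq A\otimes W$ implies $W=A$; (c) there is a counit: a linear $\varepsilon:A\to\mathbb{C}$ with $(\varepsilon\otimes\iota)T_1(a\otimes b)=ab=(\iota\otimes\varepsilon)T_2(a\otimes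 b)$; (d) there is an idempotent $E\in M(A\otimes A)$ with $T_1(A\otimes A)=E(A\otimes A)$, $T_2(A\otimes A)=(A\otimes A)E$ and $(\iota\otimes\Delta)E=(E\otimes1)(1\otimes E)=(1\otimes E)(E\otimes1)$, where $\iota\otimes\Delta$ is extended to $M(A\otimes A)$ with $(\iota\otimes\Delta)(1)=1\otimes E$; (e) $\ker T_i=(1-G_i)(A\otimes A)$ for $i=1,2$, where the linear maps $G_i$ on $A\otimes A$ are given by $(G_1\otimes\iota)(\Delta_{13}(a)(1\otimes b\otimes c))=\Delta_{13}(a)(1\otimes E)(1\otimes b\otimes c)$ and $(\iota\otimes G_2)((a\otimes b\otimes1)\Delta_{13}(c))=(a\otimes b\otimes1)(E\otimes1)\Delta_{13}(c)$. It is \emph{regular} if also $\Delta(a)(b\otimes1),(1\otimes a)\Delta(b)\in A\otimes A$ for all $a,b\in A$ and $A$ with the flipped coproduct is a weak multiplier Hopf algebra. Its antipode is the linear map $S:A\to A$ with $S(a)b=(\varepsilon\otimes\iota)R_1(a\otimes b)$ and $bS(a)=(\iota\otimes\varepsilon)R_2(b\otimes a)$, where $R_i$ is the generalized inverse of $T_i$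 (that is, $R_iT_iR_i=R_i$) such that $R_iT_i=G_i$, $T_1R_1$ is left multiplication by $E$, and $T_2R_2$ is right multiplication by $E$. The source map $\varepsilon_s:A\to M(A)$ is $\varepsilon_s(a)=\sum S(a_{(1)})a_{(2)}$, i.e. $\varepsilon_s(a)b=\sum S(a_{(1)})a_{(2)}b$. \textbf{Proposition.} Let $A$ be a regular weak multiplier Hopf algebra. Then $S$ and $\varepsilon_s$ are well defined. Write $E=E_{(1)}\otimes E_{(2)}$, put $\alpha_a(x)=\sum a_{(1)}xS(a_{(2)})$ for $a,x\in A$ (the image of $\Delta(a)(x\otimes 1)\in A\otimes A$ under $p\otimes q\mapsto pS(q)$), and let $$A_0=\mathrm{span}\{E_{(1)}p\,S(E_{(2)}q)\mid p,q\in A\}.$$ For every $a\in A$ the expression $E_{(1)}aS(E_{(2)})$ defines an element of $A$: for every $q\in A$ the multiplier $(1\otimes q)E(a\otimes1)$ lies in $A\otimes A$, and $E_{(1)}aS(E_{(2)})$ is the element $z$ with $zS(q)=E_{(1)}aS(qE_{(2)})$ for all $q$; it depends linearly on $a$. Moreover: (1) $A_0=\{E_{(1)}aS(E_{(2)})\mid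 a\in A\}=\mathrm{span}\{\alpha_a(x)\mid a,x\in A\}$. (2) $A_0$ is a subalgebra of $A$, its product is non-degenerate, and $A_0A=AA_0=A$. (3) $A_0=\{a\in A\mid ay=ya\ \text{for all } y\in\varepsilon_s(A)\}$. (4) $M(A_0)=\{m\in M(A)\mid my=ym\ \text{for all } y\in\varepsilon_s(A)\}$; that is, there is an injective unital algebra homomorphism $j:M(A_0)\to M(A)$ with $j(n)x=nx$ and $x\,j(n)=xn$ for all $n\in M(A_0)$, $x\in A_0$, and its image is the commutant of $\varepsilon_s(A)$ in $M(A)$. (5) $A_0$ is a left $A$-module algebra under $a\rhd x=\alpha_a(x)$: $\alpha_a$ maps $A_0$ into itself for every $a\in A$, $A_0$ is a non-degenerate idempotent algebra, $(ab)\rhd x=a\rhd(b\rhd x)$, $A\rhd A_0=A_0$, and $a\rhd(xy)=\sum(a_{(1)}\rhd x)(a_{(2)}\rhd y)$ for all $a,b\in A$, $x,y\in A_0$, where the last sum is the product map applied to $\Delta(a)\rhd(x\otimes y)$, with $\Delta(a)\rhd(c\rhd x'\otimes b\rhd y')=(\Delta(a)(c\otimes b))\rhd(x'\otimes y')$ for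 all $b,c\in A$, $x',y'\in A_0$. -/

import Mathlib

open scoped TensorProduct

noncomputable section

namespace WMHA

section Multipliers

variable (A : Type*) [NonUnitalRing A] [Module ℂ A] [IsScalarTower ℂ A A] [SMulCommClass ℂ A A]

/-- The product of `A` is non-degenerate. -/
def IsNondegenerate : Prop :=
  (∀ a : A, (∀ b, a * b = 0) → a = 0) ∧ (∀ a : A, (∀ b, b * a = 0) → a = 0)

/-- `A` is idempotent: `A` is the linear span of the products `a * b`. -/
def IsIdempotentAlgebra : Prop := LinearMap.range (LinearMap.mul' ℂ A) = ⊤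

/-- The multiplier algebra `M(A)`: pairs `(l, r)` of a left and a right multiplier with
`r(a) b = a l(b)`. Right multipliers compose in the opposite order. -/
def multiplierSubalgebra : Subalgebra ℂ (Module.End ℂ A × (Module.End ℂ A)ᵐᵒᵖ) where
  carrier := {p | (∀ a b, p.1 (a * b) = p.1 a * b) ∧
    (∀ a b, p.2.unop (a * b) = a * p.2.unop b) ∧ ∀ a b, p.2.unop a * b = a * p.1 b}
  mul_mem' := by
    rintro p q ⟨h1, h2, h3⟩ ⟨k1, k2, k3⟩
    refine ⟨?_, ?_, ?_⟩ <;> intro a b <;>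
      simp [Module.End.mul_apply, h1, h2, h3, k1, k2, k3]
  add_mem' := by
    rintro p q ⟨h1, h2, h3⟩ ⟨k1, k2, k3⟩
    refine ⟨?_, ?_, ?_⟩ <;> intro a b <;>
      simp [h1, h2, h3, k1, k2, k3, add_mul, mul_add]
  algebraMap_mem' := by
    intro c
    refine ⟨?_, ?_, ?_⟩ <;> intro a b <;>
      simp [Module.algebraMap_end_apply, smul_mul_assoc, mul_smul_comm]

/-- `M(A)`, as a unital algebra. -/
abbrev Multiplier : Type _ := ↥(multiplierSubalgebra A)

end Multipliers

namespace Multiplier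

variable {A : Type*} [NonUnitalRing A] [Module ℂ A] [IsScalarTower ℂ A A] [SMulCommClass ℂ A A]
variable {B : Type*} [NonUnitalRing B] [Module ℂ B] [IsScalarTower ℂ B B] [SMulCommClass ℂ B B]

/-- `m.left a = m a`. -/
def left (m : Multiplier A) : A →ₗ[ℂ] A := m.1.1

/-- `m.right a = a m`. -/
def right (m : Multiplier A) : A →ₗ[ℂ] A := m.1.2.unop

/-- The canonical map `A → M(A)`. -/
def of : A →ₗ[ℂ] Multiplier A where
  toFun a := ⟨(LinearMap.mulLeft ℂ a, MulOpposite.op (LinearMap.mulRight ℂ a)), by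
    refine ⟨?_, ?_, ?_⟩ <;> intro x y <;> simp [mul_assoc]⟩
  map_add' a b := by
    apply Subtype.ext
    apply Prod.ext
    · ext x; simp [add_mul]
    · apply MulOpposite.unop_injective; ext x; simp [mul_add]
  map_smul' c a := by
    apply Subtype.ext
    apply Prod.ext
    · ext x; simp [smul_mul_assoc]
    · apply MulOpposite.unop_injective; ext x; simp [mul_smul_comm]

/-- Transport of multipliers along an isomorphism of algebras. -/
def congr (e : A ≃ₗ[ℂ] B) (he : ∀ x y, e (x * y) = e x * e y) (m : Multiplier A) :
    Multiplier B :=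
  ⟨(e.toLinearMap ∘ₗ m.left ∘ₗ e.symm.toLinearMap,
    MulOpposite.op (e.toLinearMap ∘ₗ m.right ∘ₗ e.symm.toLinearMap)), by
    have hs : ∀ x y, e.symm (x * y) = e.symm x * e.symm y := fun x y => by
      apply e.injective; simp [he]
    obtain ⟨m, h1, h2, h3⟩ := m
    refine ⟨?_, ?_, ?_⟩
    · intro x y; simp [left, hs, h1, he]
    · intro x y; simp [right, hs, h2, he]
    · intro x y
      have := congrArg e (h3 (e.symm x) (e.symm y))
      simpa [left, right, he] using this⟩

/-- The canonical map `M(A) × M(B) → M(A ⊗ B)`, `(m, n) ↦ m ⊗ n`. -/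
def tmulFun (m : Multiplier A) (n : Multiplier B) : Multiplier (A ⊗[ℂ] B) :=
  ⟨(TensorProduct.map m.left n.left, MulOpposite.op (TensorProduct.map m.right n.right)), by
    obtain ⟨m, h1, h2, h3⟩ := m
    obtain ⟨n, k1, k2, k3⟩ := n
    refine ⟨?_, ?_, ?_⟩ <;> intro x y
    · induction x with
      | zero => simp
      | add x x' hx hx' => simp only [add_mul, map_add, hx, hx']
      | tmul a b =>
        induction y with
        | zero => simp
        | add y y' hy hy' => simp only [mul_add, map_add, hy, hy']
        | tmul c d => simp [left, h1, k1]
    · induction x with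
      | zero => simp
      | add x x' hx hx' => simp only [add_mul, map_add, hx, hx']
      | tmul a b =>
        induction y with
        | zero => simp
        | add y y' hy hy' => simp only [mul_add, map_add, hy, hy']
        | tmul c d => simp [right, h2, k2]
    · induction x with
      | zero => simp
      | add x x' hx hx' => simp only [add_mul, map_add, hx, hx']
      | tmul a b =>
        induction y with
        | zero => simp
        | add y y' hy hy' => simp only [mul_add, map_add, hy, hy']
        | tmul c d => simp [left, right, h3, k3]⟩

/-- `tmulFun` as a bilinear map. -/
def tmul : Multiplier A →ₗ[ℂ] Multiplier B →ₗ[ℂ] Multiplier (A ⊗[ℂ] B) :=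
  LinearMap.mk₂ ℂ tmulFun
    (fun m m' n => by
      apply Subtype.ext
      apply Prod.ext
      · exact TensorProduct.map_add_left m.left m'.left n.left
      · exact congrArg MulOpposite.op (TensorProduct.map_add_left m.right m'.right n.right))
    (fun c m n => by
      apply Subtype.ext
      apply Prod.ext
      · exact TensorProduct.map_smul_left c m.left n.left
      · exact congrArg MulOpposite.op (TensorProduct.map_smul_left c m.right n.right))
    (fun m n n' => by
      apply Subtype.ext
      apply Prod.ext
      · exact TensorProduct.map_add_right m.left n.left n'.left
      · exact congrArg MulOpposite.op (TensorProduct.map_add_right m.right n.right n'.right))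
    (fun c m n => by
      apply Subtype.ext
      apply Prod.ext
      · exact TensorProduct.map_smul_right c m.left n.left
      · exact congrArg MulOpposite.op (TensorProduct.map_smul_right c m.right n.right))

/-- The flip `M(A ⊗ A) → M(A ⊗ A)` induced by `a ⊗ b ↦ b ⊗ a`. -/
def flip (m : Multiplier (A ⊗[ℂ] A)) : Multiplier (A ⊗[ℂ] A) :=
  congr (TensorProduct.comm ℂ A A) (fun x y => by
    induction x with
    | zero => simp
    | add x x' hx hx' => simp only [add_mul, map_add, hx, hx']
    | tmul a b =>
      induction y with
      | zero => simp
      | add y y' hy hy' => simp only [mul_add, map_add, hy, hy']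
      | tmul c d => simp) m

/-- The identification `M((A ⊗ A) ⊗ A) → M(A ⊗ (A ⊗ A))`. -/
def assoc (m : Multiplier ((A ⊗[ℂ] A) ⊗[ℂ] A)) : Multiplier (A ⊗[ℂ] (A ⊗[ℂ] A)) :=
  congr (TensorProduct.assoc ℂ A A A) (fun x y => by
    induction x with
    | zero => simp
    | add x x' hx hx' => simp only [add_mul, map_add, hx, hx']
    | tmul u c =>
      induction u with
      | zero => simp
      | add u u' hu hu' => simp only [TensorProduct.add_tmul, add_mul, map_add, hu, hu']
      | tmul a b =>
        induction y with
        | zero => simp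
        | add y y' hy hy' => simp only [mul_add, map_add, hy, hy']
        | tmul v f =>
          induction v with
          | zero => simp
          | add v v' hv hv' => simp only [TensorProduct.add_tmul, mul_add, map_add, hv, hv']
          | tmul d e => simp) m

/-- `X` is the value at `m` of the extension of the homomorphism `γ : B → M(A)` to `M(B)` that
sends `1` to the idempotent `e`, where `γ(B) A = e A` and `A γ(B) = A e`. -/
structure IsExtensionValue (γ : B →ₗ[ℂ] Multiplier A) (e : Multiplier A) (m : Multiplier B)
    (X : Multiplier A) : Prop where
  mul_left : ∀ b, X * γ b = γ (m.left b)
  mul_right : ∀ b, γ b * X = γ (m.right b)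
  mul_idem : X * e = X
  idem_mul : e * X = X

end Multiplier

open Multiplier

/-- A weak multiplier Hopf algebra structure on the algebra `A`. All data are determined by the
coproduct `Δ`. The maps `T₁`, `T₂` record that `Δ(a)(1 ⊗ b)` and `(a ⊗ 1)Δ(b)` lie in `A ⊗ A`. -/
structure WeakMultiplierHopfAlgebra (A : Type*) [NonUnitalRing A] [Module ℂ A]
    [IsScalarTower ℂ A A] [SMulCommClass ℂ A A] where
  nondegenerate : IsNondegenerate A
  idempotent : IsIdempotentAlgebra A
  /-- the coproduct -/
  Δ : A →ₙₐ[ℂ] Multiplier (A ⊗[ℂ] A)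
  /-- `T₁(a ⊗ b) = Δ(a)(1 ⊗ b)` -/
  T₁ : A ⊗[ℂ] A →ₗ[ℂ] A ⊗[ℂ] A
  /-- `T₂(a ⊗ b) = (a ⊗ 1)Δ(b)` -/
  T₂ : A ⊗[ℂ] A →ₗ[ℂ] A ⊗[ℂ] A
  of_T₁ : ∀ a b, of (T₁ (a ⊗ₜ b)) = Δ a * tmul 1 (of b)
  of_T₂ : ∀ a b, of (T₂ (a ⊗ₜ b)) = tmul (of a) 1 * Δ b
  /-- coassociativity:
  `(c ⊗ 1 ⊗ 1)(Δ ⊗ ι)(Δ(a)(1 ⊗ b)) = (ι ⊗ Δ)((c ⊗ 1)Δ(a))(1 ⊗ 1 ⊗ b)` -/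
  coassoc : ∀ a b c : A,
    TensorProduct.assoc ℂ A A A
      (TensorProduct.map T₂ LinearMap.id
        ((TensorProduct.assoc ℂ A A A).symm (c ⊗ₜ T₁ (a ⊗ₜ b)))) =
    TensorProduct.map LinearMap.id T₁
      (TensorProduct.assoc ℂ A A A (T₂ (c ⊗ₜ a) ⊗ₜ b))
  /-- the coproduct is full: a subspace `V` with `Δ(A)(1 ⊗ A) ⊆ V ⊗ A` is all of `A` -/
  full_left : ∀ V : Submodule ℂ A,
    LinearMap.range T₁ ≤ LinearMap.range (TensorProduct.map V.subtype LinearMap.id) → V = ⊤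
  full_right : ∀ W : Submodule ℂ A,
    LinearMap.range T₂ ≤ LinearMap.range (TensorProduct.map LinearMap.id W.subtype) → W = ⊤
  /-- the counit -/
  ε : A →ₗ[ℂ] ℂ
  counit_left : ∀ a b,
    TensorProduct.lid ℂ A (TensorProduct.map ε LinearMap.id (T₁ (a ⊗ₜ b))) = a * b
  counit_right : ∀ a b,
    TensorProduct.rid ℂ A (TensorProduct.map LinearMap.id ε (T₂ (a ⊗ₜ b))) = a * b
  /-- the canonical idempotent -/
  E : Multiplier (A ⊗[ℂ] A)
  E_mul_E : E * E = E
  range_T₁ : LinearMap.range E.left = LinearMap.range T₁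
  range_T₂ : LinearMap.range E.right = LinearMap.range T₂
  /-- `(E ⊗ 1)(1 ⊗ E) = (1 ⊗ E)(E ⊗ 1)` -/
  E_comm : assoc (tmul E 1) * tmul 1 E = tmul 1 E * assoc (tmul E 1)
  /-- `(ι ⊗ Δ)E = (E ⊗ 1)(1 ⊗ E)`, where `ι ⊗ Δ` is extended to `M(A ⊗ A)` with
  `(ι ⊗ Δ)(1) = 1 ⊗ E` -/
  id_Δ_E : IsExtensionValue
    (TensorProduct.lift ((tmul (A := A) (B := A ⊗[ℂ] A)).compl₁₂ of (Δ : A →ₗ[ℂ] _)))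
    (tmul 1 E) E (assoc (tmul E 1) * tmul 1 E)
  G₁ : A ⊗[ℂ] A →ₗ[ℂ] A ⊗[ℂ] A
  G₂ : A ⊗[ℂ] A →ₗ[ℂ] A ⊗[ℂ] A
  /-- `(G₁ ⊗ ι)(Δ₁₃(a)(1 ⊗ u)) = Δ₁₃(a)(1 ⊗ E)(1 ⊗ u)` for `u ∈ A ⊗ A`. Conjugating `ι ⊗ T₁` by
  the exchange of the first two tensor factors gives `a ⊗ u ↦ Δ₁₃(a)(1 ⊗ u)`. -/
  G₁_spec : ∀ (a : A) (u : A ⊗[ℂ] A),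
    TensorProduct.assoc ℂ A A A (TensorProduct.map G₁ LinearMap.id
      ((TensorProduct.assoc ℂ A A A).symm
        (TensorProduct.leftComm ℂ A A A (TensorProduct.map LinearMap.id T₁
          (TensorProduct.leftComm ℂ A A A (a ⊗ₜ u)))))) =
    TensorProduct.leftComm ℂ A A A (TensorProduct.map LinearMap.id T₁
      (TensorProduct.leftComm ℂ A A A (a ⊗ₜ E.left u)))
  /-- `(ι ⊗ G₂)((u ⊗ 1)Δ₁₃(c)) = (u ⊗ 1)(E ⊗ 1)Δ₁₃(c)` for `u ∈ A ⊗ A`. Conjugating `T₂ ⊗ ι` by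
  the exchange of the last two tensor factors gives `u ⊗ c ↦ (u ⊗ 1)Δ₁₃(c)`. -/
  G₂_spec : ∀ (u : A ⊗[ℂ] A) (c : A),
    TensorProduct.map LinearMap.id G₂ (TensorProduct.assoc ℂ A A A
      (TensorProduct.rightComm ℂ A A A (TensorProduct.map T₂ LinearMap.id
        (TensorProduct.rightComm ℂ A A A (u ⊗ₜ c))))) =
    TensorProduct.assoc ℂ A A A
      (TensorProduct.rightComm ℂ A A A (TensorProduct.map T₂ LinearMap.id
        (TensorProduct.rightComm ℂ A A A (E.right u ⊗ₜ c))))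
  ker_T₁ : LinearMap.ker T₁ = LinearMap.range (LinearMap.id - G₁)
  ker_T₂ : LinearMap.ker T₂ = LinearMap.range (LinearMap.id - G₂)

/-- A regular weak multiplier Hopf algebra: `Δ` is regular and the opposite coproduct
`Δ^{cop}` also makes `A` a weak multiplier Hopf algebra. -/
structure RegularWeakMultiplierHopfAlgebra (A : Type*) [NonUnitalRing A] [Module ℂ A]
    [IsScalarTower ℂ A A] [SMulCommClass ℂ A A] extends WeakMultiplierHopfAlgebra A where
  /-- `T₃(a ⊗ b) = (1 ⊗ b)Δ(a)` -/
  T₃ : A ⊗[ℂ] A →ₗ[ℂ] A ⊗[ℂ] A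
  /-- `T₄(a ⊗ b) = Δ(b)(a ⊗ 1)` -/
  T₄ : A ⊗[ℂ] A →ₗ[ℂ] A ⊗[ℂ] A
  of_T₃ : ∀ a b, of (T₃ (a ⊗ₜ b)) = tmul 1 (of b) * Δ a
  of_T₄ : ∀ a b, of (T₄ (a ⊗ₜ b)) = Δ b * tmul (of a) 1
  cop : WeakMultiplierHopfAlgebra A
  cop_Δ : ∀ a, cop.Δ a = flip (Δ a)

/-- `R` is the generalized inverse of `T` with `T R = P` and `R T = Q`. -/
structure IsGeneralizedInverse {V : Type*} [AddCommGroup V] [Module ℂ V]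
    (T P Q R : V →ₗ[ℂ] V) : Prop where
  comp_right : T ∘ₗ R = P
  comp_left : R ∘ₗ T = Q
  reflexive : R ∘ₗ T ∘ₗ R = R

namespace RegularWeakMultiplierHopfAlgebra

variable {A : Type*} [NonUnitalRing A] [Module ℂ A] [IsScalarTower ℂ A A] [SMulCommClass ℂ A A]
variable (H : RegularWeakMultiplierHopfAlgebra A)

/-- `S : A → A` is the antipode: `S(a)b = (ε ⊗ ι)R₁(a ⊗ b)` and `bS(a) = (ι ⊗ ε)R₂(b ⊗ a)`, where
`R₁`, `R₂` are the generalized inverses of `T₁`, `T₂` determined by `E`, `G₁` and `G₂`. -/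
def IsAntipode (S : A →ₗ[ℂ] A) : Prop :=
  ∃ R₁ R₂ : A ⊗[ℂ] A →ₗ[ℂ] A ⊗[ℂ] A,
    IsGeneralizedInverse H.T₁ H.E.left H.G₁ R₁ ∧
    IsGeneralizedInverse H.T₂ H.E.right H.G₂ R₂ ∧
    (∀ a b, S a * b =
      TensorProduct.lid ℂ A (TensorProduct.map H.ε LinearMap.id (R₁ (a ⊗ₜ b)))) ∧
    (∀ a b, b * S a =
      TensorProduct.rid ℂ A (TensorProduct.map LinearMap.id H.ε (R₂ (b ⊗ₜ a))))

open Classical in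
/-- The antipode. -/
def antipode : A →ₗ[ℂ] A := if h : ∃ S, H.IsAntipode S then h.choose else 0

/-- `p ⊗ q ↦ p S(q)`. -/
def mulAntipode : A ⊗[ℂ] A →ₗ[ℂ] A :=
  LinearMap.mul' ℂ A ∘ₗ TensorProduct.map LinearMap.id H.antipode

/-- `f = ε_s : A → M(A)`, `ε_s(a) = ∑ S(a₁) a₂`, that is `ε_s(a) b = ∑ S(a₁) a₂ b`. -/
def IsSourceMap (f : A →ₗ[ℂ] Multiplier A) : Prop :=
  ∀ a b, (f a).left b =
    LinearMap.mul' ℂ A (TensorProduct.map H.antipode LinearMap.id (H.T₁ (a ⊗ₜ b)))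

open Classical in
/-- The source map `ε_s`. -/
def sourceMap : A →ₗ[ℂ] Multiplier A := if h : ∃ f, H.IsSourceMap f then h.choose else 0

/-- `α_a(x) = ∑ a₁ x S(a₂)`, the image of `Δ(a)(x ⊗ 1)` under `p ⊗ q ↦ p S(q)`. -/
def adj (a x : A) : A := H.mulAntipode (H.T₄ (x ⊗ₜ a))

/-- `A₀ = span {E₁ p S(E₂ q) | p, q ∈ A}`. -/
def adjSpace : Submodule ℂ A :=
  Submodule.span ℂ {z | ∃ p q : A, z = H.mulAntipode (H.E.left (p ⊗ₜ q))}

/-- `z = E₁ a S(E₂)`: for all `q`, the element `(1 ⊗ q)E(a ⊗ 1)` lies in `A ⊗ A` and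
`z S(q) = E₁ a S(q E₂)`. -/
def IsSandwich (a z : A) : Prop :=
  ∀ q : A, ∃ t : A ⊗[ℂ] A, of t = tmul 1 (of q) * H.E * tmul (of a) 1 ∧
    z * H.antipode q = H.mulAntipode t

end RegularWeakMultiplierHopfAlgebra

/-- The action of `A ⊗ A` on `R ⊗ R`, `(a ⊗ b)(r ⊗ s) = ar ⊗ bs`. -/
def tensorAction {A R : Type*} [AddCommGroup A] [Module ℂ A] [AddCommGroup R] [Module ℂ R]
    (act : A →ₗ[ℂ] R →ₗ[ℂ] R) : A ⊗[ℂ] A →ₗ[ℂ] R ⊗[ℂ] R →ₗ[ℂ] R ⊗[ℂ] R :=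
  TensorProduct.homTensorHomMap (RingHom.id ℂ) R R R R ∘ₗ TensorProduct.map act act

/-- `R` is a left module algebra over `A` under `act`: a non-degenerate idempotent algebra that is
a unital left `A`-module, with `a(xy) = m(Δ(a)(x ⊗ y))`. The elements of `R` have the form
`∑ c x`, and `Δ(a)(cx ⊗ by) = (Δ(a)(c ⊗ b))(x ⊗ y)` is the action of `Δ(a) ∈ M(A ⊗ A)`. -/
structure IsModuleAlgebra {A R : Type*} [NonUnitalRing A] [Module ℂ A] [IsScalarTower ℂ A A]
    [SMulCommClass ℂ A A] [NonUnitalRing R] [Module ℂ R] [IsScalarTower ℂ R R]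
    [SMulCommClass ℂ R R] (H : WeakMultiplierHopfAlgebra A) (act : A →ₗ[ℂ] R →ₗ[ℂ] R) :
    Prop where
  nondegenerate : IsNondegenerate R
  idempotent : IsIdempotentAlgebra R
  mul_act : ∀ a b r, act (a * b) r = act a (act b r)
  unital : Submodule.map₂ act ⊤ ⊤ = ⊤
  act_mul : ∀ a b c x y, act a (act c x * act b y) =
    LinearMap.mul' ℂ R (tensorAction act ((H.Δ a).left (c ⊗ₜ b)) (x ⊗ₜ y))

end WMHA

end

open scoped TensorProduct

noncomputable section

/-! Everything rests on one formula and one bijection. The formula is `ε_s(a₁) ⊗ a₂ = (1 ⊗ a)E`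
(`es_legLeft_T₁`), which is the counit applied to the axiom for `G₁`. It identifies the first legs
of `(1 ⊗ a)E` with values of the source map. The bijection is the antipode, which is a priori only
multiplier-valued.

For the antipode, `R₁` is characterised by `T₁R₁ = E` and `G₁R₁ = R₁` (`R₁_eq`), so every identity
for `T₁`, `E` and `G₁` passes to `R₁`, in particular coassociativity. This yields
antimultiplicativity (`s_mul`) and, formally, `R₁(b ⊗ c) = b₁ ⊗ S(b₂)c`. Regularity supplies an
antipode `S'` of the opposite algebra. Since `S` intertwines `R₃` with `T₁` (`onRight_σ_R₃`), it
follows that `S(bS'(a)) = aS(b)`. The elements `bS'(a)` span `A`, so `S` takes values in `A`, and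
`S'` is a right inverse of the surjection `S` (`exists_S`, `S_op_S`).

The map `π(a) = E₁aS(E₂)` has range `A₀`. If `y` is a slice of the first leg of `E`, then `yb₁ ⊗ b₂
= b₁ ⊗ y'b₂` with `S(y'x) = S(x)y`, so `y` commutes with `b₁S(b₂e)`; these elements span `A₀`
(`mul_esMul_of_mem`). Conversely, if `z` commutes with `ε_s(A)`, then `z ⊗ 1` commutes with `E`,
hence `π(z)S(q)` is the image of `(z ⊗ q)E` under `p ⊗ q ↦ pS(q)`, which is `zS(q)`. Thus `π(z) = z`
(`π_eq_self`), and `A₀` is the commutant of `ε_s(A)`.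

Non-degeneracy, `A₀A = AA₀ = A` and the embedding of `M(A₀)` all follow from local units for `A`
inside `A₀` (`exists_mem_A₀_mul_eq`). They come from local units in `A` itself (`exists_mul_eq`): if
`at = t` for the relevant elements `t`, then `π(a)` fixes the given one. The module algebra law is
coassociativity combined with `g(c ▹ x) = (g₁c ▹ x)g₂` (`adjMap_T₄`).

The axioms are first rewritten as identities between operators on `A ⊗ A`, with threefold tensors
sliced by functionals. In this form they are stable under passing to the opposite product and to the
opposite coproduct, so each argument serves up to four times. -/

namespace WMHA

/-! ### Slices of tensors by functionals -/

section Slices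

variable {U V W X : Type*} [AddCommGroup U] [Module ℂ U] [AddCommGroup V] [Module ℂ V]
  [AddCommGroup W] [Module ℂ W] [AddCommGroup X] [Module ℂ X]

/-- `θ ⊗ ι`. -/
def onLeft (θ : U →ₗ[ℂ] V) : U ⊗[ℂ] W →ₗ[ℂ] V ⊗[ℂ] W := TensorProduct.map θ LinearMap.id

/-- `ι ⊗ θ`. -/
def onRight (θ : U →ₗ[ℂ] V) : W ⊗[ℂ] U →ₗ[ℂ] W ⊗[ℂ] V := TensorProduct.map LinearMap.id θ

/-- The slice map `ω ⊗ ι`. -/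
def sliceLeft (ω : V →ₗ[ℂ] ℂ) : V ⊗[ℂ] W →ₗ[ℂ] W :=
  (TensorProduct.lid ℂ W).toLinearMap ∘ₗ TensorProduct.map ω LinearMap.id

/-- The slice map `ι ⊗ ω`. -/
def sliceRight (ω : W →ₗ[ℂ] ℂ) : V ⊗[ℂ] W →ₗ[ℂ] V :=
  (TensorProduct.rid ℂ V).toLinearMap ∘ₗ TensorProduct.map LinearMap.id ω

@[simp] lemma onLeft_tmul (θ : U →ₗ[ℂ] V) (u : U) (w : W) :
    onLeft θ (u ⊗ₜ[ℂ] w) = θ u ⊗ₜ w := rfl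

@[simp] lemma onRight_tmul (θ : U →ₗ[ℂ] V) (u : U) (w : W) :
    onRight θ (w ⊗ₜ[ℂ] u) = w ⊗ₜ θ u := rfl

@[simp] lemma sliceLeft_tmul (ω : V →ₗ[ℂ] ℂ) (v : V) (w : W) :
    sliceLeft ω (v ⊗ₜ[ℂ] w) = ω v • w := rfl

@[simp] lemma sliceRight_tmul (ω : W →ₗ[ℂ] ℂ) (v : V) (w : W) :
    sliceRight ω (v ⊗ₜ[ℂ] w) = ω w • v := rfl

lemma eq_of_tmul {f g : U ⊗[ℂ] V →ₗ[ℂ] W} (h : ∀ u v, f (u ⊗ₜ v) = g (u ⊗ₜ v))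
    (z : U ⊗[ℂ] V) : f z = g z :=
  DFunLike.congr_fun (TensorProduct.ext' h) z

lemma onLeft_onLeft (θ : U →ₗ[ℂ] V) (φ : V →ₗ[ℂ] X) (z : U ⊗[ℂ] W) :
    onLeft φ (onLeft θ z) = onLeft (φ ∘ₗ θ) z :=
  eq_of_tmul (f := onLeft φ ∘ₗ onLeft θ) (g := onLeft (φ ∘ₗ θ)) (fun _ _ => rfl) z

lemma onRight_onRight (θ : U →ₗ[ℂ] V) (φ : V →ₗ[ℂ] X) (z : W ⊗[ℂ] U) :
    onRight φ (onRight θ z) = onRight (φ ∘ₗ θ) z :=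
  eq_of_tmul (f := onRight φ ∘ₗ onRight θ) (g := onRight (φ ∘ₗ θ)) (fun _ _ => rfl) z

lemma onLeft_onRight (θ : U →ₗ[ℂ] V) (φ : W →ₗ[ℂ] X) (z : U ⊗[ℂ] W) :
    onLeft θ (onRight φ z) = onRight φ (onLeft θ z) :=
  eq_of_tmul (f := onLeft θ ∘ₗ onRight φ) (g := onRight φ ∘ₗ onLeft θ) (fun _ _ => rfl) z

lemma sliceLeft_onLeft (θ : U →ₗ[ℂ] V) (ω : V →ₗ[ℂ] ℂ) (z : U ⊗[ℂ] W) :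
    sliceLeft ω (onLeft θ z) = sliceLeft (ω ∘ₗ θ) z :=
  eq_of_tmul (f := sliceLeft ω ∘ₗ onLeft θ) (g := sliceLeft (ω ∘ₗ θ)) (fun _ _ => by simp) z

lemma sliceRight_onRight (θ : U →ₗ[ℂ] V) (ω : V →ₗ[ℂ] ℂ) (z : W ⊗[ℂ] U) :
    sliceRight ω (onRight θ z) = sliceRight (ω ∘ₗ θ) z :=
  eq_of_tmul (f := sliceRight ω ∘ₗ onRight θ) (g := sliceRight (ω ∘ₗ θ)) (fun _ _ => by simp) z

lemma sliceLeft_onRight (θ : U →ₗ[ℂ] V) (ω : W →ₗ[ℂ] ℂ) (z : W ⊗[ℂ] U) :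
    sliceLeft ω (onRight θ z) = θ (sliceLeft ω z) :=
  eq_of_tmul (f := sliceLeft ω ∘ₗ onRight θ) (g := θ ∘ₗ sliceLeft ω)
    (fun _ _ => by simp) z

lemma sliceRight_onLeft (θ : U →ₗ[ℂ] V) (ω : W →ₗ[ℂ] ℂ) (z : U ⊗[ℂ] W) :
    sliceRight ω (onLeft θ z) = θ (sliceRight ω z) :=
  eq_of_tmul (f := sliceRight ω ∘ₗ onLeft θ) (g := θ ∘ₗ sliceRight ω)
    (fun _ _ => by simp) z

lemma apply_sliceLeft (ω : V →ₗ[ℂ] ℂ) (μ : W →ₗ[ℂ] ℂ) (z : V ⊗[ℂ] W) :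
    μ (sliceLeft ω z) = ω (sliceRight μ z) :=
  eq_of_tmul (f := μ ∘ₗ sliceLeft ω) (g := ω ∘ₗ sliceRight μ)
    (fun _ _ => by simp [mul_comm]) z

lemma eq_of_forall_dual {v w : V} (h : ∀ ω : V →ₗ[ℂ] ℂ, ω v = ω w) : v = w := by
  rw [← sub_eq_zero]
  refine (Module.forall_dual_apply_eq_zero_iff ℂ (v - w)).1 fun ω => ?_
  rw [map_sub, sub_eq_zero]
  exact h ω

lemma eq_of_sliceLeft {z z' : V ⊗[ℂ] W}
    (h : ∀ ω : V →ₗ[ℂ] ℂ, sliceLeft ω z = sliceLeft ω z') : z = z' := by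
  classical
  let b := Module.Basis.ofVectorSpace ℂ V
  apply (TensorProduct.equivFinsuppOfBasisLeft (N := W) b).injective
  ext i
  have key : ∀ x : V ⊗[ℂ] W,
      TensorProduct.equivFinsuppOfBasisLeft (N := W) b x i = sliceLeft (b.coord i) x := by
    intro x
    induction x with
    | zero => simp
    | add x y hx hy => simp [hx, hy]
    | tmul v w => simp
  rw [key, key, h]

lemma eq_of_sliceRight {z z' : V ⊗[ℂ] W}
    (h : ∀ ω : W →ₗ[ℂ] ℂ, sliceRight ω z = sliceRight ω z') : z = z' :=
  eq_of_sliceLeft fun ω => eq_of_forall_dual fun μ => by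
    rw [apply_sliceLeft, apply_sliceLeft, h]

/-- A tensor whose slices lie in a subspace `Y` lies in `V ⊗ Y`. -/
lemma mem_range_onRight {Y : Submodule ℂ W} {z : V ⊗[ℂ] W}
    (h : ∀ ω : V →ₗ[ℂ] ℂ, sliceLeft ω z ∈ Y) :
    z ∈ LinearMap.range (onRight (W := V) Y.subtype) := by
  have hq : onRight (W := V) Y.mkQ z = 0 := eq_of_sliceLeft fun ω => by
    rw [sliceLeft_onRight, map_zero]
    simpa using h ω
  have hex : Function.Exact (onRight (W := V) Y.subtype) (onRight (W := V) Y.mkQ) :=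
    lTensor_exact V (LinearMap.exact_subtype_mkQ Y) (Submodule.mkQ_surjective Y)
  exact (hex z).1 hq

lemma mem_range_onLeft {Y : Submodule ℂ V} {z : V ⊗[ℂ] W}
    (h : ∀ ω : W →ₗ[ℂ] ℂ, sliceRight ω z ∈ Y) :
    z ∈ LinearMap.range (onLeft (W := W) Y.subtype) := by
  have hq : onLeft (W := W) Y.mkQ z = 0 := eq_of_sliceRight fun ω => by
    rw [sliceRight_onLeft, map_zero]
    simpa using h ω
  have hex : Function.Exact (onLeft (W := W) Y.subtype) (onLeft (W := W) Y.mkQ) :=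
    rTensor_exact W (LinearMap.exact_subtype_mkQ Y) (Submodule.mkQ_surjective Y)
  exact (hex z).1 hq

end Slices

/-! ### Legs of operators, the flip, and coassociativity leg by leg -/

section Conjugation

variable {A : Type*} [AddCommGroup A] [Module ℂ A]

/-- The operator `b ↦ (ω ⊗ ι) X(c ⊗ b)`. -/
def legRight (X : A ⊗[ℂ] A →ₗ[ℂ] A ⊗[ℂ] A) (c : A) (ω : A →ₗ[ℂ] ℂ) : A →ₗ[ℂ] A :=
  sliceLeft ω ∘ₗ X ∘ₗ TensorProduct.mk ℂ A A c

/-- The operator `a ↦ (ι ⊗ ω) X(a ⊗ d)`. -/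
def legLeft (X : A ⊗[ℂ] A →ₗ[ℂ] A ⊗[ℂ] A) (d : A) (ω : A →ₗ[ℂ] ℂ) : A →ₗ[ℂ] A :=
  sliceRight ω ∘ₗ X ∘ₗ (TensorProduct.mk ℂ A A).flip d

lemma legRight_apply (X : A ⊗[ℂ] A →ₗ[ℂ] A ⊗[ℂ] A) (c : A) (ω : A →ₗ[ℂ] ℂ) (b : A) :
    legRight X c ω b = sliceLeft ω (X (c ⊗ₜ b)) := rfl

lemma legLeft_apply (X : A ⊗[ℂ] A →ₗ[ℂ] A ⊗[ℂ] A) (d : A) (ω : A →ₗ[ℂ] ℂ) (a : A) :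
    legLeft X d ω a = sliceRight ω (X (a ⊗ₜ d)) := rfl

/-- Conjugation by the flip of `A ⊗ A`. -/
def flipConj (X : A ⊗[ℂ] A →ₗ[ℂ] A ⊗[ℂ] A) : A ⊗[ℂ] A →ₗ[ℂ] A ⊗[ℂ] A :=
  (TensorProduct.comm ℂ A A).toLinearMap ∘ₗ X ∘ₗ (TensorProduct.comm ℂ A A).toLinearMap

/-- The flip of `A ⊗ A`. -/
def swap : A ⊗[ℂ] A →ₗ[ℂ] A ⊗[ℂ] A := (TensorProduct.comm ℂ A A).toLinearMap

@[simp] lemma swap_tmul (a b : A) : swap (a ⊗ₜ[ℂ] b) = b ⊗ₜ a := rfl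

@[simp] lemma swap_swap (z : A ⊗[ℂ] A) : swap (swap z) = z :=
  eq_of_tmul (f := swap ∘ₗ swap) (g := LinearMap.id) (fun _ _ => rfl) z

lemma flipConj_apply (X : A ⊗[ℂ] A →ₗ[ℂ] A ⊗[ℂ] A) (z : A ⊗[ℂ] A) :
    flipConj X z = swap (X (swap z)) := rfl

lemma onLeft_swap (θ : A →ₗ[ℂ] A) (z : A ⊗[ℂ] A) : onLeft θ (swap z) = swap (onRight θ z) :=
  eq_of_tmul (f := onLeft θ ∘ₗ swap) (g := swap ∘ₗ onRight θ) (fun _ _ => rfl) z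

lemma onRight_swap (θ : A →ₗ[ℂ] A) (z : A ⊗[ℂ] A) : onRight θ (swap z) = swap (onLeft θ z) :=
  eq_of_tmul (f := onRight θ ∘ₗ swap) (g := swap ∘ₗ onLeft θ) (fun _ _ => rfl) z

@[simp] lemma sliceLeft_swap (ω : A →ₗ[ℂ] ℂ) (z : A ⊗[ℂ] A) :
    sliceLeft ω (swap z) = sliceRight ω z :=
  eq_of_tmul (f := sliceLeft ω ∘ₗ swap) (g := sliceRight ω) (fun _ _ => rfl) z

@[simp] lemma sliceRight_swap (ω : A →ₗ[ℂ] ℂ) (z : A ⊗[ℂ] A) :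
    sliceRight ω (swap z) = sliceLeft ω z :=
  eq_of_tmul (f := sliceRight ω ∘ₗ swap) (g := sliceLeft ω) (fun _ _ => rfl) z

@[simp] lemma legRight_flipConj (X : A ⊗[ℂ] A →ₗ[ℂ] A ⊗[ℂ] A) (c : A) (ω : A →ₗ[ℂ] ℂ) :
    legRight (flipConj X) c ω = legLeft X c ω := by
  ext b
  simp [legRight_apply, legLeft_apply, flipConj_apply]

@[simp] lemma legLeft_flipConj (X : A ⊗[ℂ] A →ₗ[ℂ] A ⊗[ℂ] A) (c : A) (ω : A →ₗ[ℂ] ℂ) :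
    legLeft (flipConj X) c ω = legRight X c ω := by
  ext b
  simp [legRight_apply, legLeft_apply, flipConj_apply]

@[simp] lemma flipConj_flipConj (X : A ⊗[ℂ] A →ₗ[ℂ] A ⊗[ℂ] A) : flipConj (flipConj X) = X := by
  ext a b
  simp [flipConj_apply]

/-- `X₁₂ Y₂₃ = Y₂₃ X₁₂` on `A ⊗ A ⊗ A`, in terms of slices of the first leg. -/
def LegsCommute (X Y : A ⊗[ℂ] A →ₗ[ℂ] A ⊗[ℂ] A) : Prop :=
  ∀ c ω z, onLeft (legRight X c ω) (Y z) = Y (onLeft (legRight X c ω) z)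

/-- Both sides are the slice of `X₁₂Y₂₃(c ⊗ b ⊗ d)` by `ω` on the first leg and `μ` on the third. -/
lemma sliceRight_onLeft_legRight (X Y : A ⊗[ℂ] A →ₗ[ℂ] A ⊗[ℂ] A) (c b d : A)
    (ω μ : A →ₗ[ℂ] ℂ) : sliceRight μ (onLeft (legRight X c ω) (Y (b ⊗ₜ d))) =
      sliceLeft ω (X (onRight (legLeft Y d μ) (c ⊗ₜ b))) := by
  rw [sliceRight_onLeft]; rfl

lemma sliceRight_onLeft_legRight' (X Y : A ⊗[ℂ] A →ₗ[ℂ] A ⊗[ℂ] A) (c b d : A)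
    (ω μ : A →ₗ[ℂ] ℂ) : sliceRight μ (Y (onLeft (legRight X c ω) (b ⊗ₜ d))) =
      sliceLeft ω (onRight (legLeft Y d μ) (X (c ⊗ₜ b))) := by
  rw [sliceLeft_onRight]; rfl

/-- Slicing the two outer legs at once gives a condition symmetric in the two operators.
Coassociativity can therefore be used through first-leg slices of `X` or last-leg slices of `Y`. -/
lemma legsCommute_iff_right {X Y : A ⊗[ℂ] A →ₗ[ℂ] A ⊗[ℂ] A} : LegsCommute X Y ↔
    ∀ d ω z, onRight (legLeft Y d ω) (X z) = X (onRight (legLeft Y d ω) z) := by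
  constructor
  · intro h d μ z
    refine eq_of_tmul (f := onRight (legLeft Y d μ) ∘ₗ X) (g := X ∘ₗ onRight (legLeft Y d μ))
      (fun c b => eq_of_sliceLeft fun ω => ?_) z
    have := congrArg (sliceRight μ) (h c ω (b ⊗ₜ d))
    rw [sliceRight_onLeft_legRight, sliceRight_onLeft_legRight'] at this
    exact this.symm
  · intro h c ω z
    refine eq_of_tmul (f := onLeft (legRight X c ω) ∘ₗ Y) (g := Y ∘ₗ onLeft (legRight X c ω))
      (fun b d => eq_of_sliceRight fun μ => ?_) z
    have := congrArg (sliceLeft ω) (h d μ (c ⊗ₜ b))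
    rw [← sliceRight_onLeft_legRight, ← sliceRight_onLeft_legRight'] at this
    exact this.symm

/-- Reversing the order of the three legs exchanges positions 12 and 23, hence also the roles of `X`
and `Y`. -/
lemma LegsCommute.flipConj {X Y : A ⊗[ℂ] A →ₗ[ℂ] A ⊗[ℂ] A} (h : LegsCommute X Y) :
    LegsCommute (flipConj Y) (flipConj X) := by
  intro c ω z
  simp only [legRight_flipConj, flipConj_apply, onLeft_swap]
  rw [legsCommute_iff_right.1 h, ← onRight_swap]

end Conjugation

/-! ### Sliced axioms and their opposite and coopposite symmetries -/

/-- The structure maps of a regular weak multiplier Hopf algebra, as operators on `A ⊗ A`, with the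
product given as a bilinear map. All the conditions on `A ⊗ A ⊗ A` are sliced with functionals.
`DL a` and `DR a` are the left and the right multiplication with `Δ(a)`, and `L` and `P` are the
left and the right multiplication with the canonical idempotent. -/
structure HopfData (A : Type*) [AddCommGroup A] [Module ℂ A] where
  mul : A →ₗ[ℂ] A →ₗ[ℂ] A
  ε : A →ₗ[ℂ] ℂ
  DL : A → A ⊗[ℂ] A →ₗ[ℂ] A ⊗[ℂ] A
  DR : A → A ⊗[ℂ] A →ₗ[ℂ] A ⊗[ℂ] A
  T₁ : A ⊗[ℂ] A →ₗ[ℂ] A ⊗[ℂ] A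
  T₂ : A ⊗[ℂ] A →ₗ[ℂ] A ⊗[ℂ] A
  T₃ : A ⊗[ℂ] A →ₗ[ℂ] A ⊗[ℂ] A
  T₄ : A ⊗[ℂ] A →ₗ[ℂ] A ⊗[ℂ] A
  G₁ : A ⊗[ℂ] A →ₗ[ℂ] A ⊗[ℂ] A
  G₂ : A ⊗[ℂ] A →ₗ[ℂ] A ⊗[ℂ] A
  G₃ : A ⊗[ℂ] A →ₗ[ℂ] A ⊗[ℂ] A
  G₄ : A ⊗[ℂ] A →ₗ[ℂ] A ⊗[ℂ] A
  L : A ⊗[ℂ] A →ₗ[ℂ] A ⊗[ℂ] A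
  P : A ⊗[ℂ] A →ₗ[ℂ] A ⊗[ℂ] A
  mul_assoc : ∀ a b c, mul (mul a b) c = mul a (mul b c)
  nondeg_left : ∀ a, (∀ b, mul a b = 0) → a = 0
  nondeg_right : ∀ a, (∀ b, mul b a = 0) → a = 0
  idem : ∀ V : Submodule ℂ A, (∀ a b, mul a b ∈ V) → V = ⊤
  T₁_T₂ : ∀ a b c, onLeft (mul c) (T₁ (a ⊗ₜ b)) = onRight (mul.flip b) (T₂ (c ⊗ₜ a))
  T₃_T₄ : ∀ a b c, onLeft (mul.flip c) (T₃ (a ⊗ₜ b)) = onRight (mul b) (T₄ (c ⊗ₜ a))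
  T₁_T₃ : ∀ a b c, onRight (mul c) (T₁ (a ⊗ₜ b)) = onRight (mul.flip b) (T₃ (a ⊗ₜ c))
  T₂_T₄ : ∀ a c d, onLeft (mul c) (T₄ (d ⊗ₜ a)) = onLeft (mul.flip d) (T₂ (c ⊗ₜ a))
  DL_eq_T₁ : ∀ a x b, onLeft (mul.flip x) (T₁ (a ⊗ₜ b)) = DL a (x ⊗ₜ b)
  DL_eq_T₄ : ∀ a x y, onRight (mul.flip y) (T₄ (x ⊗ₜ a)) = DL a (x ⊗ₜ y)
  DR_eq_T₃ : ∀ a x b, onLeft (mul x) (T₃ (a ⊗ₜ b)) = DR a (x ⊗ₜ b)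
  DR_eq_T₂ : ∀ a x y, onRight (mul y) (T₂ (x ⊗ₜ a)) = DR a (x ⊗ₜ y)
  DL_T₁ : ∀ d a b, DL d (T₁ (a ⊗ₜ b)) = T₁ (mul d a ⊗ₜ b)
  DL_T₄ : ∀ d a x, DL d (T₄ (x ⊗ₜ a)) = T₄ (x ⊗ₜ mul d a)
  DR_T₃ : ∀ d a b, DR d (T₃ (a ⊗ₜ b)) = T₃ (mul.flip d a ⊗ₜ b)
  DR_T₂ : ∀ d a x, DR d (T₂ (x ⊗ₜ a)) = T₂ (x ⊗ₜ mul.flip d a)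
  L_P : ∀ u v x y, onLeft (mul u) (onRight (mul v) (L (x ⊗ₜ y))) =
    onLeft (mul.flip x) (onRight (mul.flip y) (P (u ⊗ₜ v)))
  L_T₁ : ∀ z, L (T₁ z) = T₁ z
  L_T₄ : ∀ z, L (T₄ z) = T₄ z
  P_T₂ : ∀ z, P (T₂ z) = T₂ z
  P_T₃ : ∀ z, P (T₃ z) = T₃ z
  exists_T₁ : ∀ z, ∃ w, L z = T₁ w
  exists_T₄ : ∀ z, ∃ w, L z = T₄ w
  exists_T₂ : ∀ z, ∃ w, P z = T₂ w
  exists_T₃ : ∀ z, ∃ w, P z = T₃ w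
  T₁_G₁ : ∀ z, T₁ (G₁ z) = T₁ z
  T₂_G₂ : ∀ z, T₂ (G₂ z) = T₂ z
  T₃_G₃ : ∀ z, T₃ (G₃ z) = T₃ z
  T₄_G₄ : ∀ z, T₄ (G₄ z) = T₄ z
  ker_T₁ : ∀ z, T₁ z = 0 → ∃ w, z = w - G₁ w
  ker_T₂ : ∀ z, T₂ z = 0 → ∃ w, z = w - G₂ w
  ker_T₃ : ∀ z, T₃ z = 0 → ∃ w, z = w - G₃ w
  ker_T₄ : ∀ z, T₄ z = 0 → ∃ w, z = w - G₄ w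
  counit_T₁ : ∀ a b, sliceLeft ε (T₁ (a ⊗ₜ b)) = mul a b
  counit_T₂ : ∀ a b, sliceRight ε (T₂ (a ⊗ₜ b)) = mul a b
  counit_T₃ : ∀ a b, sliceLeft ε (T₃ (a ⊗ₜ b)) = mul b a
  counit_T₄ : ∀ a b, sliceRight ε (T₄ (a ⊗ₜ b)) = mul b a
  full_L_left : ∀ V : Submodule ℂ A, (∀ ω z, sliceRight ω (L z) ∈ V) → V = ⊤
  full_L_right : ∀ V : Submodule ℂ A, (∀ ω z, sliceLeft ω (L z) ∈ V) → V = ⊤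
  full_P_left : ∀ V : Submodule ℂ A, (∀ ω z, sliceRight ω (P z) ∈ V) → V = ⊤
  full_P_right : ∀ V : Submodule ℂ A, (∀ ω z, sliceLeft ω (P z) ∈ V) → V = ⊤
  comm_T₂_T₁ : LegsCommute T₂ T₁
  comm_T₄_T₃ : LegsCommute T₄ T₃
  comm_L_T₁ : LegsCommute L T₁
  comm_P_T₃ : LegsCommute P T₃
  comm_T₄_L : LegsCommute T₄ L
  comm_T₂_P : LegsCommute T₂ P
  comm_L_L : LegsCommute L L
  comm_P_P : LegsCommute P P
  T₁_L : ∀ d ω z, T₁ (onLeft (legLeft L d ω) z) = onRight (legLeft L d ω) (T₁ z)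
  T₃_P : ∀ d ω z, T₃ (onLeft (legLeft P d ω) z) = onRight (legLeft P d ω) (T₃ z)
  T₄_L : ∀ d ω z, T₄ (onRight (legRight L d ω) z) = onLeft (legRight L d ω) (T₄ z)
  T₂_P : ∀ d ω z, T₂ (onRight (legRight P d ω) z) = onLeft (legRight P d ω) (T₂ z)
  G₁_spec : ∀ b ω z, onLeft (legLeft G₁ b ω) (T₁ z) = T₁ (onRight (legRight L b ω) z)
  G₃_spec : ∀ b ω z, onLeft (legLeft G₃ b ω) (T₃ z) = T₃ (onRight (legRight P b ω) z)
  G₂_spec : ∀ b ω z, onRight (legRight G₂ b ω) (T₂ z) = T₂ (onLeft (legLeft P b ω) z)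
  G₄_spec : ∀ b ω z, onRight (legRight G₄ b ω) (T₄ z) = T₄ (onLeft (legLeft L b ω) z)

namespace HopfData

variable {A : Type*} [AddCommGroup A] [Module ℂ A] (D : HopfData A)

/-- The opposite algebra. -/
@[simps] def op : HopfData A where
  mul := D.mul.flip
  ε := D.ε
  DL := D.DR
  DR := D.DL
  T₁ := D.T₃
  T₂ := D.T₄
  T₃ := D.T₁
  T₄ := D.T₂
  G₁ := D.G₃
  G₂ := D.G₄
  G₃ := D.G₁
  G₄ := D.G₂
  L := D.P
  P := D.L
  mul_assoc a b c := (D.mul_assoc c b a).symm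
  nondeg_left := D.nondeg_right
  nondeg_right := D.nondeg_left
  idem V h := D.idem V fun a b => h b a
  T₁_T₂ := D.T₃_T₄
  T₃_T₄ := D.T₁_T₂
  T₁_T₃ a b c := (D.T₁_T₃ a c b).symm
  T₂_T₄ a c d := (D.T₂_T₄ a d c).symm
  DL_eq_T₁ := D.DR_eq_T₃
  DL_eq_T₄ := D.DR_eq_T₂
  DR_eq_T₃ := D.DL_eq_T₁
  DR_eq_T₂ := D.DL_eq_T₄
  DL_T₁ := D.DR_T₃
  DL_T₄ := D.DR_T₂
  DR_T₃ := D.DL_T₁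
  DR_T₂ := D.DL_T₄
  L_P u v x y := (D.L_P x y u v).symm
  L_T₁ := D.P_T₃
  L_T₄ := D.P_T₂
  P_T₂ := D.L_T₄
  P_T₃ := D.L_T₁
  exists_T₁ := D.exists_T₃
  exists_T₄ := D.exists_T₂
  exists_T₂ := D.exists_T₄
  exists_T₃ := D.exists_T₁
  T₁_G₁ := D.T₃_G₃
  T₂_G₂ := D.T₄_G₄
  T₃_G₃ := D.T₁_G₁
  T₄_G₄ := D.T₂_G₂
  ker_T₁ := D.ker_T₃
  ker_T₂ := D.ker_T₄
  ker_T₃ := D.ker_T₁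
  ker_T₄ := D.ker_T₂
  counit_T₁ := D.counit_T₃
  counit_T₂ := D.counit_T₄
  counit_T₃ := D.counit_T₁
  counit_T₄ := D.counit_T₂
  full_L_left := D.full_P_left
  full_L_right := D.full_P_right
  full_P_left := D.full_L_left
  full_P_right := D.full_L_right
  comm_T₂_T₁ := D.comm_T₄_T₃
  comm_T₄_T₃ := D.comm_T₂_T₁
  comm_L_T₁ := D.comm_P_T₃
  comm_P_T₃ := D.comm_L_T₁
  comm_T₄_L := D.comm_T₂_P
  comm_T₂_P := D.comm_T₄_L
  comm_L_L := D.comm_P_P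
  comm_P_P := D.comm_L_L
  T₁_L := D.T₃_P
  T₃_P := D.T₁_L
  T₄_L := D.T₂_P
  T₂_P := D.T₄_L
  G₁_spec := D.G₃_spec
  G₃_spec := D.G₁_spec
  G₂_spec := D.G₄_spec
  G₄_spec := D.G₂_spec

/-- The coopposite coproduct. -/
@[simps] def cop : HopfData A where
  mul := D.mul
  ε := D.ε
  DL a := flipConj (D.DL a)
  DR a := flipConj (D.DR a)
  T₁ := flipConj D.T₄
  T₂ := flipConj D.T₃
  T₃ := flipConj D.T₂
  T₄ := flipConj D.T₁
  G₁ := flipConj D.G₄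
  G₂ := flipConj D.G₃
  G₃ := flipConj D.G₂
  G₄ := flipConj D.G₁
  L := flipConj D.L
  P := flipConj D.P
  mul_assoc := D.mul_assoc
  nondeg_left := D.nondeg_left
  nondeg_right := D.nondeg_right
  idem := D.idem
  T₁_T₂ a b c := by simp [flipConj_apply, onLeft_swap, onRight_swap, D.T₃_T₄]
  T₃_T₄ a b c := by simp [flipConj_apply, onLeft_swap, onRight_swap, D.T₁_T₂]
  T₁_T₃ a b c := by simp [flipConj_apply, onRight_swap, D.T₂_T₄]
  T₂_T₄ a b c := by simp [flipConj_apply, onLeft_swap, D.T₁_T₃]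
  DL_eq_T₁ a b c := by simp [flipConj_apply, onLeft_swap, D.DL_eq_T₄]
  DL_eq_T₄ a b c := by simp [flipConj_apply, onRight_swap, D.DL_eq_T₁]
  DR_eq_T₃ a b c := by simp [flipConj_apply, onLeft_swap, D.DR_eq_T₂]
  DR_eq_T₂ a b c := by simp [flipConj_apply, onRight_swap, D.DR_eq_T₃]
  DL_T₁ a b c := by simp [flipConj_apply, D.DL_T₄]
  DL_T₄ a b c := by simp [flipConj_apply, D.DL_T₁]
  DR_T₃ a b c := by simpa [flipConj_apply] using congrArg swap (D.DR_T₂ a b c)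
  DR_T₂ a b c := by simpa [flipConj_apply] using congrArg swap (D.DR_T₃ a b c)
  L_P u v x y := by
    simp only [flipConj_apply, onLeft_swap, onRight_swap, swap_tmul]
    rw [← onLeft_onRight, D.L_P, onLeft_onRight]
  L_T₁ z := by simp [flipConj_apply, D.L_T₄]
  L_T₄ z := by simp [flipConj_apply, D.L_T₁]
  P_T₂ z := by simp [flipConj_apply, D.P_T₃]
  P_T₃ z := by simp [flipConj_apply, D.P_T₂]
  exists_T₁ z := by
    obtain ⟨w, hw⟩ := D.exists_T₄ (swap z)
    exact ⟨swap w, by simp [flipConj_apply, hw]⟩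
  exists_T₄ z := by
    obtain ⟨w, hw⟩ := D.exists_T₁ (swap z)
    exact ⟨swap w, by simp [flipConj_apply, hw]⟩
  exists_T₂ z := by
    obtain ⟨w, hw⟩ := D.exists_T₃ (swap z)
    exact ⟨swap w, by simp [flipConj_apply, hw]⟩
  exists_T₃ z := by
    obtain ⟨w, hw⟩ := D.exists_T₂ (swap z)
    exact ⟨swap w, by simp [flipConj_apply, hw]⟩
  T₁_G₁ z := by simp [flipConj_apply, D.T₄_G₄]
  T₂_G₂ z := by simp [flipConj_apply, D.T₃_G₃]
  T₃_G₃ z := by simp [flipConj_apply, D.T₂_G₂]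
  T₄_G₄ z := by simp [flipConj_apply, D.T₁_G₁]
  ker_T₁ z hz := by
    obtain ⟨w, hw⟩ := D.ker_T₄ (swap z) (by simpa [flipConj_apply] using congrArg swap hz)
    exact ⟨swap w, by simpa [flipConj_apply] using congrArg swap hw⟩
  ker_T₂ z hz := by
    obtain ⟨w, hw⟩ := D.ker_T₃ (swap z) (by simpa [flipConj_apply] using congrArg swap hz)
    exact ⟨swap w, by simpa [flipConj_apply] using congrArg swap hw⟩
  ker_T₃ z hz := by
    obtain ⟨w, hw⟩ := D.ker_T₂ (swap z) (by simpa [flipConj_apply] using congrArg swap hz)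
    exact ⟨swap w, by simpa [flipConj_apply] using congrArg swap hw⟩
  ker_T₄ z hz := by
    obtain ⟨w, hw⟩ := D.ker_T₁ (swap z) (by simpa [flipConj_apply] using congrArg swap hz)
    exact ⟨swap w, by simpa [flipConj_apply] using congrArg swap hw⟩
  counit_T₁ a b := by simp [flipConj_apply, D.counit_T₄]
  counit_T₂ a b := by simp [flipConj_apply, D.counit_T₃]
  counit_T₃ a b := by simp [flipConj_apply, D.counit_T₂]
  counit_T₄ a b := by simp [flipConj_apply, D.counit_T₁]
  full_L_left V h := D.full_L_right V fun ω z => by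
    simpa [flipConj_apply] using h ω (swap z)
  full_L_right V h := D.full_L_left V fun ω z => by
    simpa [flipConj_apply] using h ω (swap z)
  full_P_left V h := D.full_P_right V fun ω z => by
    simpa [flipConj_apply] using h ω (swap z)
  full_P_right V h := D.full_P_left V fun ω z => by
    simpa [flipConj_apply] using h ω (swap z)
  comm_T₂_T₁ := D.comm_T₄_T₃.flipConj
  comm_T₄_T₃ := D.comm_T₂_T₁.flipConj
  comm_L_T₁ := D.comm_T₄_L.flipConj
  comm_P_T₃ := D.comm_T₂_P.flipConj
  comm_T₄_L := D.comm_L_T₁.flipConj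
  comm_T₂_P := D.comm_P_T₃.flipConj
  comm_L_L := D.comm_L_L.flipConj
  comm_P_P := D.comm_P_P.flipConj
  T₁_L d ω z := by
    simpa [flipConj_apply, onLeft_swap, onRight_swap] using
      congrArg swap (D.T₄_L d ω (swap z))
  T₃_P d ω z := by
    simpa [flipConj_apply, onLeft_swap, onRight_swap] using
      congrArg swap (D.T₂_P d ω (swap z))
  T₄_L d ω z := by
    simpa [flipConj_apply, onLeft_swap, onRight_swap] using
      congrArg swap (D.T₁_L d ω (swap z))
  T₂_P d ω z := by
    simpa [flipConj_apply, onLeft_swap, onRight_swap] using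
      congrArg swap (D.T₃_P d ω (swap z))
  G₁_spec b ω z := by
    simpa [flipConj_apply, onLeft_swap, onRight_swap] using
      congrArg swap (D.G₄_spec b ω (swap z))
  G₃_spec b ω z := by
    simpa [flipConj_apply, onLeft_swap, onRight_swap] using
      congrArg swap (D.G₂_spec b ω (swap z))
  G₂_spec b ω z := by
    simpa [flipConj_apply, onLeft_swap, onRight_swap] using
      congrArg swap (D.G₃_spec b ω (swap z))
  G₄_spec b ω z := by
    simpa [flipConj_apply, onLeft_swap, onRight_swap] using
      congrArg swap (D.G₁_spec b ω (swap z))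

end HopfData

namespace HopfData

variable {A : Type*} [AddCommGroup A] [Module ℂ A] (D : HopfData A)
variable {W : Type*} [AddCommGroup W] [Module ℂ W]

/-! ### Cancellation from non-degeneracy, idempotence and fullness -/

section Cancellation

lemma eq_of_mul_left {x y : A} (h : ∀ c, D.mul c x = D.mul c y) : x = y :=
  sub_eq_zero.1 <| D.nondeg_right _ fun c => by rw [map_sub, h, sub_self]

lemma eq_of_mul_right {x y : A} (h : ∀ c, D.mul x c = D.mul y c) : x = y :=
  D.op.eq_of_mul_left h

lemma eq_of_onLeft_mul {z z' : A ⊗[ℂ] W}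
    (h : ∀ c, onLeft (D.mul c) z = onLeft (D.mul c) z') : z = z' :=
  eq_of_sliceRight fun ω => D.eq_of_mul_left fun c => by
    rw [← sliceRight_onLeft, h, sliceRight_onLeft]

lemma eq_of_onRight_mul {z z' : W ⊗[ℂ] A}
    (h : ∀ c, onRight (D.mul c) z = onRight (D.mul c) z') : z = z' :=
  eq_of_sliceLeft fun ω => D.eq_of_mul_left fun c => by
    rw [← sliceLeft_onRight, h, sliceLeft_onRight]

lemma eq_of_onLeft_flip {z z' : A ⊗[ℂ] W}
    (h : ∀ c, onLeft (D.mul.flip c) z = onLeft (D.mul.flip c) z') : z = z' :=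
  D.op.eq_of_onLeft_mul h

lemma eq_of_onRight_flip {z z' : W ⊗[ℂ] A}
    (h : ∀ c, onRight (D.mul.flip c) z = onRight (D.mul.flip c) z') : z = z' :=
  D.op.eq_of_onRight_mul h

lemma eq_of_idem {f g : A →ₗ[ℂ] W} (h : ∀ a b, f (D.mul a b) = g (D.mul a b)) : f = g := by
  have := D.idem (LinearMap.eqLocus f g) h
  exact LinearMap.ext fun a => (this ▸ Submodule.mem_top : a ∈ LinearMap.eqLocus f g)

/-- Two linear maps that agree on the first leg of `Δ(A)(1 ⊗ A)` are equal. -/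
lemma eq_of_legLeft_T₁ {f g : A →ₗ[ℂ] W}
    (h : ∀ c d ω, f (legLeft D.T₁ d ω c) = g (legLeft D.T₁ d ω c)) : f = g := by
  have := D.full_L_left (LinearMap.eqLocus f g) fun ω z => by
    obtain ⟨w, hw⟩ := D.exists_T₁ z
    rw [hw]
    exact eq_of_tmul (f := f ∘ₗ sliceRight ω ∘ₗ D.T₁) (g := g ∘ₗ sliceRight ω ∘ₗ D.T₁)
      (fun c d => h c d ω) w
  exact LinearMap.ext fun a => (this ▸ Submodule.mem_top : a ∈ LinearMap.eqLocus f g)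

lemma eq_of_onLeft_T₁ {f g : A →ₗ[ℂ] W} (h : ∀ z, onLeft f (D.T₁ z) = onLeft g (D.T₁ z)) :
    f = g :=
  D.eq_of_legLeft_T₁ fun c d ω => by
    rw [legLeft_apply, ← sliceRight_onLeft, h, sliceRight_onLeft]

/-- Two linear maps that agree on the second leg of `(A ⊗ 1)Δ(A)` are equal. -/
lemma eq_of_legRight_T₂ {f g : A →ₗ[ℂ] W}
    (h : ∀ c d ω, f (legRight D.T₂ d ω c) = g (legRight D.T₂ d ω c)) : f = g :=
  D.op.cop.eq_of_legLeft_T₁ fun c d ω => by simpa using h c d ω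

lemma eq_of_onRight_T₂ {f g : A →ₗ[ℂ] W} (h : ∀ z, onRight f (D.T₂ z) = onRight g (D.T₂ z)) :
    f = g :=
  D.eq_of_legRight_T₂ fun c d ω => by
    rw [legRight_apply, ← sliceLeft_onRight, h, sliceLeft_onRight]

end Cancellation

/-! ### Module properties of the structure maps -/

section Linearity

lemma mul_comp (a b : A) : D.mul (D.mul a b) = D.mul a ∘ₗ D.mul b :=
  LinearMap.ext fun c => D.mul_assoc a b c

lemma flip_comp (a b : A) : D.mul.flip (D.mul a b) = D.mul.flip b ∘ₗ D.mul.flip a :=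
  LinearMap.ext fun c => (D.mul_assoc c a b).symm

lemma mul_comp_flip (a b : A) : D.mul a ∘ₗ D.mul.flip b = D.mul.flip b ∘ₗ D.mul a :=
  LinearMap.ext fun c => (D.mul_assoc a c b).symm

/-- Tested after a left factor in the second leg, `T₁` can be traded for `T₃` by `T₁_T₃`. There the
second argument of `T₁` is a plain right factor. -/
lemma T₁_onRight_flip (c : A) (z : A ⊗[ℂ] A) :
    D.T₁ (onRight (D.mul.flip c) z) = onRight (D.mul.flip c) (D.T₁ z) := by
  refine eq_of_tmul (f := D.T₁ ∘ₗ onRight (D.mul.flip c)) (g := onRight (D.mul.flip c) ∘ₗ D.T₁)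
    (fun a b => D.eq_of_onRight_mul fun d => ?_) z
  simp only [LinearMap.comp_apply, onRight_tmul, LinearMap.flip_apply]
  rw [D.T₁_T₃, flip_comp, ← onRight_onRight, ← D.T₁_T₃, onRight_onRight, onRight_onRight,
    mul_comp_flip]

lemma T₄_onLeft_flip (c : A) (z : A ⊗[ℂ] A) :
    D.T₄ (onLeft (D.mul.flip c) z) = onLeft (D.mul.flip c) (D.T₄ z) := by
  simpa [flipConj_apply, onLeft_swap, onRight_swap] using
    congrArg swap (D.cop.T₁_onRight_flip c (swap z))

/-- After left factors, `L_P` replaces `L` by `P`, and the argument of `L` enters only through right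
multiplications. -/
lemma L_onLeft_flip (c : A) (z : A ⊗[ℂ] A) :
    D.L (onLeft (D.mul.flip c) z) = onLeft (D.mul.flip c) (D.L z) := by
  refine eq_of_tmul (f := D.L ∘ₗ onLeft (D.mul.flip c)) (g := onLeft (D.mul.flip c) ∘ₗ D.L)
    (fun a b => D.eq_of_onRight_mul fun v => D.eq_of_onLeft_mul fun u => ?_) z
  simp only [LinearMap.comp_apply, onLeft_tmul, LinearMap.flip_apply]
  rw [D.L_P, flip_comp, ← onLeft_onLeft, ← D.L_P, onLeft_onLeft, ← onLeft_onRight,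
    onLeft_onLeft, mul_comp_flip]

lemma L_onRight_flip (c : A) (z : A ⊗[ℂ] A) :
    D.L (onRight (D.mul.flip c) z) = onRight (D.mul.flip c) (D.L z) := by
  simpa [flipConj_apply, onLeft_swap, onRight_swap] using
    congrArg swap (D.cop.L_onLeft_flip c (swap z))

lemma P_onLeft_mul (c : A) (z : A ⊗[ℂ] A) :
    D.P (onLeft (D.mul c) z) = onLeft (D.mul c) (D.P z) :=
  D.op.L_onLeft_flip c z

lemma P_onRight_mul (c : A) (z : A ⊗[ℂ] A) :
    D.P (onRight (D.mul c) z) = onRight (D.mul c) (D.P z) :=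
  D.op.L_onRight_flip c z

lemma L_L (z : A ⊗[ℂ] A) : D.L (D.L z) = D.L z := by
  obtain ⟨w, hw⟩ := D.exists_T₁ z
  rw [hw, L_T₁]

lemma DL_DR (a u v x y : A) : onLeft (D.mul u) (onRight (D.mul v) (D.DL a (x ⊗ₜ y))) =
    onLeft (D.mul.flip x) (onRight (D.mul.flip y) (D.DR a (u ⊗ₜ v))) := by
  rw [← DL_eq_T₁, ← DR_eq_T₂, ← onLeft_onRight, onLeft_onLeft, mul_comp_flip, ← onLeft_onLeft,
    onLeft_onRight, T₁_T₂, onRight_onRight, onRight_onRight, mul_comp_flip]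

lemma L_DL (a : A) (z : A ⊗[ℂ] A) : D.L (D.DL a z) = D.DL a z := by
  refine eq_of_tmul (f := D.L ∘ₗ D.DL a) (g := D.DL a) (fun x y => ?_) z
  rw [LinearMap.comp_apply, ← DL_eq_T₁, L_onLeft_flip, L_T₁]

lemma P_DR (a : A) (z : A ⊗[ℂ] A) : D.P (D.DR a z) = D.DR a z := D.op.L_DL a z

/-- The product `w z` in `A ⊗ A`. -/
def mulTensor (w : A ⊗[ℂ] A) : A ⊗[ℂ] A →ₗ[ℂ] A ⊗[ℂ] A :=
  TensorProduct.homTensorHomMap (RingHom.id ℂ) A A A A (TensorProduct.map D.mul D.mul w)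

lemma mulTensor_tmul (u v : A) (z : A ⊗[ℂ] A) :
    D.mulTensor (u ⊗ₜ v) z = onLeft (D.mul u) (onRight (D.mul v) z) :=
  eq_of_tmul (f := D.mulTensor (u ⊗ₜ v)) (g := onLeft (D.mul u) ∘ₗ onRight (D.mul v))
    (fun _ _ => rfl) z

lemma mulTensor_add (w w' z : A ⊗[ℂ] A) :
    D.mulTensor (w + w') z = D.mulTensor w z + D.mulTensor w' z := by
  simp [mulTensor]

lemma mulTensor_tmul_right (x y : A) (w : A ⊗[ℂ] A) :
    D.mulTensor w (x ⊗ₜ y) = onLeft (D.mul.flip x) (onRight (D.mul.flip y) w) := by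
  induction w with
  | zero => simp [mulTensor]
  | add w w' h h' => rw [mulTensor_add, h, h', map_add, map_add]
  | tmul u v => rw [mulTensor_tmul]; rfl

lemma mulTensor_L (w z : A ⊗[ℂ] A) : D.mulTensor w (D.L z) = D.mulTensor (D.P w) z := by
  induction w with
  | zero => simp [mulTensor]
  | add w w' h h' => rw [mulTensor_add, h, h', map_add, mulTensor_add]
  | tmul u v =>
    refine eq_of_tmul (f := D.mulTensor (u ⊗ₜ v) ∘ₗ D.L) (g := D.mulTensor (D.P (u ⊗ₜ v)))
      (fun x y => ?_) z
    rw [LinearMap.comp_apply, mulTensor_tmul, L_P, mulTensor_tmul_right]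

lemma mulTensor_DL (a : A) (w z : A ⊗[ℂ] A) :
    D.mulTensor w (D.DL a z) = D.mulTensor (D.DR a w) z := by
  induction w with
  | zero => simp [mulTensor]
  | add w w' h h' => rw [mulTensor_add, h, h', map_add, mulTensor_add]
  | tmul u v =>
    refine eq_of_tmul (f := D.mulTensor (u ⊗ₜ v) ∘ₗ D.DL a)
      (g := D.mulTensor (D.DR a (u ⊗ₜ v))) (fun x y => ?_) z
    rw [LinearMap.comp_apply, mulTensor_tmul, DL_DR, mulTensor_tmul_right]

lemma eq_of_mulTensor {z z' : A ⊗[ℂ] A} (h : ∀ w, D.mulTensor w z = D.mulTensor w z') :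
    z = z' :=
  D.eq_of_onRight_mul fun v => D.eq_of_onLeft_mul fun u => by
    rw [← mulTensor_tmul, ← mulTensor_tmul, h]

/-- Against an arbitrary left factor `w`, both `Δ(a)` and `E` move onto `w`, where right
multiplication by `E` fixes the image of right multiplication by `Δ(a)`. -/
lemma DL_L (a : A) (z : A ⊗[ℂ] A) : D.DL a (D.L z) = D.DL a z :=
  D.eq_of_mulTensor fun w => by rw [mulTensor_DL, mulTensor_L, P_DR, mulTensor_DL]

lemma DL_T₁' (d : A) (z : A ⊗[ℂ] A) : D.DL d (D.T₁ z) = D.T₁ (onLeft (D.mul d) z) :=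
  eq_of_tmul (f := D.DL d ∘ₗ D.T₁) (g := D.T₁ ∘ₗ onLeft (D.mul d)) (fun a b => D.DL_T₁ d a b) z

lemma DL_T₄' (d : A) (z : A ⊗[ℂ] A) : D.DL d (D.T₄ z) = D.T₄ (onRight (D.mul d) z) :=
  eq_of_tmul (f := D.DL d ∘ₗ D.T₄) (g := D.T₄ ∘ₗ onRight (D.mul d))
    (fun a b => D.DL_T₄ d b a) z

/-- Since `Δ(d) = Δ(d)E`, the tensor may be replaced by an element of the range of `T₄`, where
multiplicativity of `Δ` and the counit property apply. -/
lemma sliceRight_DL (d : A) (z : A ⊗[ℂ] A) :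
    sliceRight D.ε (D.DL d z) = D.mul d (sliceRight D.ε (D.L z)) := by
  rw [← DL_L]
  obtain ⟨w, hw⟩ := D.exists_T₄ z
  rw [hw, DL_T₄']
  refine eq_of_tmul (f := sliceRight D.ε ∘ₗ D.T₄ ∘ₗ onRight (D.mul d))
    (g := D.mul d ∘ₗ sliceRight D.ε ∘ₗ D.T₄) (fun a b => ?_) w
  simp only [LinearMap.comp_apply, onRight_tmul, counit_T₄, mul_assoc]

lemma sliceLeft_DL (d : A) (z : A ⊗[ℂ] A) :
    sliceLeft D.ε (D.DL d z) = D.mul d (sliceLeft D.ε (D.L z)) := by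
  simpa [flipConj_apply] using D.cop.sliceRight_DL d (swap z)

/-- Operators that commute with `T₁` on the first leg commute with `T₃`, and conversely. -/
lemma T₃_onLeft_comm {θ : A →ₗ[ℂ] A} (h : ∀ z, onLeft θ (D.T₁ z) = D.T₁ (onLeft θ z))
    (z : A ⊗[ℂ] A) : onLeft θ (D.T₃ z) = D.T₃ (onLeft θ z) := by
  refine eq_of_tmul (f := onLeft θ ∘ₗ D.T₃) (g := D.T₃ ∘ₗ onLeft θ)
    (fun a c => D.eq_of_onRight_flip fun b => ?_) z
  simp only [LinearMap.comp_apply, onLeft_tmul]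
  rw [← onLeft_onRight, ← T₁_T₃, onLeft_onRight, h, onLeft_tmul, T₁_T₃]

lemma T₁_onLeft_comm {θ : A →ₗ[ℂ] A} (h : ∀ z, onLeft θ (D.T₃ z) = D.T₃ (onLeft θ z))
    (z : A ⊗[ℂ] A) : onLeft θ (D.T₁ z) = D.T₁ (onLeft θ z) :=
  D.op.T₃_onLeft_comm h z

lemma T₂_onRight_comm {θ : A →ₗ[ℂ] A} (h : ∀ z, onRight θ (D.T₄ z) = D.T₄ (onRight θ z))
    (z : A ⊗[ℂ] A) : onRight θ (D.T₂ z) = D.T₂ (onRight θ z) := by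
  have := D.cop.T₃_onLeft_comm (θ := θ) (fun z => by
    simpa [flipConj_apply, onLeft_swap, onRight_swap] using congrArg swap (h (swap z))) (swap z)
  simpa [flipConj_apply, onLeft_swap, onRight_swap] using congrArg swap this

lemma comm_P_T₁ : LegsCommute D.P D.T₁ := fun c ω z => D.T₁_onLeft_comm (D.comm_P_T₃ c ω) z

lemma comm_T₂_T₃ : LegsCommute D.T₂ D.T₃ := fun c ω z => D.T₃_onLeft_comm (D.comm_T₂_T₁ c ω) z

lemma comm_T₂_L : LegsCommute D.T₂ D.L :=
  legsCommute_iff_right.2 fun d ω z =>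
    D.T₂_onRight_comm (legsCommute_iff_right.1 D.comm_T₄_L d ω) z

/-- Left multipliers of the second leg commute with right multiplication by the idempotent. -/
lemma P_onRight_comm {θ : A →ₗ[ℂ] A} (h : ∀ a b, θ (D.mul a b) = D.mul (θ a) b)
    (z : A ⊗[ℂ] A) : onRight θ (D.P z) = D.P (onRight θ z) := by
  have hθ : ∀ a, θ ∘ₗ D.mul a = D.mul (θ a) := fun a => LinearMap.ext (h a)
  refine eq_of_tmul (f := onRight θ ∘ₗ D.P) (g := D.P ∘ₗ onRight θ) (fun u v => ?_) z
  refine LinearMap.congr_fun (f := onRight θ ∘ₗ D.P ∘ₗ TensorProduct.mk ℂ A A u)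
    (g := D.P ∘ₗ onRight θ ∘ₗ TensorProduct.mk ℂ A A u) (D.eq_of_idem fun a b => ?_) v
  have e : u ⊗ₜ[ℂ] D.mul a b = onRight (D.mul a) (u ⊗ₜ b) := rfl
  simp only [LinearMap.comp_apply, TensorProduct.mk_apply]
  rw [e, P_onRight_mul, onRight_onRight, onRight_onRight, hθ, P_onRight_mul]

lemma legLeft_L_mul (d : A) (ω : A →ₗ[ℂ] ℂ) (a b : A) :
    legLeft D.L d ω (D.mul a b) = D.mul (legLeft D.L d ω a) b := by
  have e : D.mul a b ⊗ₜ[ℂ] d = onLeft (D.mul.flip b) (a ⊗ₜ d) := rfl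
  rw [legLeft_apply, e, L_onLeft_flip, sliceRight_onLeft]; rfl

/-- Slices of the first leg of `E` are left multipliers, while `P` multiplies on the right. -/
lemma comm_P_L : LegsCommute D.P D.L :=
  legsCommute_iff_right.2 fun d ω z => D.P_onRight_comm (D.legLeft_L_mul d ω) z

end Linearity

end HopfData

/-! ### Unsliced coassociativity on the triple tensor product -/

section Triple

variable {A : Type*} [AddCommGroup A] [Module ℂ A]

/-- `X ⊗ ι` on `A ⊗ (A ⊗ A)`. -/
def onFirstTwo (X : A ⊗[ℂ] A →ₗ[ℂ] A ⊗[ℂ] A) : A ⊗[ℂ] (A ⊗[ℂ] A) →ₗ[ℂ] A ⊗[ℂ] (A ⊗[ℂ] A) :=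
  (TensorProduct.assoc ℂ A A A).toLinearMap ∘ₗ onLeft X ∘ₗ
    (TensorProduct.assoc ℂ A A A).symm.toLinearMap

lemma sliceLeft_onFirstTwo (X : A ⊗[ℂ] A →ₗ[ℂ] A ⊗[ℂ] A) (ω : A →ₗ[ℂ] ℂ) (c : A)
    (z : A ⊗[ℂ] A) : sliceLeft ω (onFirstTwo X (c ⊗ₜ z)) = onLeft (legRight X c ω) z := by
  refine eq_of_tmul (f := sliceLeft ω ∘ₗ onFirstTwo X ∘ₗ TensorProduct.mk ℂ A (A ⊗[ℂ] A) c)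
    (g := onLeft (legRight X c ω)) (fun b d => ?_) z
  exact eq_of_tmul (f := sliceLeft ω ∘ₗ (TensorProduct.assoc ℂ A A A).toLinearMap ∘ₗ
    (TensorProduct.mk ℂ (A ⊗[ℂ] A) A).flip d)
    (g := (TensorProduct.mk ℂ A A).flip d ∘ₗ sliceLeft ω)
    (fun _ _ => by simp [TensorProduct.smul_tmul']) (X (c ⊗ₜ b))

/-- Functionals on the first leg separate tensors. The unsliced form is the one in which all three
legs can be multiplied together. -/
lemma legsCommute_iff {X Y : A ⊗[ℂ] A →ₗ[ℂ] A ⊗[ℂ] A} : LegsCommute X Y ↔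
    ∀ c z, onFirstTwo X (c ⊗ₜ Y z) = onRight Y (onFirstTwo X (c ⊗ₜ z)) := by
  constructor
  · intro h c z
    refine eq_of_sliceLeft fun ω => ?_
    rw [sliceLeft_onRight, sliceLeft_onFirstTwo, sliceLeft_onFirstTwo, h]
  · intro h c ω z
    rw [← sliceLeft_onFirstTwo, h, sliceLeft_onRight, sliceLeft_onFirstTwo]

end Triple

namespace HopfData

variable {A : Type*} [AddCommGroup A] [Module ℂ A] (D : HopfData A)
variable {W : Type*} [AddCommGroup W] [Module ℂ W]

/-! ### The source map and the generalized inverses -/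

section Source

lemma ε_comp_legRight_T₂ (u : A) (ω : A →ₗ[ℂ] ℂ) :
    D.ε ∘ₗ legRight D.T₂ u ω = ω ∘ₗ D.mul u := LinearMap.ext fun a => by
  rw [LinearMap.comp_apply, legRight_apply, apply_sliceLeft, counit_T₂, LinearMap.comp_apply]

lemma ε_comp_legLeft_T₁ (d : A) (ω : A →ₗ[ℂ] ℂ) :
    D.ε ∘ₗ legLeft D.T₁ d ω = ω ∘ₗ D.mul.flip d := LinearMap.ext fun a => by
  rw [LinearMap.comp_apply, legLeft_apply, ← apply_sliceLeft, counit_T₁, LinearMap.comp_apply,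
    LinearMap.flip_apply]

/-- By the counit property `ω(u ·)` is `ε` composed with a slice of `T₂`, and such slices pass
through colinear maps. -/
lemma sliceLeft_of_legsCommute {X : A ⊗[ℂ] A →ₗ[ℂ] A ⊗[ℂ] A} (h : LegsCommute D.T₂ X) (u : A)
    (ω : A →ₗ[ℂ] ℂ) (z : A ⊗[ℂ] A) :
    sliceLeft (ω ∘ₗ D.mul u) (X z) = sliceLeft D.ε (X (onLeft (legRight D.T₂ u ω) z)) := by
  rw [← ε_comp_legRight_T₂, ← sliceLeft_onLeft, h]

/-- Colinear maps are determined by their composition with `ε ⊗ ι`. -/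
lemma eq_of_legsCommute {X Y : A ⊗[ℂ] A →ₗ[ℂ] A ⊗[ℂ] A} (hX : LegsCommute D.T₂ X)
    (hY : LegsCommute D.T₂ Y) (h : ∀ a b, sliceLeft D.ε (X (a ⊗ₜ b)) = sliceLeft D.ε (Y (a ⊗ₜ b)))
    (z : A ⊗[ℂ] A) : X z = Y z := by
  have h' := eq_of_tmul (f := sliceLeft D.ε ∘ₗ X) (g := sliceLeft D.ε ∘ₗ Y) h
  simp only [LinearMap.comp_apply] at h'
  refine D.eq_of_onLeft_mul fun u => eq_of_sliceLeft fun ω => ?_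
  rw [sliceLeft_onLeft, sliceLeft_onLeft, D.sliceLeft_of_legsCommute hX,
    D.sliceLeft_of_legsCommute hY, h']

/-- `es (c ⊗ b) = ε_s(c) b`. -/
def es : A ⊗[ℂ] A →ₗ[ℂ] A := sliceLeft D.ε ∘ₗ D.G₁

lemma es_apply (z : A ⊗[ℂ] A) : D.es z = sliceLeft D.ε (D.G₁ z) := rfl

/-- This is `ε_s(c₁) ⊗ c₂ = (1 ⊗ c)E`, obtained by applying `ε` to the first leg of `G₁_spec`. All
later links between the source map and the legs of `E` come from it. -/
lemma es_legLeft_T₁ (b c d : A) (ω : A →ₗ[ℂ] ℂ) :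
    D.es (legLeft D.T₁ d ω c ⊗ₜ b) = sliceRight (ω ∘ₗ D.mul c) (D.L (b ⊗ₜ d)) := by
  refine eq_of_forall_dual fun μ => ?_
  have h := congrArg (fun z => ω (sliceLeft D.ε z)) (D.G₁_spec b μ (c ⊗ₜ d))
  simp only [onRight_tmul, counit_T₁] at h
  rw [sliceLeft_onLeft, apply_sliceLeft, ← legLeft_apply, LinearMap.comp_apply, legLeft_apply,
    ← apply_sliceLeft] at h
  rw [es_apply, h, legRight_apply, ← apply_sliceLeft]
  rfl

/-- `u (ε_s(c) a) = (u ε_s(c)) a`. -/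
lemma mul_es (u c a : A) :
    D.mul u (D.es (c ⊗ₜ a)) = D.mul (sliceRight D.ε (D.P (u ⊗ₜ c))) a := by
  -- By fullness `c` may be taken to be a first leg of `T₁`. Then `es_legLeft_T₁` evaluates one
  -- side, and coassociativity of `P` with `T₁` followed by the counit evaluates the other.
  refine LinearMap.congr_fun (f := D.mul u ∘ₗ D.es ∘ₗ (TensorProduct.mk ℂ A A).flip a)
    (g := D.mul.flip a ∘ₗ sliceRight D.ε ∘ₗ D.P ∘ₗ TensorProduct.mk ℂ A A u)
    (D.eq_of_legLeft_T₁ fun c d ω => ?_) c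
  simp only [LinearMap.comp_apply, LinearMap.flip_apply, TensorProduct.mk_apply]
  have e : u ⊗ₜ[ℂ] legLeft D.T₁ d ω c = onRight (legLeft D.T₁ d ω) (u ⊗ₜ c) := rfl
  rw [es_legLeft_T₁, e, ← legsCommute_iff_right.1 D.comm_P_T₁, sliceRight_onRight,
    ε_comp_legLeft_T₁, ← sliceRight_onRight, ← sliceRight_onRight]
  have := congrArg (sliceRight ω) (D.L_P u c a d)
  rwa [sliceRight_onLeft, sliceRight_onLeft] at this

/-- `(a ε_t(c)) u = a (ε_t(c) u)`. -/
lemma et_mul (a c u : A) :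
    D.mul (sliceRight D.ε (D.G₂ (a ⊗ₜ c))) u = D.mul a (sliceLeft D.ε (D.L (c ⊗ₜ u))) := by
  simpa [es_apply, flipConj_apply] using D.op.cop.mul_es u c a

/-- On the first leg of `T₁`, a slice of `G₁` equals `T₁` preceded by a slice of `E` on the second
leg, which `θ` does not touch. Fullness concludes. -/
lemma G₁_onLeft_comm {θ : A →ₗ[ℂ] A} (h : ∀ z, onLeft θ (D.T₁ z) = D.T₁ (onLeft θ z))
    (z : A ⊗[ℂ] A) : onLeft θ (D.G₁ z) = D.G₁ (onLeft θ z) := by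
  refine eq_of_tmul (f := onLeft θ ∘ₗ D.G₁) (g := D.G₁ ∘ₗ onLeft θ)
    (fun a b => eq_of_sliceRight fun μ => ?_) z
  simp only [LinearMap.comp_apply, sliceRight_onLeft]
  refine LinearMap.congr_fun (f := θ ∘ₗ legLeft D.G₁ b μ) (g := legLeft D.G₁ b μ ∘ₗ θ)
    (D.eq_of_onLeft_T₁ fun z => ?_) a
  rw [← onLeft_onLeft, ← onLeft_onLeft, G₁_spec, h, h, G₁_spec, onLeft_onRight]

/-- `y ↦ (ι ⊗ ω) T₁(c ⊗ y)`. -/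
def T₁Leg (c : A) (ω : A →ₗ[ℂ] ℂ) : A →ₗ[ℂ] A := sliceRight ω ∘ₗ D.T₁ ∘ₗ TensorProduct.mk ℂ A A c

lemma T₁Leg_apply (c d : A) (ω : A →ₗ[ℂ] ℂ) : D.T₁Leg c ω d = sliceRight ω (D.T₁ (c ⊗ₜ d)) := rfl

/-- An unsliced `G₁_spec`: on legs of the coproduct `G₁` is `E` in disguise. Idempotence and
linearity of `E` pass to `G₁` this way. -/
lemma G₁_T₁Leg (c : A) (ω : A →ₗ[ℂ] ℂ) (z : A ⊗[ℂ] A) :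
    D.G₁ (onLeft (D.T₁Leg c ω) (swap z)) = onLeft (D.T₁Leg c ω) (swap (D.L z)) := by
  refine eq_of_tmul (f := D.G₁ ∘ₗ onLeft (D.T₁Leg c ω) ∘ₗ swap)
    (g := onLeft (D.T₁Leg c ω) ∘ₗ swap ∘ₗ D.L) (fun b d => eq_of_sliceRight fun μ => ?_) z
  simp only [LinearMap.comp_apply, swap_tmul, onLeft_tmul]
  have h := congrArg (sliceRight ω) (D.G₁_spec b μ (c ⊗ₜ d))
  rw [sliceRight_onLeft, onRight_tmul, legRight_apply] at h
  rw [sliceRight_onLeft, sliceRight_swap]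
  exact h

/-- A property of maps on `A ⊗ A` can be checked on the elements `T₁Leg c ω d ⊗ b`. -/
lemma eq_of_T₁Leg {f g : A ⊗[ℂ] A →ₗ[ℂ] W}
    (h : ∀ c ω z, f (onLeft (D.T₁Leg c ω) (swap z)) = g (onLeft (D.T₁Leg c ω) (swap z)))
    (z : A ⊗[ℂ] A) : f z = g z := by
  refine eq_of_tmul (fun a b => ?_) z
  exact LinearMap.congr_fun (f := f ∘ₗ (TensorProduct.mk ℂ A A).flip b)
    (g := g ∘ₗ (TensorProduct.mk ℂ A A).flip b)
    (D.eq_of_legLeft_T₁ fun c d ω => h c ω (b ⊗ₜ d)) a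

lemma G₁_G₁ (z : A ⊗[ℂ] A) : D.G₁ (D.G₁ z) = D.G₁ z :=
  D.eq_of_T₁Leg (f := D.G₁ ∘ₗ D.G₁) (g := D.G₁) (fun c ω z => by
    rw [LinearMap.comp_apply, G₁_T₁Leg, G₁_T₁Leg, L_L]) z

lemma G₁_onRight_flip (a : A) (z : A ⊗[ℂ] A) :
    D.G₁ (onRight (D.mul.flip a) z) = onRight (D.mul.flip a) (D.G₁ z) :=
  D.eq_of_T₁Leg (f := D.G₁ ∘ₗ onRight (D.mul.flip a)) (g := onRight (D.mul.flip a) ∘ₗ D.G₁)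
    (fun c ω z => by
      rw [LinearMap.comp_apply, LinearMap.comp_apply, G₁_T₁Leg, ← onLeft_onRight, ← onLeft_onRight,
        onRight_swap, onRight_swap, G₁_T₁Leg, L_onLeft_flip]) z

/-- The kernel of `T₁` is the range of `1 - G₁`, which the idempotent `G₁` annihilates. -/
lemma G₁_eq_of_T₁_eq {z z' : A ⊗[ℂ] A} (h : D.T₁ z = D.T₁ z') : D.G₁ z = D.G₁ z' := by
  obtain ⟨w, hw⟩ := D.ker_T₁ (z - z') (by rw [map_sub, h, sub_self])
  rw [← sub_eq_zero, ← map_sub, hw, map_sub, G₁_G₁, sub_self]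

/-- Take any linear section of `T₁` over its range, apply it to `E z` and correct by `G₁`. By
`G₁_eq_of_T₁_eq` the choice of section disappears. -/
lemma exists_R₁ : ∃ R : A ⊗[ℂ] A →ₗ[ℂ] A ⊗[ℂ] A, (∀ z, D.T₁ (R z) = D.L z) ∧
    (∀ z, R (D.T₁ z) = D.G₁ z) ∧ ∀ z, D.G₁ (R z) = R z := by
  obtain ⟨g, hg⟩ := LinearMap.exists_rightInverse_of_surjective D.T₁.rangeRestrict
    D.T₁.range_rangeRestrict
  have hL : ∀ z, D.L z ∈ LinearMap.range D.T₁ := fun z => by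
    obtain ⟨w, hw⟩ := D.exists_T₁ z
    exact ⟨w, hw.symm⟩
  have hT : ∀ z, D.T₁ (g (D.L.codRestrict _ hL z)) = D.L z := fun z => by
    have := congrArg Subtype.val (LinearMap.congr_fun hg (D.L.codRestrict _ hL z))
    simpa using this
  refine ⟨D.G₁ ∘ₗ g ∘ₗ D.L.codRestrict _ hL, fun z => ?_, fun z => ?_, fun z => ?_⟩
  · simp only [LinearMap.comp_apply, T₁_G₁, hT]
  · simp only [LinearMap.comp_apply]
    exact D.G₁_eq_of_T₁_eq (by rw [hT, L_T₁])
  · simp only [LinearMap.comp_apply, G₁_G₁]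

/-- The generalized inverse of `T₁`. -/
def R₁ : A ⊗[ℂ] A →ₗ[ℂ] A ⊗[ℂ] A := D.exists_R₁.choose

lemma T₁_R₁ (z : A ⊗[ℂ] A) : D.T₁ (D.R₁ z) = D.L z := D.exists_R₁.choose_spec.1 z

lemma R₁_T₁ (z : A ⊗[ℂ] A) : D.R₁ (D.T₁ z) = D.G₁ z := D.exists_R₁.choose_spec.2.1 z

lemma G₁_R₁ (z : A ⊗[ℂ] A) : D.G₁ (D.R₁ z) = D.R₁ z := D.exists_R₁.choose_spec.2.2 z

/-- `T₁` is injective on the fixed points of `G₁`, so these two conditions pin down `R₁ z`.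
Identities for `R₁` are proved by verifying them. -/
lemma R₁_eq {y z : A ⊗[ℂ] A} (h : D.T₁ y = D.L z) (hy : D.G₁ y = y) : D.R₁ z = y := by
  rw [← hy, ← G₁_R₁]
  exact D.G₁_eq_of_T₁_eq (by rw [T₁_R₁, h])

lemma R₁_L (z : A ⊗[ℂ] A) : D.R₁ (D.L z) = D.R₁ z :=
  D.R₁_eq (by rw [T₁_R₁, L_L]) (D.G₁_R₁ z)

/-- The generalized inverse of `T₂`. -/
def R₂ : A ⊗[ℂ] A →ₗ[ℂ] A ⊗[ℂ] A := flipConj D.op.cop.R₁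

@[simp] lemma R₁_op_cop : D.op.cop.R₁ = flipConj D.R₂ := (flipConj_flipConj _).symm

lemma T₂_R₂ (z : A ⊗[ℂ] A) : D.T₂ (D.R₂ z) = D.P z := by
  simpa [flipConj_apply] using congrArg swap (D.op.cop.T₁_R₁ (swap z))

lemma R₂_T₂ (z : A ⊗[ℂ] A) : D.R₂ (D.T₂ z) = D.G₂ z := by
  simpa [flipConj_apply] using congrArg swap (D.op.cop.R₁_T₁ (swap z))

lemma G₂_R₂ (z : A ⊗[ℂ] A) : D.G₂ (D.R₂ z) = D.R₂ z := by
  simpa [flipConj_apply] using congrArg swap (D.op.cop.G₁_R₁ (swap z))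

lemma R₂_P (z : A ⊗[ℂ] A) : D.R₂ (D.P z) = D.R₂ z := by
  simpa [flipConj_apply] using congrArg swap (D.op.cop.R₁_L (swap z))

lemma G₁_onLeft_mul (d : A) (z : A ⊗[ℂ] A) :
    D.G₁ (onLeft (D.mul d) z) = onLeft (D.mul d) (D.G₁ z) := by
  refine eq_of_tmul (f := D.G₁ ∘ₗ onLeft (D.mul d)) (g := onLeft (D.mul d) ∘ₗ D.G₁)
    (fun a b => eq_of_sliceRight fun μ => ?_) z
  simp only [LinearMap.comp_apply, sliceRight_onLeft]
  refine LinearMap.congr_fun (f := legLeft D.G₁ b μ ∘ₗ D.mul d) (g := D.mul d ∘ₗ legLeft D.G₁ b μ)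
    (D.eq_of_idem fun a x => ?_) a
  simp only [LinearMap.comp_apply]
  -- The product `ax` is `(ι ⊗ ε)(Δ(a)(x ⊗ 1))`, and multiplying it by `d` amounts to multiplying by
  -- `Δ(d)` inside. Rewriting `Δ(a)(x ⊗ 1)` as a value of `T₁` makes `G₁_spec` available.
  obtain ⟨w, hw⟩ := D.exists_T₁ (D.T₄ (x ⊗ₜ a))
  rw [L_T₄] at hw
  have h1 : D.mul d (D.mul a x) = sliceRight D.ε (D.DL d (D.T₁ w)) := by
    rw [← hw, DL_T₄, counit_T₄, mul_assoc]
  have h2 : D.mul a x = sliceRight D.ε (D.T₁ w) := by rw [← hw, counit_T₄]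
  rw [h1, h2, ← sliceRight_onLeft, ← sliceRight_onLeft, DL_T₁', G₁_spec, G₁_spec,
    ← onLeft_onRight, ← DL_T₁', sliceRight_DL, L_T₁]

lemma R₁_onLeft_comm {θ : A →ₗ[ℂ] A} (hT : ∀ z, onLeft θ (D.T₁ z) = D.T₁ (onLeft θ z))
    (hL : ∀ z, onLeft θ (D.L z) = D.L (onLeft θ z)) (z : A ⊗[ℂ] A) :
    onLeft θ (D.R₁ z) = D.R₁ (onLeft θ z) :=
  (D.R₁_eq (by rw [← hT, T₁_R₁, hL]) (by rw [← D.G₁_onLeft_comm hT, G₁_R₁])).symm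

lemma R₂_onRight_comm {θ : A →ₗ[ℂ] A} (hT : ∀ z, onRight θ (D.T₂ z) = D.T₂ (onRight θ z))
    (hP : ∀ z, onRight θ (D.P z) = D.P (onRight θ z)) (z : A ⊗[ℂ] A) :
    onRight θ (D.R₂ z) = D.R₂ (onRight θ z) := by
  have := D.op.cop.R₁_onLeft_comm (θ := θ)
    (fun z => by
      simpa [flipConj_apply, onLeft_swap, onRight_swap] using congrArg swap (hT (swap z)))
    (fun z => by
      simpa [flipConj_apply, onLeft_swap, onRight_swap] using congrArg swap (hP (swap z)))
    (swap z)
  simpa [flipConj_apply, onLeft_swap, onRight_swap] using congrArg swap this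

lemma R₁_DL (d : A) (z : A ⊗[ℂ] A) : D.R₁ (D.DL d z) = onLeft (D.mul d) (D.R₁ z) :=
  D.R₁_eq (by rw [← DL_T₁', T₁_R₁, DL_L, L_DL]) (by rw [G₁_onLeft_mul, G₁_R₁])

/-- Multiplied by `u` on the right, both sides become `(ε ⊗ ι)(Δ(c)(x ⊗ u))`. -/
lemma sliceLeft_T₄ (x c : A) :
    sliceLeft D.ε (D.T₄ (x ⊗ₜ c)) = sliceRight D.ε (D.G₂ (c ⊗ₜ x)) := by
  refine D.eq_of_mul_right fun u => ?_
  rw [et_mul, ← sliceLeft_DL, ← DL_eq_T₄, sliceLeft_onRight, LinearMap.flip_apply]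

lemma ε_et (c x : A) : D.ε (sliceRight D.ε (D.G₂ (c ⊗ₜ x))) = D.ε (D.mul c x) := by
  rw [← sliceLeft_T₄, apply_sliceLeft, counit_T₄]

lemma ε_es (c x : A) : D.ε (D.es (c ⊗ₜ x)) = D.ε (D.mul c x) := by
  simpa [es_apply, flipConj_apply] using D.op.cop.ε_et x c

lemma comm_R₂_T₁ : LegsCommute D.R₂ D.T₁ := legsCommute_iff_right.2 fun d ω z =>
  D.R₂_onRight_comm (legsCommute_iff_right.1 D.comm_T₂_T₁ d ω)
    (legsCommute_iff_right.1 D.comm_P_T₁ d ω) z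

lemma comm_R₂_L : LegsCommute D.R₂ D.L := legsCommute_iff_right.2 fun d ω z =>
  D.R₂_onRight_comm (legsCommute_iff_right.1 D.comm_T₂_L d ω)
    (legsCommute_iff_right.1 D.comm_P_L d ω) z

/-- Slices of `R₂` commute with `T₁` and `E`, and therefore with `R₁` by its uniqueness. -/
lemma comm_R₂_R₁ : LegsCommute D.R₂ D.R₁ := fun c ω z =>
  D.R₁_onLeft_comm (D.comm_R₂_T₁ c ω) (D.comm_R₂_L c ω) z

lemma comm_T₂_R₁ : LegsCommute D.T₂ D.R₁ := fun c ω z =>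
  D.R₁_onLeft_comm (D.comm_T₂_T₁ c ω) (D.comm_T₂_L c ω) z

end Source

/-! ### The antipode as a multiplier, and its antimultiplicativity -/

section Antipode

/-- `s (a ⊗ b) = S(a) b`. -/
def s : A ⊗[ℂ] A →ₗ[ℂ] A := sliceLeft D.ε ∘ₗ D.R₁

/-- `s' (b ⊗ a) = b S(a)`. -/
def s' : A ⊗[ℂ] A →ₗ[ℂ] A := sliceRight D.ε ∘ₗ D.R₂

lemma s_apply (z : A ⊗[ℂ] A) : D.s z = sliceLeft D.ε (D.R₁ z) := rfl

lemma s'_apply (z : A ⊗[ℂ] A) : D.s' z = sliceRight D.ε (D.R₂ z) := rfl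

lemma s_op_cop (z : A ⊗[ℂ] A) : D.op.cop.s z = D.s' (swap z) := by
  simp [s_apply, s'_apply, flipConj_apply]

lemma es_R₁ (z : A ⊗[ℂ] A) : D.es (D.R₁ z) = D.s z := by rw [es_apply, G₁_R₁, s_apply]

lemma s_T₁ (z : A ⊗[ℂ] A) : D.s (D.T₁ z) = D.es z := by rw [s_apply, R₁_T₁, es_apply]

lemma s'_P (z : A ⊗[ℂ] A) : D.s' (D.P z) = D.s' z := by rw [s'_apply, R₂_P, s'_apply]

lemma s_L (z : A ⊗[ℂ] A) : D.s (D.L z) = D.s z := by rw [s_apply, R₁_L, s_apply]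

lemma lift_mul_R₁ (z : A ⊗[ℂ] A) :
    TensorProduct.lift D.mul (D.R₁ z) = sliceLeft D.ε (D.L z) := by
  rw [← T₁_R₁]
  exact eq_of_tmul (f := TensorProduct.lift D.mul) (g := sliceLeft D.ε ∘ₗ D.T₁)
    (fun a b => (D.counit_T₁ a b).symm) _

lemma lift_mul_R₂ (z : A ⊗[ℂ] A) :
    TensorProduct.lift D.mul (D.R₂ z) = sliceRight D.ε (D.P z) := by
  rw [← T₂_R₂]
  exact eq_of_tmul (f := TensorProduct.lift D.mul) (g := sliceRight D.ε ∘ₗ D.T₂)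
    (fun a b => (D.counit_T₂ a b).symm) _

/-- `c (S(a) b) = (c S(a)) b`. -/
lemma mul_s (c a b : A) : D.mul c (D.s (a ⊗ₜ b)) = D.mul (D.s' (c ⊗ₜ a)) b := by
  -- Multiply out the three legs of `(R₂ ⊗ ι)(ι ⊗ R₁)(c ⊗ a ⊗ b)`, computed in both orders. The
  -- operator applied last is multiplied out to a counit slice of `E`, that is, to a source or
  -- target value; only the antipode from the other operator survives.
  have h := congrArg (TensorProduct.lift D.mul ∘ₗ onRight (TensorProduct.lift D.mul))
    (legsCommute_iff.1 D.comm_R₂_R₁ c (a ⊗ₜ b))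
  have h1 : ∀ z, (TensorProduct.lift D.mul ∘ₗ onRight (TensorProduct.lift D.mul))
      (onFirstTwo D.R₂ (c ⊗ₜ z)) = D.mul c (D.es z) := fun z => by
    refine eq_of_tmul (f := (TensorProduct.lift D.mul ∘ₗ onRight (TensorProduct.lift D.mul)) ∘ₗ
      onFirstTwo D.R₂ ∘ₗ TensorProduct.mk ℂ A (A ⊗[ℂ] A) c) (g := D.mul c ∘ₗ D.es)
      (fun p q => ?_) z
    rw [LinearMap.comp_apply (g := D.es), mul_es, ← lift_mul_R₂]
    exact eq_of_tmul (f := (TensorProduct.lift D.mul ∘ₗ onRight (TensorProduct.lift D.mul)) ∘ₗ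
      (TensorProduct.assoc ℂ A A A).toLinearMap ∘ₗ (TensorProduct.mk ℂ (A ⊗[ℂ] A) A).flip q)
      (g := D.mul.flip q ∘ₗ TensorProduct.lift D.mul)
      (fun _ _ => by simp [D.mul_assoc]) (D.R₂ (c ⊗ₜ p))
  have h2 : ∀ z, (TensorProduct.lift D.mul ∘ₗ onRight (TensorProduct.lift D.mul))
      (onRight D.R₁ (TensorProduct.assoc ℂ A A A (z ⊗ₜ b))) =
      D.mul (sliceRight D.ε (D.G₂ z)) b := fun z => by
    refine eq_of_tmul (f := (TensorProduct.lift D.mul ∘ₗ onRight (TensorProduct.lift D.mul)) ∘ₗ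
      onRight D.R₁ ∘ₗ (TensorProduct.assoc ℂ A A A).toLinearMap ∘ₗ
      (TensorProduct.mk ℂ (A ⊗[ℂ] A) A).flip b)
      (g := D.mul.flip b ∘ₗ sliceRight D.ε ∘ₗ D.G₂) (fun p q => ?_) z
    simp only [LinearMap.comp_apply, LinearMap.flip_apply, TensorProduct.mk_apply, et_mul,
      LinearEquiv.coe_coe, TensorProduct.assoc_tmul, onRight_tmul, lift_mul_R₁,
      TensorProduct.lift.tmul]
  rw [h1, es_R₁] at h
  rw [h, s'_apply, ← G₂_R₂, ← h2]
  rfl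

/-- Left multiplication with `ε_s(c)`. -/
def esMul (c : A) : A →ₗ[ℂ] A := D.es ∘ₗ TensorProduct.mk ℂ A A c

lemma esMul_apply (c a : A) : D.esMul c a = D.es (c ⊗ₜ a) := rfl

lemma esMul_legLeft_T₁ (c d : A) (ω : A →ₗ[ℂ] ℂ) :
    D.esMul (legLeft D.T₁ d ω c) = legLeft D.L d (ω ∘ₗ D.mul c) :=
  LinearMap.ext fun b => D.es_legLeft_T₁ b c d ω

lemma esMul_eq_curry : D.esMul = TensorProduct.curry D.es := by
  ext; rfl

/-- By fullness and `esMul_legLeft_T₁`, an identity linear in `ε_s(c)` only has to be checked for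
slices of the first leg of `E`. -/
lemma eq_of_esMul {f g : (A →ₗ[ℂ] A) →ₗ[ℂ] W} (h : ∀ d ω, f (legLeft D.L d ω) = g (legLeft D.L d ω))
    (c : A) : f (D.esMul c) = g (D.esMul c) := by
  rw [esMul_eq_curry]
  refine LinearMap.congr_fun (f := f ∘ₗ TensorProduct.curry D.es)
    (g := g ∘ₗ TensorProduct.curry D.es) (D.eq_of_legLeft_T₁ fun c d ω => ?_) c
  simp only [LinearMap.comp_apply]
  rw [← esMul_eq_curry, esMul_legLeft_T₁, h]

/-- Formally `Δ(ya) = (1 ⊗ y)Δ(a)` for `y` in the image of the source map. -/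
lemma T₁_onLeft_esMul (c : A) (z : A ⊗[ℂ] A) :
    D.T₁ (onLeft (D.esMul c) z) = onRight (D.esMul c) (D.T₁ z) :=
  D.eq_of_esMul (f := D.T₁ ∘ₗ LinearMap.applyₗ z ∘ₗ LinearMap.rTensorHom A)
    (g := LinearMap.applyₗ (D.T₁ z) ∘ₗ LinearMap.lTensorHom A) (fun d ω => D.T₁_L d ω z) c

lemma L_onRight_esMul (c : A) (z : A ⊗[ℂ] A) :
    D.L (onRight (D.esMul c) z) = onRight (D.esMul c) (D.L z) :=
  D.eq_of_esMul (f := D.L ∘ₗ LinearMap.applyₗ z ∘ₗ LinearMap.lTensorHom A)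
    (g := LinearMap.applyₗ (D.L z) ∘ₗ LinearMap.lTensorHom A)
    (fun d ω => (legsCommute_iff_right.1 D.comm_L_L d ω z).symm) c

/-- The multiplier `ε_s(c)` need not lie in `A`, but `u ε_s(c)` does, so linearity of `G₁` over `A`
applies after a left factor `u`. -/
lemma G₁_onLeft_esMul (c : A) (z : A ⊗[ℂ] A) :
    D.G₁ (onLeft (D.esMul c) z) = onLeft (D.esMul c) (D.G₁ z) := by
  refine D.eq_of_onLeft_mul fun u => ?_
  have e : D.mul u ∘ₗ D.esMul c = D.mul (sliceRight D.ε (D.P (u ⊗ₜ c))) :=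
    LinearMap.ext fun a => D.mul_es u c a
  rw [← G₁_onLeft_mul, onLeft_onLeft, onLeft_onLeft, e, G₁_onLeft_mul]

lemma R₁_onRight_esMul (c : A) (z : A ⊗[ℂ] A) :
    D.R₁ (onRight (D.esMul c) z) = onLeft (D.esMul c) (D.R₁ z) :=
  D.R₁_eq (by rw [T₁_onLeft_esMul, T₁_R₁, L_onRight_esMul]) (by rw [G₁_onLeft_esMul, G₁_R₁])

/-- `S(ca) b = S(a) (S(c) b)`. -/
lemma s_mul (c a b : A) : D.s (D.mul c a ⊗ₜ b) = D.s (a ⊗ₜ D.s (c ⊗ₜ b)) := by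
  -- `E(ca ⊗ b) = E(c ⊗ b)(a ⊗ 1)`, with `E(c ⊗ b)` written as `T₁R₁(c ⊗ b)`.
  have h : D.L (D.mul c a ⊗ₜ b) = onLeft (D.mul.flip a) (D.T₁ (D.R₁ (c ⊗ₜ b))) := by
    rw [T₁_R₁, ← L_onLeft_flip]; rfl
  rw [← s_L, h, ← es_R₁ D (c ⊗ₜ b)]
  refine eq_of_tmul (f := D.s ∘ₗ onLeft (D.mul.flip a) ∘ₗ D.T₁)
    (g := D.s ∘ₗ TensorProduct.mk ℂ A A a ∘ₗ D.es) (fun p q => ?_) (D.R₁ (c ⊗ₜ b))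
  -- `R₁` turns `Δ(p)` into a factor `p` on the first leg. Under `ε` this factor may be replaced by
  -- `ε_s(p)`, which then crosses `R₁` to the second leg.
  have e : D.ε ∘ₗ D.mul p = D.ε ∘ₗ D.esMul p := LinearMap.ext fun x => (D.ε_es p x).symm
  simp only [LinearMap.comp_apply, TensorProduct.mk_apply]
  rw [DL_eq_T₁, s_apply, R₁_DL, sliceLeft_onLeft, e, ← sliceLeft_onLeft, ← R₁_onRight_esMul]
  rfl

end Antipode

end HopfData

namespace HopfData

variable {A : Type*} [AddCommGroup A] [Module ℂ A] (D : HopfData A)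
variable {W : Type*} [AddCommGroup W] [Module ℂ W]

/-! ### The antipode takes values in the algebra and is surjective -/

section AntipodeExists

/-- Fullness of `E`: its first legs, after a left factor `c` on the second, are values of `es`. The
factor `c` is cancelled modulo the range. -/
lemma range_es : LinearMap.range D.es = ⊤ := by
  refine D.full_L_left _ fun ω z => ?_
  refine eq_of_tmul (f := (LinearMap.range D.es).mkQ ∘ₗ sliceRight ω ∘ₗ D.L) (g := 0)
    (fun b d => ?_) z |> (Submodule.Quotient.mk_eq_zero _).1
  simp only [LinearMap.comp_apply, LinearMap.zero_apply]
  rw [← sliceRight_onLeft]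
  have : onLeft (LinearMap.range D.es).mkQ (D.L (b ⊗ₜ d)) = 0 := by
    refine D.eq_of_onRight_mul fun c => eq_of_sliceRight fun ω => ?_
    rw [map_zero, map_zero, sliceRight_onRight, sliceRight_onLeft, ← es_legLeft_T₁]
    exact (Submodule.Quotient.mk_eq_zero _).2 ⟨_, rfl⟩
  rw [this, map_zero]

lemma range_s : LinearMap.range D.s = ⊤ := by
  rw [eq_top_iff, ← range_es]
  rintro _ ⟨z, rfl⟩
  exact ⟨D.T₁ z, D.s_T₁ z⟩

lemma eq_of_s {f g : A →ₗ[ℂ] W} (h : ∀ a b, f (D.s (a ⊗ₜ b)) = g (D.s (a ⊗ₜ b))) : f = g := by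
  ext x
  obtain ⟨z, rfl⟩ := (LinearMap.range_eq_top.1 D.range_s) x
  exact eq_of_tmul (f := f ∘ₗ D.s) (g := g ∘ₗ D.s) h z

lemma eq_of_s' {f g : A →ₗ[ℂ] W} (h : ∀ a b, f (D.s' (a ⊗ₜ b)) = g (D.s' (a ⊗ₜ b))) : f = g :=
  D.op.cop.eq_of_s fun a b => by simpa [s_op_cop] using h b a

/-- `σ c b = S(b) c`. -/
def σ (c : A) : A →ₗ[ℂ] A := D.s ∘ₗ (TensorProduct.mk ℂ A A).flip c

/-- `σ' c b = c S(b)`. -/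
def σ' (c : A) : A →ₗ[ℂ] A := D.s' ∘ₗ TensorProduct.mk ℂ A A c

lemma σ_apply (c b : A) : D.σ c b = D.s (b ⊗ₜ c) := rfl

lemma σ_op_cop (c : A) : D.op.cop.σ c = D.σ' c := LinearMap.ext fun b => by
  rw [σ_apply, s_op_cop]; rfl

/-- `S(ba) c = S(a) S(b) c`. -/
lemma σ_mul (a b c : A) : D.σ c (D.mul b a) = D.σ (D.σ c b) a := D.s_mul b a c

lemma mul_σ (c a b : A) : D.mul c (D.σ b a) = D.mul (D.σ' c a) b := D.mul_s c a b

/-- Both sides are colinear, so `ε ⊗ ι` decides, and there the claim is antimultiplicativity. -/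
lemma R₁_onRight_σ (c : A) (z : A ⊗[ℂ] A) :
    D.R₁ (onRight (D.σ c) z) = onRight (D.σ c) (D.T₃ z) := by
  refine D.eq_of_legsCommute (X := D.R₁ ∘ₗ onRight (D.σ c)) (Y := onRight (D.σ c) ∘ₗ D.T₃)
    (fun d ω z => ?_) (fun d ω z => ?_) (fun a b => ?_) z
  · rw [LinearMap.comp_apply, LinearMap.comp_apply, D.comm_T₂_R₁, onLeft_onRight]
  · rw [LinearMap.comp_apply, LinearMap.comp_apply, onLeft_onRight, D.comm_T₂_T₃]
  · rw [LinearMap.comp_apply, LinearMap.comp_apply, sliceLeft_onRight, counit_T₃, onRight_tmul,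
      ← s_apply, σ_mul]
    rfl

/-- The rigorous form of `R₁(b ⊗ c) = b₁ ⊗ S(b₂)c`. -/
lemma onRight_σ_T₂ (c a b : A) :
    onRight (D.σ c) (D.T₂ (a ⊗ₜ b)) = onLeft (D.mul a) (D.R₁ (b ⊗ₜ c)) := by
  refine eq_of_sliceLeft fun ω => ?_
  rw [sliceLeft_onRight, sliceLeft_onLeft, D.sliceLeft_of_legsCommute D.comm_T₂_R₁]
  rfl

lemma G₁_onRight_σ_P (c : A) (z : A ⊗[ℂ] A) :
    D.G₁ (onRight (D.σ c) (D.P z)) = onRight (D.σ c) (D.P z) := by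
  obtain ⟨w, hw⟩ := D.exists_T₂ z
  rw [hw]
  refine eq_of_tmul (f := D.G₁ ∘ₗ onRight (D.σ c) ∘ₗ D.T₂) (g := onRight (D.σ c) ∘ₗ D.T₂)
    (fun a b => ?_) w
  rw [LinearMap.comp_apply, LinearMap.comp_apply, onRight_σ_T₂, G₁_onLeft_mul, G₁_R₁]

/-- Sliced and covered, `T₁(a ⊗ S(v)c)` depends on `a ⊗ v` only through `t(a)S(v)`, with `t` a slice
of `T₃`. Right multiplication by `E` commutes with `t` on the first leg by `T₃_P`, and `s'` does not
see it. -/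
lemma T₁_onRight_σ_P (c : A) (z : A ⊗[ℂ] A) :
    D.T₁ (onRight (D.σ c) (D.P z)) = D.T₁ (onRight (D.σ c) z) := by
  refine D.eq_of_onRight_mul fun u => eq_of_sliceLeft fun μ => ?_
  set t : A →ₗ[ℂ] A := sliceLeft μ ∘ₗ D.T₃ ∘ₗ (TensorProduct.mk ℂ A A).flip u with ht
  have key : ∀ z, sliceLeft μ (onRight (D.mul u) (D.T₁ (onRight (D.σ c) z))) =
      D.mul (D.s' (onLeft t z)) c := fun z => by
    refine eq_of_tmul (f := sliceLeft μ ∘ₗ onRight (D.mul u) ∘ₗ D.T₁ ∘ₗ onRight (D.σ c))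
      (g := D.mul.flip c ∘ₗ D.s' ∘ₗ onLeft t) (fun a v => ?_) z
    simp only [LinearMap.comp_apply, onRight_tmul]
    rw [T₁_T₃, sliceLeft_onRight, LinearMap.flip_apply, mul_σ]
    rfl
  have hP : ∀ z, onLeft t (D.P z) = D.P (onLeft t z) := fun z => by
    refine eq_of_tmul (f := onLeft t ∘ₗ D.P) (g := D.P ∘ₗ onLeft t)
      (fun a d => eq_of_sliceRight fun ω => ?_) z
    have := congrArg (sliceLeft μ) (D.T₃_P d ω (a ⊗ₜ u))
    rw [sliceLeft_onRight] at this
    rw [LinearMap.comp_apply, sliceRight_onLeft]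
    exact this
  rw [key, key, hP, s'_P]

/-- The right side is fixed by `G₁` and has the required image under `T₁`. Formally, `G₁` inserts
`(ι ⊗ S)E` between its arguments. -/
lemma G₁_onRight_σ (c : A) (z : A ⊗[ℂ] A) :
    D.G₁ (onRight (D.σ c) z) = onRight (D.σ c) (D.P z) := by
  rw [← G₁_onRight_σ_P]
  exact D.G₁_eq_of_T₁_eq (D.T₁_onRight_σ_P c z).symm

lemma G₂_onLeft_σ' (c : A) (z : A ⊗[ℂ] A) :
    D.G₂ (onLeft (D.σ' c) z) = onLeft (D.σ' c) (D.L z) := by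
  simpa [flipConj_apply, onLeft_swap, onRight_swap, σ_op_cop] using
    congrArg swap (D.op.cop.G₁_onRight_σ c (swap z))

/-- Antimultiplicativity writes `S(x)S(b)c` as `S(bx)c`, so the right factor `S(b)c` becomes a left
factor `b` under the antipode. There `L_P` exchanges the two actions of `E`. -/
lemma G₂_σ' (c b d y v₀ b₀ : A) :
    onLeft (D.mul.flip (D.σ c b)) (onRight (D.mul d) (D.G₂ (D.σ' v₀ b₀ ⊗ₜ y))) =
      onLeft (D.mul (D.σ' v₀ b₀) ∘ₗ D.σ c) (onRight (D.mul.flip y) (D.P (b ⊗ₜ d))) := by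
  have e : D.σ' v₀ b₀ ⊗ₜ[ℂ] y = onLeft (D.σ' v₀) (b₀ ⊗ₜ y) := rfl
  have h1 : D.mul.flip (D.σ c b) ∘ₗ D.σ' v₀ = (D.mul v₀ ∘ₗ D.σ c) ∘ₗ D.mul b :=
    LinearMap.ext fun x => by
      simp only [LinearMap.comp_apply, LinearMap.flip_apply]
      rw [σ_mul, ← mul_σ]
  have h2 : (D.mul v₀ ∘ₗ D.σ c) ∘ₗ D.mul.flip b₀ = D.mul (D.σ' v₀ b₀) ∘ₗ D.σ c :=
    LinearMap.ext fun x => by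
      simp only [LinearMap.comp_apply, LinearMap.flip_apply]
      rw [σ_mul, mul_σ]
  rw [e, G₂_onLeft_σ', onLeft_onRight, onLeft_onLeft, h1, ← onLeft_onRight, ← onLeft_onLeft,
    L_P, onLeft_onLeft, h2]

/-- The antipode carries `G₃` to `E`, the counterpart of `G₁_onRight_σ`. By fullness the first leg
may be a leg of the coproduct, where `G₃` reduces to `P`. -/
lemma L_onRight_σ (c : A) (z : A ⊗[ℂ] A) :
    D.L (onRight (D.σ c) z) = onRight (D.σ c) (D.G₃ z) := by
  refine D.op.eq_of_T₁Leg (f := D.L ∘ₗ onRight (D.σ c)) (g := onRight (D.σ c) ∘ₗ D.G₃)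
    (fun a ω z => ?_) z
  have hG := D.op.G₁_T₁Leg a ω z
  rw [op_G₁, op_L] at hG
  rw [LinearMap.comp_apply, LinearMap.comp_apply, hG]
  refine eq_of_tmul (f := D.L ∘ₗ onRight (D.σ c) ∘ₗ onLeft (D.op.T₁Leg a ω) ∘ₗ swap)
    (g := onRight (D.σ c) ∘ₗ onLeft (D.op.T₁Leg a ω) ∘ₗ swap ∘ₗ D.P) (fun b d => ?_) z
  simp only [LinearMap.comp_apply, swap_tmul, onLeft_tmul, onRight_tmul]
  -- The test factor `v` is taken of the form `v₀S(b₀)`; such elements span `A`, and `G₂` is known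
  -- on them.
  have key : ∀ v, onRight (D.mul v) (D.L (D.op.T₁Leg a ω d ⊗ₜ D.σ c b)) =
      onRight (D.mul v) (onRight (D.σ c) (onLeft (D.op.T₁Leg a ω) (swap (D.P (b ⊗ₜ d))))) := by
    intro v
    refine LinearMap.congr_fun
      (f := LinearMap.applyₗ (D.L (D.op.T₁Leg a ω d ⊗ₜ D.σ c b)) ∘ₗ LinearMap.lTensorHom A ∘ₗ D.mul)
      (g := LinearMap.applyₗ (onRight (D.σ c) (onLeft (D.op.T₁Leg a ω) (swap (D.P (b ⊗ₜ d))))) ∘ₗ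
        LinearMap.lTensorHom A ∘ₗ D.mul) (D.eq_of_s' fun v₀ b₀ => ?_) v
    change onRight (D.mul (D.σ' v₀ b₀)) _ = onRight (D.mul (D.σ' v₀ b₀)) _
    generalize hv : D.σ' v₀ b₀ = v
    refine D.eq_of_onLeft_mul fun u => eq_of_sliceRight fun μ => ?_
    have hDR : ∀ u d, onLeft (D.mul u) (D.T₃ (a ⊗ₜ d)) = onRight (D.mul d) (D.T₂ (u ⊗ₜ a)) :=
      fun u d => by rw [DR_eq_T₃, DR_eq_T₂]
    have hleg : ∀ u d, D.mul u (D.op.T₁Leg a ω d) = sliceRight (ω ∘ₗ D.mul d) (D.T₂ (u ⊗ₜ a)) :=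
      fun u d => by
        rw [T₁Leg_apply, op_T₁, ← sliceRight_onLeft, hDR, sliceRight_onRight]
    -- `G₂_spec` turns a slice of `P` acting before `T₂` into a slice of `G₂` acting after it, which
    -- `G₂_σ'` evaluates.
    have hspec := congrArg (sliceRight (ω ∘ₗ D.mul d))
      (D.G₂_spec v (μ ∘ₗ D.mul.flip (D.σ c b)) (u ⊗ₜ a))
    rw [L_P, sliceRight_onLeft, sliceRight_onRight, LinearMap.flip_apply,
      ← legLeft_apply, hleg, ← onLeft_tmul, ← hspec, sliceRight_onRight,
      sliceRight_onLeft, onRight_onRight, ← onLeft_onRight, sliceRight_onLeft, hleg]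
    congr 2
    ext y
    simp only [LinearMap.comp_apply, legRight_apply]
    have hK := congrArg (fun z => ω (sliceLeft μ z)) (D.G₂_σ' c b d y v₀ b₀)
    simp only [hv] at hK
    rw [sliceLeft_onLeft, sliceLeft_onRight, sliceLeft_onLeft, sliceLeft_onRight] at hK
    rw [hK, onRight_swap, sliceRight_swap, sliceLeft_onLeft]
    rfl
  exact D.eq_of_onRight_mul key

/-- The generalized inverse of `T₃`. -/
def R₃ : A ⊗[ℂ] A →ₗ[ℂ] A ⊗[ℂ] A := D.op.R₁

/-- Replace `z` by `T₃R₃z`; then `R₁_onRight_σ` produces `T₁R₁ = E`, and `L_onRight_σ` turns `E`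
into `G₃`, which fixes `R₃z`. -/
lemma onRight_σ_R₃ (c : A) (z : A ⊗[ℂ] A) :
    onRight (D.σ c) (D.R₃ z) = D.T₁ (onRight (D.σ c) z) := by
  have h1 : D.G₃ (D.R₃ z) = D.R₃ z := D.op.G₁_R₁ z
  have h2 : D.T₃ (D.R₃ z) = D.P z := D.op.T₁_R₁ z
  rw [← T₁_onRight_σ_P, ← h2, ← R₁_onRight_σ, T₁_R₁, L_onRight_σ, h1]

lemma s_op_s (a b c : A) : D.s (D.op.s (a ⊗ₜ b) ⊗ₜ c) = D.mul (D.s' (a ⊗ₜ b)) c := by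
  have := congrArg (sliceLeft D.ε) (D.onRight_σ_R₃ c (a ⊗ₜ b))
  rw [sliceLeft_onRight, onRight_tmul, counit_T₁, mul_σ] at this
  exact this

/-- Regularity enters here. With `S'` the antipode of the opposite algebra, `s_op_s` reads
`S(bS'(a)) = aS(b)`, whose right side lies in `A`, and the elements `bS'(a)` span `A`. -/
lemma exists_S (a : A) : ∃ z, ∀ c, D.s (a ⊗ₜ c) = D.mul z c := by
  obtain ⟨w, rfl⟩ := (LinearMap.range_eq_top.1 D.op.range_s) a
  refine ⟨D.s' w, fun c => ?_⟩
  exact eq_of_tmul (f := D.s ∘ₗ (TensorProduct.mk ℂ A A).flip c ∘ₗ D.op.s)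
    (g := D.mul.flip c ∘ₗ D.s') (fun a b => D.s_op_s a b c) w

/-- The antipode. -/
def S : A →ₗ[ℂ] A where
  toFun a := (D.exists_S a).choose
  map_add' a b := D.eq_of_mul_right fun c => by
    rw [map_add, LinearMap.add_apply, ← (D.exists_S _).choose_spec, ← (D.exists_S _).choose_spec,
      ← (D.exists_S _).choose_spec, TensorProduct.add_tmul, map_add]
  map_smul' k a := D.eq_of_mul_right fun c => by
    rw [map_smul, LinearMap.smul_apply, ← (D.exists_S _).choose_spec,
      ← (D.exists_S _).choose_spec, ← TensorProduct.smul_tmul', map_smul, RingHom.id_apply]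

lemma S_mul (a c : A) : D.mul (D.S a) c = D.s (a ⊗ₜ c) := ((D.exists_S a).choose_spec c).symm

lemma mul_S (b a : A) : D.mul b (D.S a) = D.s' (b ⊗ₜ a) := D.eq_of_mul_right fun c => by
  rw [mul_assoc, S_mul, mul_s]

lemma S_anti (a b : A) : D.S (D.mul a b) = D.mul (D.S b) (D.S a) := D.eq_of_mul_right fun c => by
  rw [mul_assoc, S_mul, S_mul, S_mul, s_mul]

lemma S_op_s (a b : A) : D.S (D.op.s (a ⊗ₜ b)) = D.s' (a ⊗ₜ b) := D.eq_of_mul_right fun c => by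
  rw [S_mul, s_op_s]

lemma S_surjective : Function.Surjective D.S := by
  rw [← LinearMap.range_eq_top]
  have h : (LinearMap.range D.S).mkQ = 0 := D.eq_of_s' fun a b => by
    rw [← S_op_s]
    exact (Submodule.Quotient.mk_eq_zero _).2 ⟨_, rfl⟩
  rw [← Submodule.ker_mkQ (LinearMap.range D.S), h, LinearMap.ker_zero]

/-- Antimultiplicativity and `S(bS'(a)) = aS(b)` give `S(S'(a))S(b) = aS(b)`; cancel the surjective
`S(b)`. -/
lemma S_op_S (a : A) : D.S (D.op.S a) = a := D.eq_of_mul_right fun c => by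
  obtain ⟨b, rfl⟩ := D.S_surjective c
  have h : D.op.s (a ⊗ₜ b) = D.mul b (D.op.S a) := (D.op.S_mul a b).symm
  rw [← S_anti, ← h, S_op_s, mul_S]

end AntipodeExists

end HopfData

namespace HopfData

variable {A : Type*} [AddCommGroup A] [Module ℂ A] (D : HopfData A)
variable {W : Type*} [AddCommGroup W] [Module ℂ W]

/-! ### The elements `E₁aS(E₂)` -/

section Sandwich

lemma s'_tmul (p q : A) : D.s' (p ⊗ₜ q) = D.mul p (D.S q) := (D.mul_S p q).symm

lemma s_tmul (p q : A) : D.s (p ⊗ₜ q) = D.mul (D.S p) q := (D.S_mul p q).symm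

lemma s'_onLeft_S (r : A) (t : A ⊗[ℂ] A) :
    D.s' (onLeft (D.mul.flip (D.S r)) t) = D.s' (onRight (D.mul.flip r) t) :=
  eq_of_tmul (f := D.s' ∘ₗ onLeft (D.mul.flip (D.S r))) (g := D.s' ∘ₗ onRight (D.mul.flip r))
    (fun p q => by simp [s'_tmul, S_anti, D.mul_assoc]) t

lemma s'_onRight_mul (r : A) (t : A ⊗[ℂ] A) :
    D.s' (onRight (D.mul r) t) = D.mul (D.s' t) (D.S r) :=
  eq_of_tmul (f := D.s' ∘ₗ onRight (D.mul r)) (g := D.mul.flip (D.S r) ∘ₗ D.s')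
    (fun p q => by simp [s'_tmul, S_anti, D.mul_assoc]) t

lemma s'_mul (t : A ⊗[ℂ] A) (c : A) :
    D.mul (D.s' t) c = TensorProduct.lift D.mul (onRight (D.σ c) t) :=
  eq_of_tmul (f := D.mul.flip c ∘ₗ D.s') (g := TensorProduct.lift D.mul ∘ₗ onRight (D.σ c))
    (fun p q => (D.mul_σ p q c).symm) t

lemma lift_mul_surjective : Function.Surjective (TensorProduct.lift D.mul) :=
  LinearMap.range_eq_top.1 <| D.idem _ fun a b => ⟨a ⊗ₜ b, rfl⟩

lemma s'_surjective : Function.Surjective D.s' := fun a => by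
  obtain ⟨w, rfl⟩ := D.lift_mul_surjective a
  refine ⟨onRight D.op.S w, ?_⟩
  exact eq_of_tmul (f := D.s' ∘ₗ onRight D.op.S) (g := TensorProduct.lift D.mul)
    (fun p q => by simp [s'_tmul, S_op_S]) w

/-- `esRight b c = ε_s(c) b`. -/
def esRight (b : A) : A →ₗ[ℂ] A := D.es ∘ₗ (TensorProduct.mk ℂ A A).flip b

lemma esRight_apply (b c : A) : D.esRight b c = D.es (c ⊗ₜ b) := rfl

lemma es_mul (c a b : A) : D.es (c ⊗ₜ D.mul a b) = D.mul (D.es (c ⊗ₜ a)) b := by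
  have e : c ⊗ₜ[ℂ] D.mul a b = onRight (D.mul.flip b) (c ⊗ₜ a) := rfl
  rw [es_apply, e, G₁_onRight_flip, sliceLeft_onRight]
  rfl

lemma onLeft_esRight_T₁ (b q d : A) :
    onLeft (D.esRight b) (D.T₁ (q ⊗ₜ d)) = onRight (D.mul q) (D.L (b ⊗ₜ d)) := by
  refine eq_of_sliceRight fun ω => ?_
  rw [sliceRight_onLeft, sliceRight_onRight, ← es_legLeft_T₁]
  rfl

/-- `t = (1 ⊗ q)E(b ⊗ 1)`. -/
def IsCover (q b : A) (t : A ⊗[ℂ] A) : Prop :=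
  ∀ d, onRight (D.mul.flip d) t = onRight (D.mul q) (D.L (b ⊗ₜ d))

variable {D} in
lemma IsCover.unique {q b : A} {t t' : A ⊗[ℂ] A} (h : D.IsCover q b t) (h' : D.IsCover q b t') :
    t = t' :=
  D.eq_of_onRight_flip fun d => by rw [h d, h' d]

/-- From `ε_s(q₁) ⊗ q₂ = (1 ⊗ q)E`: the cover attached to `q'q` is `ε_s(q₁)b ⊗ q'q₂`. Idempotence
then reaches every element of `A`. -/
lemma isCover_esRight (b : A) (w : A ⊗[ℂ] A) :
    D.IsCover (TensorProduct.lift D.mul.flip w) b (onLeft (D.esRight b) (D.T₃ w)) := by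
  intro d
  refine eq_of_tmul (f := onRight (D.mul.flip d) ∘ₗ onLeft (D.esRight b) ∘ₗ D.T₃)
    (g := LinearMap.applyₗ (D.L (b ⊗ₜ d)) ∘ₗ LinearMap.lTensorHom A ∘ₗ D.mul ∘ₗ
      TensorProduct.lift D.mul.flip) (fun q q' => ?_) w
  simp only [LinearMap.comp_apply]
  rw [← onLeft_onRight, ← T₁_T₃, onLeft_onRight, onLeft_esRight_T₁, onRight_onRight, ← mul_comp]
  rfl

lemma exists_isCover (q b : A) : ∃ t, D.IsCover q b t := by
  obtain ⟨w, rfl⟩ := D.op.lift_mul_surjective q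
  exact ⟨_, D.isCover_esRight b w⟩

/-- For `w = p ⊗ r`, the cover of `pS(r)` is that of `p` with `S(r)` on the right of the first leg.
Under `s'` this equals `r` on the right of the second leg, which leaves `(1 ⊗ q)E(p ⊗ r)`. -/
lemma mul_s'_L (w : A ⊗[ℂ] A) {q : A} {t : A ⊗[ℂ] A} (h : D.IsCover q (D.s' w) t) :
    D.mul (D.s' (D.L w)) (D.S q) = D.s' t := by
  obtain ⟨v, rfl⟩ := D.op.lift_mul_surjective q
  rw [h.unique (D.isCover_esRight _ v)]
  refine eq_of_tmul (f := D.mul.flip (D.S (TensorProduct.lift D.op.mul v)) ∘ₗ D.s' ∘ₗ D.L)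
    (g := D.s' ∘ₗ LinearMap.applyₗ (D.T₃ v) ∘ₗ LinearMap.rTensorHom A ∘ₗ
      (TensorProduct.curry D.es).flip ∘ₗ D.s') (fun p r => ?_) w
  change D.mul (D.s' (D.L (p ⊗ₜ r))) (D.S (TensorProduct.lift D.op.mul v)) =
    D.s' (onLeft (D.esRight (D.s' (p ⊗ₜ r))) (D.T₃ v))
  have e : D.esRight (D.s' (p ⊗ₜ r)) = D.mul.flip (D.S r) ∘ₗ D.esRight p :=
    LinearMap.ext fun c => by
      rw [s'_tmul, esRight_apply, es_mul]; rfl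
  rw [e, ← onLeft_onLeft, s'_onLeft_S, D.isCover_esRight p v r, s'_onRight_mul]
  rfl

/-- Use a linear section of `s'`. Independence of the section is `mul_s'_L`, where the right side
depends only on the element `b`. -/
lemma exists_π : ∃ π : A →ₗ[ℂ] A, ∀ q b t, D.IsCover q b t → D.mul (π b) (D.S q) = D.s' t := by
  obtain ⟨g, hg⟩ := LinearMap.exists_rightInverse_of_surjective D.s'
    (LinearMap.range_eq_top.2 D.s'_surjective)
  refine ⟨D.s' ∘ₗ D.L ∘ₗ g, fun q b t h => D.mul_s'_L (g b) ?_⟩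
  rwa [show D.s' (g b) = b from LinearMap.congr_fun hg b]

/-- `π a = E₁ a S(E₂)`. -/
def π : A →ₗ[ℂ] A := D.exists_π.choose

variable {D} in
lemma IsCover.mul_S {q b : A} {t : A ⊗[ℂ] A} (h : D.IsCover q b t) :
    D.mul (D.π b) (D.S q) = D.s' t := D.exists_π.choose_spec q b t h

lemma π_s' (w : A ⊗[ℂ] A) : D.π (D.s' w) = D.s' (D.L w) := D.eq_of_mul_right fun c => by
  obtain ⟨q, rfl⟩ := D.S_surjective c
  obtain ⟨t, ht⟩ := D.exists_isCover q (D.s' w)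
  rw [ht.mul_S, D.mul_s'_L w ht]

lemma range_π : LinearMap.range D.π = LinearMap.range (D.s' ∘ₗ D.L) := by
  ext z
  constructor
  · rintro ⟨b, rfl⟩
    obtain ⟨w, rfl⟩ := D.s'_surjective b
    exact ⟨w, (D.π_s' w).symm⟩
  · rintro ⟨w, rfl⟩
    exact ⟨D.s' w, D.π_s' w⟩

lemma range_s'_T₄ : LinearMap.range (D.s' ∘ₗ D.T₄) = LinearMap.range (D.s' ∘ₗ D.L) := by
  ext z
  constructor
  · rintro ⟨w, rfl⟩
    exact ⟨D.T₄ w, by rw [LinearMap.comp_apply, L_T₄, LinearMap.comp_apply]⟩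
  · rintro ⟨w, rfl⟩
    obtain ⟨v, hv⟩ := D.exists_T₄ w
    exact ⟨v, by rw [LinearMap.comp_apply, ← hv, LinearMap.comp_apply]⟩

end Sandwich

/-! ### The range of `π` is the commutant of the source map -/

section Commutant

lemma G₂_onRight_flip (d : A) (z : A ⊗[ℂ] A) :
    D.G₂ (onRight (D.mul.flip d) z) = onRight (D.mul.flip d) (D.G₂ z) := by
  simpa [flipConj_apply, onLeft_swap, onRight_swap] using
    congrArg swap (D.op.cop.G₁_onLeft_mul d (swap z))

lemma mul_legLeft_L (u a d : A) (ω : A →ₗ[ℂ] ℂ) :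
    D.mul u ∘ₗ legLeft D.L d (ω ∘ₗ D.mul a) =
      D.mul (legLeft D.P a (ω ∘ₗ D.mul.flip d) u) := LinearMap.ext fun b => by
  have := congrArg (sliceRight ω) (D.L_P u a b d)
  rw [sliceRight_onLeft, sliceRight_onLeft, sliceRight_onRight, sliceRight_onRight] at this
  exact this

lemma legRight_G₂_flip (a e : A) (ω : A →ₗ[ℂ] ℂ) :
    legRight D.G₂ a ω ∘ₗ D.mul.flip e = D.mul.flip e ∘ₗ legRight D.G₂ a ω :=
  LinearMap.ext fun b => by
    have h : a ⊗ₜ[ℂ] D.mul.flip e b = onRight (D.mul.flip e) (a ⊗ₜ b) := rfl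
    rw [LinearMap.comp_apply, legRight_apply, h, G₂_onRight_flip, sliceLeft_onRight]
    rfl

/-- A slice `y` of the first leg of `E` in front of `b₁` becomes an operator `y'`, a slice of `G₂`,
in front of `b₂`. This is `G₂_spec` after a left factor. -/
lemma onLeft_legLeft_L_T₁ (a d : A) (ω : A →ₗ[ℂ] ℂ) (z : A ⊗[ℂ] A) :
    onLeft (legLeft D.L d (ω ∘ₗ D.mul a)) (D.T₁ z) =
      onRight (legRight D.G₂ a (ω ∘ₗ D.mul.flip d)) (D.T₁ z) := by
  refine eq_of_tmul (f := onLeft (legLeft D.L d (ω ∘ₗ D.mul a)) ∘ₗ D.T₁)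
    (g := onRight (legRight D.G₂ a (ω ∘ₗ D.mul.flip d)) ∘ₗ D.T₁)
    (fun b e => D.eq_of_onLeft_mul fun u => ?_) z
  simp only [LinearMap.comp_apply]
  rw [onLeft_onLeft, mul_legLeft_L, T₁_T₂, ← onLeft_tmul, ← G₂_spec, onRight_onRight,
    ← legRight_G₂_flip, ← onRight_onRight, ← T₁_T₂, onLeft_onRight]

lemma R₁_onRight_legLeft_L (a d : A) (ω : A →ₗ[ℂ] ℂ) (z : A ⊗[ℂ] A) :
    D.R₁ (onRight (legLeft D.L d (ω ∘ₗ D.mul a)) z) =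
      onLeft (legLeft D.L d (ω ∘ₗ D.mul a)) (D.R₁ z) := by
  rw [← esMul_legLeft_T₁, R₁_onRight_esMul]

/-- Formally `S(y'x)c = S(x)yc`. On second legs of `T₂` the map `σ` produces `R₁`, through which `y`
passes by `R₁_onRight_esMul`. -/
lemma σ_comp_legRight_G₂ (a c d : A) (ω : A →ₗ[ℂ] ℂ) :
    D.σ c ∘ₗ legRight D.G₂ a (ω ∘ₗ D.mul.flip d) =
      D.σ (legLeft D.L d (ω ∘ₗ D.mul a) c) := by
  refine D.eq_of_onRight_T₂ fun z => ?_
  refine eq_of_tmul (f := onRight (D.σ c ∘ₗ legRight D.G₂ a (ω ∘ₗ D.mul.flip d)) ∘ₗ D.T₂)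
    (g := onRight (D.σ (legLeft D.L d (ω ∘ₗ D.mul a) c)) ∘ₗ D.T₂) (fun u b => ?_) z
  simp only [LinearMap.comp_apply]
  rw [← onRight_onRight, G₂_spec, onLeft_tmul, onRight_σ_T₂, onRight_σ_T₂, ← mul_legLeft_L,
    ← onLeft_onLeft, ← R₁_onRight_legLeft_L, onRight_tmul]

/-- Writing `E w` as sums of `Δ(b)(1 ⊗ e)`, the computation is `yb₁S(b₂e)c = b₁S(y'b₂e)c =
b₁S(b₂e)yc`. -/
lemma mul_esMul_of_mem (w : A ⊗[ℂ] A) (a c : A) :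
    D.mul (D.s' (D.L w)) (D.esMul a c) = D.esMul a (D.mul (D.s' (D.L w)) c) := by
  refine LinearMap.congr_fun
    (f := D.mul (D.s' (D.L w)) ∘ₗ LinearMap.applyₗ c ∘ₗ TensorProduct.curry D.es)
    (g := LinearMap.applyₗ (D.mul (D.s' (D.L w)) c) ∘ₗ TensorProduct.curry D.es)
    (D.eq_of_legLeft_T₁ fun a d ω => ?_) a
  change D.mul (D.s' (D.L w)) (D.esMul _ c) = D.esMul _ (D.mul (D.s' (D.L w)) c)
  obtain ⟨v, hv⟩ := D.exists_T₁ w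
  have e : ∀ t, D.esMul (legLeft D.T₁ d ω a) (TensorProduct.lift D.mul t) =
      TensorProduct.lift D.mul (onLeft (D.esMul (legLeft D.T₁ d ω a)) t) :=
    eq_of_tmul (f := D.esMul (legLeft D.T₁ d ω a) ∘ₗ TensorProduct.lift D.mul)
      (g := TensorProduct.lift D.mul ∘ₗ onLeft (D.esMul (legLeft D.T₁ d ω a)))
      fun p q => D.es_mul _ p q
  rw [s'_mul, s'_mul, e, esMul_legLeft_T₁, hv, onLeft_onRight, onLeft_legLeft_L_T₁,
    onRight_onRight, σ_comp_legRight_G₂]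

/-- The first legs of `(1 ⊗ a)E` are source values, with which `z` commutes; then `a` is cancelled.
-/
lemma L_onLeft_of_comm {z : A} (h : ∀ a c, D.mul z (D.esMul a c) = D.esMul a (D.mul z c))
    (w : A ⊗[ℂ] A) : D.L (onLeft (D.mul z) w) = onLeft (D.mul z) (D.L w) := by
  refine eq_of_tmul (f := D.L ∘ₗ onLeft (D.mul z)) (g := onLeft (D.mul z) ∘ₗ D.L)
    (fun b d => D.eq_of_onRight_mul fun a => eq_of_sliceRight fun ω => ?_) w
  have := h (legLeft D.T₁ d ω a) b
  rw [esMul_legLeft_T₁, legLeft_apply, legLeft_apply] at this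
  rw [LinearMap.comp_apply, LinearMap.comp_apply, sliceRight_onRight, sliceRight_onRight,
    sliceRight_onLeft, onLeft_tmul, this]

lemma isCover_P {z : A} (h : ∀ w, D.L (onLeft (D.mul z) w) = onLeft (D.mul z) (D.L w)) (q : A) :
    D.IsCover q z (D.P (z ⊗ₜ q)) := fun d => D.eq_of_onLeft_flip fun c => by
  rw [← L_P, onLeft_onRight, ← h, onLeft_tmul, onLeft_onRight, ← L_onLeft_flip, onLeft_tmul]
  rfl

/-- The cover is `(z ⊗ q)E`, and `s'` absorbs `E`, so `π(z)S(q) = zS(q)`. -/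
lemma π_eq_self {z : A} (h : ∀ w, D.L (onLeft (D.mul z) w) = onLeft (D.mul z) (D.L w)) :
    D.π z = z := D.eq_of_mul_right fun c => by
  obtain ⟨q, rfl⟩ := D.S_surjective c
  rw [(D.isCover_P h q).mul_S, s'_P, s'_tmul]

/-- The algebra `A₀`. -/
def A₀ : Submodule ℂ A := LinearMap.range (D.s' ∘ₗ D.L)

lemma mem_A₀_iff {z : A} :
    z ∈ D.A₀ ↔ ∀ a c, D.mul z (D.esMul a c) = D.esMul a (D.mul z c) := by
  constructor
  · rintro ⟨w, rfl⟩ a c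
    exact D.mul_esMul_of_mem w a c
  · intro h
    rw [A₀, ← range_π]
    exact ⟨z, D.π_eq_self (D.L_onLeft_of_comm h)⟩

lemma mem_A₀_iff_L {z : A} :
    z ∈ D.A₀ ↔ ∀ w, D.L (onLeft (D.mul z) w) = onLeft (D.mul z) (D.L w) := by
  constructor
  · intro h
    exact D.L_onLeft_of_comm (D.mem_A₀_iff.1 h)
  · intro h
    rw [A₀, ← range_π]
    exact ⟨z, D.π_eq_self h⟩

lemma P_onLeft_of_L_onLeft {z : A}
    (h : ∀ w, D.L (onLeft (D.mul z) w) = onLeft (D.mul z) (D.L w)) (w : A ⊗[ℂ] A) :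
    D.P (onLeft (D.mul.flip z) w) = onLeft (D.mul.flip z) (D.P w) := by
  refine eq_of_tmul (f := D.P ∘ₗ onLeft (D.mul.flip z)) (g := onLeft (D.mul.flip z) ∘ₗ D.P)
    (fun u v => D.eq_of_onRight_flip fun y => D.eq_of_onLeft_flip fun x => ?_) w
  simp only [LinearMap.comp_apply, onLeft_tmul]
  rw [← L_P, ← onLeft_onRight, onLeft_onLeft, ← flip_comp, ← L_P, LinearMap.flip_apply, mul_comp,
    ← onLeft_onLeft, onLeft_onRight, ← h]
  rfl

/-- Commutation of `z ⊗ 1` with `E` does not distinguish an algebra from its opposite. Right-handed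
statements about this space thus follow from left-handed ones. -/
lemma A₀_op : D.op.A₀ = D.A₀ := by
  ext z
  rw [mem_A₀_iff_L, mem_A₀_iff_L]
  exact ⟨fun h => D.op.P_onLeft_of_L_onLeft h, fun h => D.P_onLeft_of_L_onLeft h⟩

lemma mul_mem_A₀ {x y : A} (hx : x ∈ D.A₀) (hy : y ∈ D.A₀) : D.mul x y ∈ D.A₀ := by
  rw [mem_A₀_iff] at *
  intro a c
  rw [mul_assoc, hy, hx, mul_assoc]

end Commutant

/-! ### Local units -/

section LocalUnits

lemma op_es_mul (θ x u : A) :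
    D.mul (D.op.es (θ ⊗ₜ x)) u = D.mul x (sliceRight D.ε (D.L (u ⊗ₜ θ))) :=
  D.op.mul_es u θ x

/-- `targetLeg b θ = (ι ⊗ ε) E(b ⊗ θ)`. -/
def targetLeg (b : A) : A →ₗ[ℂ] A := sliceRight D.ε ∘ₗ D.L ∘ₗ TensorProduct.mk ℂ A A b

/-- The cover formula `isCover_esRight` for the opposite algebra, transported by `L_P`. -/
lemma L_eq_targetLeg (b : A) (w : A ⊗[ℂ] A) :
    onLeft (D.targetLeg b) (D.T₁ w) = D.L (b ⊗ₜ TensorProduct.lift D.mul w) := by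
  refine D.eq_of_onRight_mul fun d => D.eq_of_onLeft_mul fun u => ?_
  have e : D.mul u ∘ₗ D.targetLeg b = D.mul.flip b ∘ₗ D.op.esRight u :=
    LinearMap.ext fun θ => (D.op_es_mul θ u b).symm
  have h : onRight (D.mul d) (onLeft (D.op.esRight u) (D.T₁ w)) =
      onRight (D.mul.flip (TensorProduct.lift D.mul w)) (D.P (u ⊗ₜ d)) :=
    D.op.isCover_esRight u w d
  rw [L_P, onLeft_onRight, onLeft_onLeft, e, ← onLeft_onLeft, ← onLeft_onRight, h]

/-- Formally `R₁(p ⊗ t) = p₁ ⊗ S(p₂)t`, so its second legs lie in `At`. -/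
lemma sliceLeft_R₁_mem {Y : Submodule ℂ A} {t : A} (hY : ∀ a, D.mul a t ∈ Y) (ω : A →ₗ[ℂ] ℂ)
    (p : A) : sliceLeft ω (D.R₁ (p ⊗ₜ t)) ∈ Y := by
  have h : onRight Y.mkQ (D.R₁ (p ⊗ₜ t)) = 0 := D.eq_of_onLeft_mul fun u => by
    rw [onLeft_onRight, ← onRight_σ_T₂, onRight_onRight, map_zero]
    have : Y.mkQ ∘ₗ D.σ t = 0 := LinearMap.ext fun y =>
      (Submodule.Quotient.mk_eq_zero _).2 (by rw [σ_apply, s_tmul]; exact hY _)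
    rw [this]
    simp [onRight]
  have := congrArg (sliceLeft ω) h
  rw [sliceLeft_onRight, map_zero] at this
  exact (Submodule.Quotient.mk_eq_zero _).1 this

lemma sliceLeft_L_mem {t : A} (ω : A →ₗ[ℂ] ℂ) (p : A) :
    sliceLeft ω (D.L (p ⊗ₜ t)) ∈ LinearMap.range (D.mul.flip t) := by
  rw [← T₁_R₁]
  obtain ⟨v, hv⟩ := mem_range_onRight fun ω =>
    D.sliceLeft_R₁_mem (Y := LinearMap.range (D.mul.flip t)) (fun a => ⟨a, rfl⟩) ω p
  rw [← hv]
  have key : ((LinearMap.range (D.mul.flip t)).mkQ ∘ₗ sliceLeft ω ∘ₗ D.T₁ ∘ₗ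
      onRight (LinearMap.range (D.mul.flip t)).subtype) = 0 := by
    refine TensorProduct.ext' fun a y => ?_
    obtain ⟨_, b, rfl⟩ := y
    have e : a ⊗ₜ[ℂ] D.mul.flip t b = onRight (D.mul.flip t) (a ⊗ₜ b) := rfl
    simp only [LinearMap.comp_apply, onRight_tmul, Submodule.subtype_apply]
    rw [e, T₁_onRight_flip, sliceLeft_onRight]
    exact (Submodule.Quotient.mk_eq_zero _).2 ⟨_, rfl⟩
  exact (Submodule.Quotient.mk_eq_zero _).1 (LinearMap.congr_fun key v)

/-- Left multiplication with `S(ε_t(θ))`. -/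
def targetMul : A →ₗ[ℂ] A →ₗ[ℂ] A :=
  (TensorProduct.curry D.op.es).compr₂ D.S |>.compl₂ D.op.S

lemma targetMul_apply (θ c : A) : D.targetMul θ c = D.S (D.op.es (θ ⊗ₜ D.op.S c)) := rfl

lemma targetMul_mul (θ a c : A) :
    D.targetMul θ (D.mul a c) = D.mul (D.targetMul θ a) c := by
  have h : D.op.es (θ ⊗ₜ D.mul (D.op.S c) (D.op.S a)) =
      D.mul (D.op.S c) (D.op.es (θ ⊗ₜ D.op.S a)) := D.op.es_mul θ (D.op.S a) (D.op.S c)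
  have h' : D.op.S (D.mul a c) = D.mul (D.op.S c) (D.op.S a) := D.op.S_anti c a
  rw [targetMul_apply, h', h, S_anti, S_op_S, targetMul_apply]

/-- After a factor `S(b)`, use `S(b)t = s(E(b ⊗ t))` and expand `E(b ⊗ t)` by `L_eq_targetLeg`. -/
lemma lift_targetMul (w : A ⊗[ℂ] A) :
    TensorProduct.lift D.targetMul (D.T₁ w) = TensorProduct.lift D.mul w := by
  refine D.eq_of_mul_left fun c => ?_
  obtain ⟨b, rfl⟩ := D.S_surjective c
  rw [D.S_mul b (TensorProduct.lift D.mul w), ← s_L, ← L_eq_targetLeg]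
  refine eq_of_tmul (f := D.mul (D.S b) ∘ₗ TensorProduct.lift D.targetMul)
    (g := D.s ∘ₗ onLeft (D.targetLeg b)) (fun θ t => ?_) (D.T₁ w)
  simp only [LinearMap.comp_apply, TensorProduct.lift.tmul, onLeft_tmul]
  rw [targetMul_apply, ← S_anti, op_es_mul, S_anti, S_op_S, s_tmul]
  rfl

lemma targetMul_eq_zero {θ : A} (h : ∀ b, D.targetLeg b θ = 0) : D.targetMul θ = 0 :=
  LinearMap.ext fun c => by
    have : D.op.es (θ ⊗ₜ D.op.S c) = 0 := D.eq_of_mul_right fun u => by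
      rw [op_es_mul, map_zero, LinearMap.zero_apply]
      exact (congrArg _ (h u)).trans (map_zero _)
    rw [targetMul_apply, this, map_zero, LinearMap.zero_apply]

/-- By `lift_targetMul`, `t` is a sum of `f(t')` over a tensor `∑ f ⊗ t'` of left multipliers and
elements. Its second legs can be taken in `At` because those of `E(b ⊗ t)` lie there, and `f(bt) =
f(b)t` puts the sum in `At`. -/
lemma exists_mul_eq (t : A) : ∃ a, D.mul a t = t := by
  obtain ⟨w, rfl⟩ := D.lift_mul_surjective t
  set t := TensorProduct.lift D.mul w with ht
  set Y := LinearMap.range (D.mul.flip t) with hY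
  change t ∈ Y
  let M : Submodule ℂ (A →ₗ[ℂ] A) := LinearMap.range D.targetMul
  have hM : ∀ ν : M →ₗ[ℂ] ℂ, sliceLeft ν (onLeft D.targetMul.rangeRestrict (D.T₁ w)) ∈ Y := by
    intro ν
    refine (Submodule.Quotient.mk_eq_zero _).1 (eq_of_forall_dual fun ω => ?_)
    rw [map_zero]
    change (ω ∘ₗ Y.mkQ) _ = 0
    rw [apply_sliceLeft, sliceRight_onLeft]
    -- A functional vanishing on `At` annihilates the second legs of `E(b ⊗ t)`, so the
    -- corresponding slice of `T₁ w` has zero target leg for every `b`.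
    have : D.targetMul (sliceRight (ω ∘ₗ Y.mkQ) (D.T₁ w)) = 0 := D.targetMul_eq_zero fun b => by
      rw [← sliceRight_onLeft, L_eq_targetLeg]
      refine eq_of_forall_dual fun μ => ?_
      rw [← apply_sliceLeft, map_zero, LinearMap.comp_apply]
      have h : Y.mkQ (sliceLeft μ (D.L (b ⊗ₜ t))) = 0 :=
        (Submodule.Quotient.mk_eq_zero _).2 (D.sliceLeft_L_mem μ b)
      rw [h, map_zero]
    have h0 : D.targetMul.rangeRestrict (sliceRight (ω ∘ₗ Y.mkQ) (D.T₁ w)) = 0 :=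
      Subtype.ext this
    rw [h0, map_zero]
  obtain ⟨v, hv⟩ := mem_range_onRight hM
  have e : t = TensorProduct.lift M.subtype (onLeft D.targetMul.rangeRestrict (D.T₁ w)) := by
    rw [ht, ← lift_targetMul]
    exact eq_of_tmul (f := TensorProduct.lift D.targetMul)
      (g := TensorProduct.lift M.subtype ∘ₗ onLeft D.targetMul.rangeRestrict)
      (fun _ _ => rfl) _
  rw [← hv] at e
  have key : Y.mkQ ∘ₗ TensorProduct.lift M.subtype ∘ₗ onRight Y.subtype = 0 := by
    refine TensorProduct.ext' fun f y => ?_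
    obtain ⟨_, θ, rfl⟩ := f
    obtain ⟨_, b, rfl⟩ := y
    refine (Submodule.Quotient.mk_eq_zero _).2 ⟨D.targetMul θ b, ?_⟩
    exact (D.targetMul_mul θ b t).symm
  rw [e]
  exact (Submodule.Quotient.mk_eq_zero _).1 (LinearMap.congr_fun key v)

lemma exists_onRight_mul_eq_aux (z : A ⊗[ℂ] A) : ∀ a, ∃ e, onRight (D.mul e) z = z ∧
    ∀ y : A ⊗[ℂ] A, onRight (D.mul a) y = y → onRight (D.mul e) y = y := by
  induction z with
  | zero => exact fun a => ⟨a, map_zero _, fun _ h => h⟩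
  | tmul p q =>
    intro a
    obtain ⟨b, hb⟩ := D.exists_mul_eq (q - D.mul a q)
    -- Formally `1 - e = (1 - b)(1 - a)`: the new unit fixes `q` and everything that `a` already
    -- fixes.
    refine ⟨a + b - D.mul b a, ?_, fun y hy => ?_⟩
    · rw [onRight_tmul, map_sub, map_add, LinearMap.sub_apply, LinearMap.add_apply, mul_assoc,
        add_sub_assoc, ← map_sub, hb, add_sub_cancel]
    · have : ∀ y : A ⊗[ℂ] A, onRight (D.mul (a + b - D.mul b a)) y = onRight (D.mul a) y +
          onRight (D.mul b) (y - onRight (D.mul a) y) :=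
        eq_of_tmul (f := onRight (D.mul (a + b - D.mul b a)))
          (g := onRight (D.mul a) + onRight (D.mul b) ∘ₗ (LinearMap.id - onRight (D.mul a)))
          fun p q => by
            simp [TensorProduct.tmul_add, TensorProduct.tmul_sub, mul_assoc, add_sub_assoc]
      rw [this, hy, sub_self, map_zero, add_zero]
  | add z z' h h' =>
    intro a
    obtain ⟨e, he, he'⟩ := h a
    obtain ⟨f, hf, hf'⟩ := h' e
    exact ⟨f, by rw [map_add, hf' z he, hf], fun y hy => hf' y (he' y hy)⟩

lemma exists_onRight_mul_eq (z : A ⊗[ℂ] A) : ∃ e, onRight (D.mul e) z = z :=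
  (D.exists_onRight_mul_eq_aux z 0).imp fun _ h => h.1

/-- This is `ε_s(q₁)S(q'q₂) = S(q'q)`: by `R₁_onRight_σ` the tensor on the left, multiplied by `c`,
is `R₁(q ⊗ S(q')c)`, and `es` after `R₁` is `s`. -/
lemma es_onRight_S_T₃ (w : A ⊗[ℂ] A) :
    D.es (onRight D.S (D.T₃ w)) = D.S (TensorProduct.lift D.mul.flip w) := by
  refine D.eq_of_mul_right fun c => ?_
  refine eq_of_tmul (f := D.mul.flip c ∘ₗ D.es ∘ₗ onRight D.S ∘ₗ D.T₃)
    (g := D.mul.flip c ∘ₗ D.S ∘ₗ TensorProduct.lift D.mul.flip) (fun q q' => ?_) w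
  have h : ∀ z, D.mul (D.es (onRight D.S z)) c = D.es (onRight (D.σ c) z) :=
    eq_of_tmul (f := D.mul.flip c ∘ₗ D.es ∘ₗ onRight D.S) (g := D.es ∘ₗ onRight (D.σ c))
      fun θ y => by
        simp only [LinearMap.comp_apply, LinearMap.flip_apply, onRight_tmul, ← es_mul, S_mul,
          σ_apply]
  simp only [LinearMap.comp_apply, LinearMap.flip_apply, TensorProduct.lift.tmul, h]
  rw [← R₁_onRight_σ, es_R₁, S_mul, s_mul]
  rfl

/-- `A₀` contains left local units for `A`. -/
lemma exists_mem_A₀_mul_eq (c : A) : ∃ z ∈ D.A₀, D.mul z c = c := by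
  obtain ⟨w, hw⟩ := D.op.lift_mul_surjective (D.op.S c)
  -- With `c = S(q)`, choose `a` acting as a unit on the second legs after `S`. Then `π(a)c` is a
  -- sum of `ε_s(θ)aS(y) = ε_s(θ)S(y)`, which adds up to `c`.
  obtain ⟨a, ha⟩ := D.exists_onRight_mul_eq (onRight D.S (D.T₃ w))
  refine ⟨D.π a, by rw [A₀, ← range_π]; exact ⟨a, rfl⟩, ?_⟩
  have hc : c = D.S (TensorProduct.lift D.mul.flip w) :=
    (D.S_op_S c).symm.trans (congrArg D.S hw.symm)
  rw [hc, (D.isCover_esRight a w).mul_S, ← es_onRight_S_T₃, ← ha]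
  refine eq_of_tmul (f := D.s' ∘ₗ onLeft (D.esRight a))
    (g := D.es ∘ₗ onRight (D.mul a) ∘ₗ onRight D.S) (fun θ y => ?_) (D.T₃ w)
  simp only [LinearMap.comp_apply, onLeft_tmul, onRight_tmul]
  rw [s'_tmul, es_mul, esRight_apply]

lemma exists_mem_A₀_eq_mul (c : A) : ∃ z ∈ D.A₀, D.mul c z = c := by
  rw [← A₀_op]
  exact D.op.exists_mem_A₀_mul_eq c

end LocalUnits

/-! ### The adjoint action -/

section Adjoint

/-- `adj a x = ∑ a₁ x S(a₂)`. -/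
def adj (a x : A) : A := D.s' (D.T₄ (x ⊗ₜ a))

lemma adj_mem (a x : A) : D.adj a x ∈ D.A₀ := ⟨D.T₄ (x ⊗ₜ a), by
  rw [LinearMap.comp_apply, L_T₄, adj]⟩

/-- Since `a₁pS(a₂q) = a₁pS(q)S(a₂)`, acting on `pS(q)` amounts to multiplying `p ⊗ q` by `Δ(a)`.
Multiplicativity of `Δ` then gives the module law. -/
lemma s'_DL (a : A) (z : A ⊗[ℂ] A) : D.s' (D.DL a z) = D.s' (D.T₄ (D.s' z ⊗ₜ a)) := by
  refine eq_of_tmul (f := D.s' ∘ₗ D.DL a)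
    (g := D.s' ∘ₗ D.T₄ ∘ₗ (TensorProduct.mk ℂ A A).flip a ∘ₗ D.s') (fun p q => ?_) z
  have e : D.s' (p ⊗ₜ q) ⊗ₜ[ℂ] a = onLeft (D.mul.flip (D.S q)) (p ⊗ₜ a) := by
    rw [s'_tmul]; rfl
  simp only [LinearMap.comp_apply, LinearMap.flip_apply, TensorProduct.mk_apply]
  rw [e, T₄_onLeft_flip, s'_onLeft_S, DL_eq_T₄]

lemma adj_mul_left (a b x : A) : D.adj (D.mul a b) x = D.adj a (D.adj b x) := by
  rw [adj, ← DL_T₄, s'_DL, adj, adj]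

lemma adj_mul_S (a x r : A) :
    D.mul (D.adj a x) (D.S r) = D.s' (onLeft (D.mul.flip x) (D.T₃ (a ⊗ₜ r))) := by
  rw [adj, ← s'_onRight_mul, T₃_T₄]

/-- Insert `x` between the legs of `R₁(p ⊗ v) = p₁ ⊗ S(p₂)v`. -/
lemma adj_mul_eq (p x v : A) :
    D.mul (D.adj p x) v = TensorProduct.lift D.mul (onLeft (D.mul.flip x) (D.R₁ (p ⊗ₜ v))) := by
  rw [adj, s'_mul]
  congr 1
  refine D.eq_of_onLeft_mul fun u => ?_
  rw [onLeft_onRight, T₂_T₄, ← onLeft_onRight, onRight_σ_T₂, onLeft_onLeft, onLeft_onLeft,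
    mul_comp_flip]

/-- `adj` as a bilinear map. -/
def adjMap : A →ₗ[ℂ] A →ₗ[ℂ] A := (TensorProduct.curry (D.s' ∘ₗ D.T₄)).flip

/-- The relation `(g₁c ▹ x)g₂u = g(c ▹ x)u`, which in terms of `R₁` is `R₁_DL`. -/
lemma adjMap_T₄ (x u c g : A) :
    TensorProduct.lift D.mul (TensorProduct.map (D.adjMap.flip x) (D.mul.flip u) (D.T₄ (c ⊗ₜ g))) =
      D.mul g (D.mul (D.adj c x) u) := by
  have h : ∀ z, TensorProduct.lift D.mul (TensorProduct.map (D.adjMap.flip x) (D.mul.flip u) z) =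
      TensorProduct.lift D.mul (onLeft (D.mul.flip x) (D.R₁ (onRight (D.mul.flip u) z))) :=
    eq_of_tmul (f := TensorProduct.lift D.mul ∘ₗ
        TensorProduct.map (D.adjMap.flip x) (D.mul.flip u))
      (g := TensorProduct.lift D.mul ∘ₗ onLeft (D.mul.flip x) ∘ₗ D.R₁ ∘ₗ onRight (D.mul.flip u))
      fun p q => D.adj_mul_eq p x (D.mul q u)
  have h' : ∀ z, TensorProduct.lift D.mul (onLeft (D.mul g) z) =
      D.mul g (TensorProduct.lift D.mul z) :=
    eq_of_tmul (f := TensorProduct.lift D.mul ∘ₗ onLeft (D.mul g))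
      (g := D.mul g ∘ₗ TensorProduct.lift D.mul) fun p q => D.mul_assoc g p q
  rw [h, DL_eq_T₄, R₁_DL, onLeft_onLeft, ← mul_comp_flip, ← onLeft_onLeft, h', ← adj_mul_eq]

/-- `a ▹ ((c ▹ x) y) = ∑ (a₁ c ▹ x) (a₂ ▹ y)`. -/
lemma adj_mul_right (a c x y : A) :
    TensorProduct.lift D.mul
      (TensorProduct.map (D.adjMap.flip x) (D.adjMap.flip y) (D.T₄ (c ⊗ₜ a))) =
      D.adj a (D.mul (D.adj c x) y) := by
  refine D.eq_of_mul_right fun v => ?_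
  obtain ⟨r, rfl⟩ := D.S_surjective v
  rw [adj_mul_S]
  -- After the test factor `S(r)`, both sides are `F` of a threefold tensor. Coassociativity of `T₄`
  -- with `T₃` puts `T₄` outermost, where `adjMap_T₄` evaluates it.
  let F : A ⊗[ℂ] (A ⊗[ℂ] A) →ₗ[ℂ] A := TensorProduct.lift D.mul ∘ₗ
    TensorProduct.map (D.adjMap.flip x) (D.s' ∘ₗ onLeft (D.mul.flip y))
  have h1 : ∀ z, D.mul (TensorProduct.lift D.mul
      (TensorProduct.map (D.adjMap.flip x) (D.adjMap.flip y) z)) (D.S r) =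
      F (onRight D.T₃ (TensorProduct.assoc ℂ A A A (z ⊗ₜ r))) :=
    eq_of_tmul (f := D.mul.flip (D.S r) ∘ₗ TensorProduct.lift D.mul ∘ₗ
        TensorProduct.map (D.adjMap.flip x) (D.adjMap.flip y))
      (g := F ∘ₗ onRight D.T₃ ∘ₗ (TensorProduct.assoc ℂ A A A).toLinearMap ∘ₗ
        (TensorProduct.mk ℂ (A ⊗[ℂ] A) A).flip r) fun p q => by
      change D.mul (D.mul (D.adj p x) (D.adj q y)) (D.S r) =
        D.mul (D.adj p x) (D.s' (onLeft (D.mul.flip y) (D.T₃ (q ⊗ₜ r))))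
      rw [mul_assoc, adj_mul_S]
  have h2 : ∀ z, F (onFirstTwo D.T₄ (c ⊗ₜ z)) =
      D.s' (onLeft (D.mul.flip (D.mul (D.adj c x) y)) z) := by
    refine eq_of_tmul (f := F ∘ₗ onFirstTwo D.T₄ ∘ₗ TensorProduct.mk ℂ A (A ⊗[ℂ] A) c)
      (g := D.s' ∘ₗ onLeft (D.mul.flip (D.mul (D.adj c x) y))) fun g h => ?_
    have h3 : ∀ z, F (TensorProduct.assoc ℂ A A A (z ⊗ₜ h)) = TensorProduct.lift D.mul
        (TensorProduct.map (D.adjMap.flip x) (D.mul.flip (D.mul y (D.S h))) z) :=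
      eq_of_tmul (f := F ∘ₗ (TensorProduct.assoc ℂ A A A).toLinearMap ∘ₗ
          (TensorProduct.mk ℂ (A ⊗[ℂ] A) A).flip h)
        (g := TensorProduct.lift D.mul ∘ₗ
          TensorProduct.map (D.adjMap.flip x) (D.mul.flip (D.mul y (D.S h)))) fun p q => by
        change D.mul (D.adj p x) (D.s' (D.mul q y ⊗ₜ h)) =
          D.mul (D.adj p x) (D.mul q (D.mul y (D.S h)))
        rw [s'_tmul, mul_assoc]
    refine (h3 (D.T₄ (c ⊗ₜ g))).trans ?_
    rw [adjMap_T₄, LinearMap.comp_apply, onLeft_tmul, s'_tmul, LinearMap.flip_apply, mul_assoc,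
      mul_assoc]
  rw [h1, ← h2, legsCommute_iff.1 D.comm_T₄_T₃]
  rfl

end Adjoint

end HopfData

/-! ### Calculus in multiplier algebras -/

section MultiplierLemmas

lemma eq_of_nondeg_left {A : Type*} [NonUnitalRing A] (h : IsNondegenerate A) {x y : A}
    (hxy : ∀ b, x * b = y * b) : x = y :=
  sub_eq_zero.1 <| h.1 _ fun b => by rw [sub_mul, hxy, sub_self]

lemma eq_of_nondeg_right {A : Type*} [NonUnitalRing A] (h : IsNondegenerate A) {x y : A}
    (hxy : ∀ b, b * x = b * y) : x = y :=
  sub_eq_zero.1 <| h.2 _ fun b => by rw [mul_sub, hxy, sub_self]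

variable {A : Type*} [NonUnitalRing A] [Module ℂ A] [IsScalarTower ℂ A A] [SMulCommClass ℂ A A]
variable {B : Type*} [NonUnitalRing B] [Module ℂ B] [IsScalarTower ℂ B B] [SMulCommClass ℂ B B]

lemma mul_tmul_eq (z : A ⊗[ℂ] B) (a : A) (b : B) :
    z * (a ⊗ₜ b) = onLeft ((LinearMap.mul ℂ A).flip a) (onRight ((LinearMap.mul ℂ B).flip b) z) :=
  eq_of_tmul (f := (LinearMap.mul ℂ (A ⊗[ℂ] B)).flip (a ⊗ₜ b))
    (g := onLeft ((LinearMap.mul ℂ A).flip a) ∘ₗ onRight ((LinearMap.mul ℂ B).flip b))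
    (fun _ _ => by simp) z

lemma tmul_mul_eq (z : A ⊗[ℂ] B) (a : A) (b : B) :
    (a ⊗ₜ b) * z = onLeft (LinearMap.mul ℂ A a) (onRight (LinearMap.mul ℂ B b) z) :=
  eq_of_tmul (f := LinearMap.mul ℂ (A ⊗[ℂ] B) (a ⊗ₜ b))
    (g := onLeft (LinearMap.mul ℂ A a) ∘ₗ onRight (LinearMap.mul ℂ B b))
    (fun _ _ => by simp) z

lemma IsNondegenerate.tensor (hA : IsNondegenerate A) (hB : IsNondegenerate B) :
    IsNondegenerate (A ⊗[ℂ] B) := by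
  constructor
  · intro z hz
    refine eq_of_sliceLeft fun ω => ?_
    rw [map_zero]
    refine hB.1 _ fun b => ?_
    have : onRight ((LinearMap.mul ℂ B).flip b) z = 0 := eq_of_sliceRight fun μ => by
      rw [map_zero]
      refine hA.1 _ fun a => ?_
      have := congrArg (sliceRight μ) (hz (a ⊗ₜ b))
      rwa [mul_tmul_eq, sliceRight_onLeft, map_zero] at this
    have := congrArg (sliceLeft ω) this
    rwa [sliceLeft_onRight, map_zero] at this
  · intro z hz
    refine eq_of_sliceLeft fun ω => ?_
    rw [map_zero]
    refine hB.2 _ fun b => ?_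
    have : onRight (LinearMap.mul ℂ B b) z = 0 := eq_of_sliceRight fun μ => by
      rw [map_zero]
      refine hA.2 _ fun a => ?_
      have := congrArg (sliceRight μ) (hz (a ⊗ₜ b))
      rwa [tmul_mul_eq, sliceRight_onLeft, map_zero] at this
    have := congrArg (sliceLeft ω) this
    rwa [sliceLeft_onRight, map_zero] at this

namespace Multiplier

lemma of_left (a b : A) : (of a).left b = a * b := rfl

lemma of_right (a b : A) : (of a).right b = b * a := rfl

lemma of_injective (h : IsNondegenerate A) : Function.Injective (of : A → Multiplier A) :=
  fun x y hxy => eq_of_nondeg_left h fun b => by rw [← of_left, hxy, of_left]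

lemma mul_left_apply (m n : Multiplier A) (a : A) : (m * n).left a = m.left (n.left a) := rfl

lemma mul_right_apply (m n : Multiplier A) (a : A) : (m * n).right a = n.right (m.right a) := rfl

lemma left_mul (m : Multiplier A) (a b : A) : m.left (a * b) = m.left a * b := m.2.1 a b

lemma right_mul (m : Multiplier A) (a b : A) : m.right (a * b) = a * m.right b := m.2.2.1 a b

lemma right_mul_eq (m : Multiplier A) (a b : A) : m.right a * b = a * m.left b := m.2.2.2 a b

lemma ext_left (h : IsNondegenerate A) {m n : Multiplier A} (hmn : ∀ a, m.left a = n.left a) :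
    m = n := by
  have h1 : m.left = n.left := LinearMap.ext hmn
  have h2 : m.right = n.right := LinearMap.ext fun a => eq_of_nondeg_left h fun b => by
    rw [right_mul_eq, right_mul_eq, hmn]
  exact Subtype.ext (Prod.ext h1 (MulOpposite.unop_injective h2))

lemma of_left_eq (m : Multiplier A) (a : A) : of (m.left a) = m * of a := by
  refine Subtype.ext (Prod.ext ?_ (MulOpposite.unop_injective ?_))
  · exact LinearMap.ext fun b => (left_mul m a b).symm
  · exact LinearMap.ext fun b => (right_mul_eq m b a).symm

lemma of_right_eq (m : Multiplier A) (a : A) : of (m.right a) = of a * m := by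
  refine Subtype.ext (Prod.ext ?_ (MulOpposite.unop_injective ?_))
  · exact LinearMap.ext fun b => right_mul_eq m a b
  · exact LinearMap.ext fun b => (right_mul m b a).symm

lemma tmul_mul_tmul (m m' : Multiplier A) (n n' : Multiplier B) :
    tmul m n * tmul m' n' = tmul (m * m') (n * n') := by
  refine Subtype.ext (Prod.ext ?_ (MulOpposite.unop_injective ?_))
  · exact TensorProduct.ext' fun _ _ => rfl
  · exact TensorProduct.ext' fun _ _ => rfl

lemma of_tmul (a : A) (b : B) : of (a ⊗ₜ[ℂ] b) = tmul (of a) (of b) := by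
  refine Subtype.ext (Prod.ext ?_ (MulOpposite.unop_injective ?_))
  · exact TensorProduct.ext' fun _ _ => by
      change (a ⊗ₜ[ℂ] b) * _ = _; rw [Algebra.TensorProduct.tmul_mul_tmul]; rfl
  · exact TensorProduct.ext' fun _ _ => by
      change _ * (a ⊗ₜ[ℂ] b) = _; rw [Algebra.TensorProduct.tmul_mul_tmul]; rfl

lemma of_onLeft (m : Multiplier A) (z : A ⊗[ℂ] B) :
    of (onLeft m.left z) = tmul m 1 * of z := of_left_eq (tmul m 1) z

lemma of_onRight (m : Multiplier B) (z : A ⊗[ℂ] B) :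
    of (onRight m.left z) = tmul 1 m * of z := of_left_eq (tmul 1 m) z

lemma of_onLeft_right (m : Multiplier A) (z : A ⊗[ℂ] B) :
    of (onLeft m.right z) = of z * tmul m 1 := of_right_eq (tmul m 1) z

lemma of_onRight_right (m : Multiplier B) (z : A ⊗[ℂ] B) :
    of (onRight m.right z) = of z * tmul 1 m := of_right_eq (tmul 1 m) z

lemma of_onLeft_mul (a : A) (z : A ⊗[ℂ] B) :
    of (onLeft (LinearMap.mul ℂ A a) z) = tmul (of a) 1 * of z := of_onLeft (of a) z

lemma of_onRight_mul (b : B) (z : A ⊗[ℂ] B) :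
    of (onRight (LinearMap.mul ℂ B b) z) = tmul 1 (of b) * of z := of_onRight (of b) z

lemma of_onLeft_flip (a : A) (z : A ⊗[ℂ] B) :
    of (onLeft ((LinearMap.mul ℂ A).flip a) z) = of z * tmul (of a) 1 := of_onLeft_right (of a) z

lemma of_onRight_flip (b : B) (z : A ⊗[ℂ] B) :
    of (onRight ((LinearMap.mul ℂ B).flip b) z) = of z * tmul 1 (of b) :=
  of_onRight_right (of b) z

lemma of_tmul_eq (a : A) (b : B) : of (a ⊗ₜ[ℂ] b) = tmul (of a) 1 * tmul 1 (of b) := by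
  rw [of_tmul, tmul_mul_tmul, mul_one, one_mul]

lemma of_tmul_eq' (a : A) (b : B) : of (a ⊗ₜ[ℂ] b) = tmul 1 (of b) * tmul (of a) 1 := by
  rw [of_tmul, tmul_mul_tmul, mul_one, one_mul]

lemma flip_left (m : Multiplier (A ⊗[ℂ] A)) : (flip m).left = flipConj m.left := rfl

lemma flip_right (m : Multiplier (A ⊗[ℂ] A)) : (flip m).right = flipConj m.right := rfl

lemma ext_left_right {m n : Multiplier A} (hl : ∀ a, m.left a = n.left a)
    (hr : ∀ a, m.right a = n.right a) : m = n :=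
  Subtype.ext (Prod.ext (LinearMap.ext hl) (MulOpposite.unop_injective (LinearMap.ext hr)))

lemma flip_mul (m n : Multiplier (A ⊗[ℂ] A)) : flip (m * n) = flip m * flip n :=
  ext_left_right
    (fun a => by simp only [mul_left_apply, flip_left, flipConj_apply, swap_swap])
    (fun a => by simp only [mul_right_apply, flip_right, flipConj_apply, swap_swap])

lemma flip_flip (m : Multiplier (A ⊗[ℂ] A)) : flip (flip m) = m :=
  ext_left_right (fun a => by simp only [flip_left, flipConj_flipConj])
    (fun a => by simp only [flip_right, flipConj_flipConj])

lemma flip_tmul (m n : Multiplier A) : flip (tmul m n) = tmul n m :=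
  ext_left_right
    (fun z => eq_of_tmul (f := (flip (tmul m n)).left) (g := (tmul n m).left) (fun _ _ => rfl) z)
    (fun z => eq_of_tmul (f := (flip (tmul m n)).right) (g := (tmul n m).right) (fun _ _ => rfl) z)

lemma swap_mul (z w : A ⊗[ℂ] A) : swap (z * w) = swap z * swap w := by
  refine eq_of_tmul (f := swap ∘ₗ LinearMap.mul ℂ (A ⊗[ℂ] A) z)
    (g := LinearMap.mul ℂ (A ⊗[ℂ] A) (swap z) ∘ₗ swap) (fun a b => ?_) w
  exact eq_of_tmul (f := swap ∘ₗ (LinearMap.mul ℂ (A ⊗[ℂ] A)).flip (a ⊗ₜ b))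
    (g := (LinearMap.mul ℂ (A ⊗[ℂ] A)).flip (b ⊗ₜ a) ∘ₗ swap) (fun c d => by simp) z

lemma of_swap (z : A ⊗[ℂ] A) : of (swap z) = flip (of z) :=
  ext_left_right
    (fun a => by rw [flip_left, flipConj_apply, of_left, of_left, swap_mul, swap_swap])
    (fun a => by rw [flip_right, flipConj_apply, of_right, of_right, swap_mul, swap_swap])

end Multiplier

end MultiplierLemmas

open Multiplier

/-! ### From identities on the triple tensor product to commuting legs -/

section Triple

variable {A : Type*} [AddCommGroup A] [Module ℂ A]

/-- `a ⊗ b ↦ a ⊗ X(b ⊗ d)`. -/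
def onSecond (X : A ⊗[ℂ] A →ₗ[ℂ] A ⊗[ℂ] A) (d : A) : A ⊗[ℂ] A →ₗ[ℂ] A ⊗[ℂ] (A ⊗[ℂ] A) :=
  onRight (X ∘ₗ (TensorProduct.mk ℂ A A).flip d)

lemma onRight_onFirstTwo (X Y : A ⊗[ℂ] A →ₗ[ℂ] A ⊗[ℂ] A) (a b d : A) :
    onRight Y (onFirstTwo X (a ⊗ₜ (b ⊗ₜ d))) = onSecond Y d (X (a ⊗ₜ b)) :=
  eq_of_tmul (f := onRight Y ∘ₗ (TensorProduct.assoc ℂ A A A).toLinearMap ∘ₗ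
    (TensorProduct.mk ℂ (A ⊗[ℂ] A) A).flip d) (g := onSecond Y d)
    (fun _ _ => rfl) (X (a ⊗ₜ b))

lemma legsCommute_of_onFirstTwo {X Y : A ⊗[ℂ] A →ₗ[ℂ] A ⊗[ℂ] A}
    (h : ∀ d z, onFirstTwo Y (onSecond X d z) = onSecond X d (Y z)) : LegsCommute Y X :=
  legsCommute_iff.2 fun c z =>
    eq_of_tmul (f := onFirstTwo Y ∘ₗ TensorProduct.mk ℂ A _ c ∘ₗ X)
      (g := onRight X ∘ₗ onFirstTwo Y ∘ₗ TensorProduct.mk ℂ A _ c)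
      (fun b d => (h d (c ⊗ₜ b)).trans (onRight_onFirstTwo Y X c b d).symm) z

/-- Here the coproduct variable is the second argument of `X`, so the slice of `Y` acts on the
second leg before `X` and on the first leg after it. -/
lemma onLeft_legRight_of_onFirstTwo {X Y : A ⊗[ℂ] A →ₗ[ℂ] A ⊗[ℂ] A}
    (h : ∀ d z, onFirstTwo Y (onSecond (X ∘ₗ swap) d z) = onSecond (X ∘ₗ swap) d (Y z))
    (c : A) (ω : A →ₗ[ℂ] ℂ) (z : A ⊗[ℂ] A) :
    X (onRight (legRight Y c ω) z) = onLeft (legRight Y c ω) (X z) := by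
  refine eq_of_tmul (f := X ∘ₗ onRight (legRight Y c ω)) (g := onLeft (legRight Y c ω) ∘ₗ X)
    (fun d b => ?_) z
  have := congrArg (sliceLeft ω) (h d (c ⊗ₜ b))
  rw [onSecond, onRight_tmul, sliceLeft_onFirstTwo, sliceLeft_onRight] at this
  exact this.symm

end Triple

namespace RegularWeakMultiplierHopfAlgebra

variable {A : Type*} [NonUnitalRing A] [Module ℂ A] [IsScalarTower ℂ A A] [SMulCommClass ℂ A A]
variable (H : RegularWeakMultiplierHopfAlgebra A)

lemma of_inj (H : RegularWeakMultiplierHopfAlgebra A) {z z' : A ⊗[ℂ] A}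
    (h : of z = of z') : z = z' :=
  of_injective (H.nondegenerate.tensor H.nondegenerate) h

lemma of_inj₃ (H : RegularWeakMultiplierHopfAlgebra A)
    {z z' : A ⊗[ℂ] (A ⊗[ℂ] A)} (h : of z = of z') : z = z' :=
  of_injective (H.nondegenerate.tensor (H.nondegenerate.tensor H.nondegenerate)) h

/-! ### The sliced axioms derived from one coproduct -/

section Half

lemma tmul_T₁_T₂ (a b c : A) : onLeft (LinearMap.mul ℂ A c) (H.T₁ (a ⊗ₜ b)) =
    onRight ((LinearMap.mul ℂ A).flip b) (H.T₂ (c ⊗ₜ a)) := H.of_inj <| by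
  rw [of_onLeft_mul, of_onRight_flip, H.of_T₁, H.of_T₂, mul_assoc]

lemma tmul_T₃_T₄ (a b c : A) : onLeft ((LinearMap.mul ℂ A).flip c) (H.T₃ (a ⊗ₜ b)) =
    onRight (LinearMap.mul ℂ A b) (H.T₄ (c ⊗ₜ a)) := H.of_inj <| by
  rw [of_onLeft_flip, of_onRight_mul, H.of_T₃, H.of_T₄, mul_assoc]

lemma tmul_T₁_T₃ (a b c : A) : onRight (LinearMap.mul ℂ A c) (H.T₁ (a ⊗ₜ b)) =
    onRight ((LinearMap.mul ℂ A).flip b) (H.T₃ (a ⊗ₜ c)) := H.of_inj <| by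
  rw [of_onRight_mul, of_onRight_flip, H.of_T₁, H.of_T₃, mul_assoc]

lemma tmul_T₂_T₄ (a c d : A) : onLeft (LinearMap.mul ℂ A c) (H.T₄ (d ⊗ₜ a)) =
    onLeft ((LinearMap.mul ℂ A).flip d) (H.T₂ (c ⊗ₜ a)) := H.of_inj <| by
  rw [of_onLeft_mul, of_onLeft_flip, H.of_T₂, H.of_T₄, mul_assoc]

lemma Δ_left_T₁ (a x b : A) : onLeft ((LinearMap.mul ℂ A).flip x) (H.T₁ (a ⊗ₜ b)) =
    (H.Δ a).left (x ⊗ₜ b) := H.of_inj <| by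
  rw [of_onLeft_flip, H.of_T₁, of_left_eq, of_tmul_eq', mul_assoc]

lemma Δ_left_T₄ (a x y : A) : onRight ((LinearMap.mul ℂ A).flip y) (H.T₄ (x ⊗ₜ a)) =
    (H.Δ a).left (x ⊗ₜ y) := H.of_inj <| by
  rw [of_onRight_flip, H.of_T₄, of_left_eq, of_tmul_eq, mul_assoc]

lemma Δ_right_T₃ (a x b : A) : onLeft (LinearMap.mul ℂ A x) (H.T₃ (a ⊗ₜ b)) =
    (H.Δ a).right (x ⊗ₜ b) := H.of_inj <| by
  rw [of_onLeft_mul, H.of_T₃, of_right_eq, of_tmul_eq, mul_assoc]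

lemma Δ_right_T₂ (a x y : A) : onRight (LinearMap.mul ℂ A y) (H.T₂ (x ⊗ₜ a)) =
    (H.Δ a).right (x ⊗ₜ y) := H.of_inj <| by
  rw [of_onRight_mul, H.of_T₂, of_right_eq, of_tmul_eq', mul_assoc]

lemma Δ_mul_T₁ (d a b : A) : (H.Δ d).left (H.T₁ (a ⊗ₜ b)) = H.T₁ ((d * a) ⊗ₜ b) :=
  H.of_inj <| by rw [of_left_eq, H.of_T₁, H.of_T₁, map_mul, mul_assoc]

lemma Δ_mul_T₄ (d a x : A) : (H.Δ d).left (H.T₄ (x ⊗ₜ a)) = H.T₄ (x ⊗ₜ (d * a)) :=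
  H.of_inj <| by rw [of_left_eq, H.of_T₄, H.of_T₄, map_mul, mul_assoc]

lemma Δ_mul_T₃ (d a b : A) : (H.Δ d).right (H.T₃ (a ⊗ₜ b)) = H.T₃ ((a * d) ⊗ₜ b) :=
  H.of_inj <| by rw [of_right_eq, H.of_T₃, H.of_T₃, map_mul, mul_assoc]

lemma Δ_mul_T₂ (d a x : A) : (H.Δ d).right (H.T₂ (x ⊗ₜ a)) = H.T₂ (x ⊗ₜ (a * d)) :=
  H.of_inj <| by rw [of_right_eq, H.of_T₂, H.of_T₂, map_mul, mul_assoc]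

lemma E_left_right (u v x y : A) :
    onLeft (LinearMap.mul ℂ A u) (onRight (LinearMap.mul ℂ A v) (H.E.left (x ⊗ₜ y))) =
    onLeft ((LinearMap.mul ℂ A).flip x) (onRight ((LinearMap.mul ℂ A).flip y)
      (H.E.right (u ⊗ₜ v))) := H.of_inj <| by
  rw [of_onLeft_mul, of_onRight_mul, of_onLeft_flip, of_onRight_flip, of_left_eq, of_right_eq,
    ← mul_assoc, ← mul_assoc, ← of_tmul_eq, of_tmul_eq' x y, ← mul_assoc]

lemma E_left_E_left (z : A ⊗[ℂ] A) : H.E.left (H.E.left z) = H.E.left z := by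
  rw [← mul_left_apply, H.E_mul_E]

lemma E_right_E_right (z : A ⊗[ℂ] A) : H.E.right (H.E.right z) = H.E.right z := by
  rw [← mul_right_apply, H.E_mul_E]

lemma E_left_T₁ (z : A ⊗[ℂ] A) : H.E.left (H.T₁ z) = H.T₁ z := by
  obtain ⟨w, hw⟩ : H.T₁ z ∈ LinearMap.range H.E.left := H.range_T₁ ▸ ⟨z, rfl⟩
  rw [← hw, E_left_E_left]

lemma E_right_T₂ (z : A ⊗[ℂ] A) : H.E.right (H.T₂ z) = H.T₂ z := by
  obtain ⟨w, hw⟩ : H.T₂ z ∈ LinearMap.range H.E.right := H.range_T₂ ▸ ⟨z, rfl⟩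
  rw [← hw, E_right_E_right]

lemma exists_T₁_eq (z : A ⊗[ℂ] A) : ∃ w, H.E.left z = H.T₁ w := by
  obtain ⟨w, hw⟩ : H.E.left z ∈ LinearMap.range H.T₁ := H.range_T₁ ▸ ⟨z, rfl⟩
  exact ⟨w, hw.symm⟩

lemma exists_T₂_eq (z : A ⊗[ℂ] A) : ∃ w, H.E.right z = H.T₂ w := by
  obtain ⟨w, hw⟩ : H.E.right z ∈ LinearMap.range H.T₂ := H.range_T₂ ▸ ⟨z, rfl⟩
  exact ⟨w, hw.symm⟩

lemma E_mul_Δ (a : A) : H.E * H.Δ a = H.Δ a := by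
  refine ext_left (H.nondegenerate.tensor H.nondegenerate) fun z => ?_
  refine eq_of_tmul (f := (H.E * H.Δ a).left) (g := (H.Δ a).left) (fun x b => H.of_inj ?_) z
  rw [mul_left_apply, ← Δ_left_T₁, of_left_eq, of_onLeft_flip, ← mul_assoc, ← of_left_eq,
    E_left_T₁]

lemma E_left_T₄ (z : A ⊗[ℂ] A) : H.E.left (H.T₄ z) = H.T₄ z :=
  eq_of_tmul (f := H.E.left ∘ₗ H.T₄) (g := H.T₄) (fun x a => H.of_inj <| by
    rw [LinearMap.comp_apply, of_left_eq, H.of_T₄, ← mul_assoc, E_mul_Δ]) z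

lemma Δ_mul_E (a : A) : H.Δ a * H.E = H.Δ a := by
  refine ext_left (H.nondegenerate.tensor H.nondegenerate) fun z => ?_
  refine eq_of_nondeg_right (H.nondegenerate.tensor H.nondegenerate) fun w => ?_
  rw [← right_mul_eq, ← right_mul_eq]
  congr 1
  refine eq_of_tmul (f := (H.Δ a * H.E).right) (g := (H.Δ a).right) (fun x b => H.of_inj ?_) w
  rw [mul_right_apply, ← Δ_right_T₂, of_right_eq, of_onRight_mul, mul_assoc, ← of_right_eq,
    E_right_T₂]

lemma E_right_T₃ (z : A ⊗[ℂ] A) : H.E.right (H.T₃ z) = H.T₃ z :=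
  eq_of_tmul (f := H.E.right ∘ₗ H.T₃) (g := H.T₃) (fun x a => H.of_inj <| by
    rw [LinearMap.comp_apply, of_right_eq, H.of_T₃, mul_assoc, Δ_mul_E]) z

lemma T₁_G₁ (z : A ⊗[ℂ] A) : H.T₁ (H.G₁ z) = H.T₁ z := by
  have : (LinearMap.id - H.G₁ : A ⊗[ℂ] A →ₗ[ℂ] A ⊗[ℂ] A) z ∈ LinearMap.ker H.T₁ :=
    H.ker_T₁ ▸ ⟨z, rfl⟩
  rw [LinearMap.mem_ker, LinearMap.sub_apply, map_sub, sub_eq_zero] at this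
  exact this.symm

lemma T₂_G₂ (z : A ⊗[ℂ] A) : H.T₂ (H.G₂ z) = H.T₂ z := by
  have : (LinearMap.id - H.G₂ : A ⊗[ℂ] A →ₗ[ℂ] A ⊗[ℂ] A) z ∈ LinearMap.ker H.T₂ :=
    H.ker_T₂ ▸ ⟨z, rfl⟩
  rw [LinearMap.mem_ker, LinearMap.sub_apply, map_sub, sub_eq_zero] at this
  exact this.symm

lemma exists_of_T₁_eq_zero (z : A ⊗[ℂ] A) (h : H.T₁ z = 0) : ∃ w, z = w - H.G₁ w := by
  obtain ⟨w, hw⟩ : z ∈ LinearMap.range (LinearMap.id - H.G₁) := H.ker_T₁ ▸ h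
  exact ⟨w, hw.symm⟩

lemma exists_of_T₂_eq_zero (z : A ⊗[ℂ] A) (h : H.T₂ z = 0) : ∃ w, z = w - H.G₂ w := by
  obtain ⟨w, hw⟩ : z ∈ LinearMap.range (LinearMap.id - H.G₂) := H.ker_T₂ ▸ h
  exact ⟨w, hw.symm⟩

lemma full_E_left (V : Submodule ℂ A) (h : ∀ ω z, sliceRight ω (H.E.left z) ∈ V) : V = ⊤ :=
  H.full_left V <| by
    rintro _ ⟨z, rfl⟩
    exact mem_range_onLeft fun ω => by rw [← E_left_T₁]; exact h ω _

lemma full_E_right (V : Submodule ℂ A) (h : ∀ ω z, sliceLeft ω (H.E.right z) ∈ V) : V = ⊤ :=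
  H.full_right V <| by
    rintro _ ⟨z, rfl⟩
    exact mem_range_onRight fun ω => by rw [← E_right_T₂]; exact h ω _

lemma legsCommute_T₂_T₁ : LegsCommute H.T₂ H.T₁ := legsCommute_iff.2 fun c z =>
  eq_of_tmul (f := onFirstTwo H.T₂ ∘ₗ TensorProduct.mk ℂ A _ c ∘ₗ H.T₁)
    (g := onRight H.T₁ ∘ₗ onFirstTwo H.T₂ ∘ₗ TensorProduct.mk ℂ A _ c)
    (fun a b => H.coassoc a b c) z

lemma legsCommute_E_left : LegsCommute H.E.left H.E.left := legsCommute_iff.2 fun c z =>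
  LinearMap.congr_fun (congrArg Multiplier.left H.E_comm) (c ⊗ₜ z)

lemma legsCommute_E_right : LegsCommute H.E.right H.E.right := legsCommute_iff.2 fun c z =>
  (LinearMap.congr_fun (congrArg Multiplier.right H.E_comm) (c ⊗ₜ z)).symm

/-- `a ⊗ b ↦ a ⊗ Δ(b)`. -/
def idΔ : A ⊗[ℂ] A →ₗ[ℂ] Multiplier (A ⊗[ℂ] (A ⊗[ℂ] A)) :=
  TensorProduct.lift ((tmul (A := A) (B := A ⊗[ℂ] A)).compl₁₂ of (H.Δ : A →ₗ[ℂ] _))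

lemma idΔ_tmul (a b : A) : H.idΔ (a ⊗ₜ b) = tmul (of a) (H.Δ b) := rfl

/-- The extension axiom gives `(E ⊗ 1)(1 ⊗ E)`, and `EΔ(b) = Δ(b)` absorbs the second factor. -/
lemma E_mul_idΔ (z : A ⊗[ℂ] A) :
    assoc (tmul H.E 1) * H.idΔ z = H.idΔ (H.E.left z) := by
  have h := H.id_Δ_E.mul_left z
  have e : tmul 1 H.E * H.idΔ z = H.idΔ z := by
    induction z with
    | zero => rw [map_zero, mul_zero]
    | add z z' hz hz' => rw [map_add, mul_add, hz (H.id_Δ_E.mul_left z), hz' (H.id_Δ_E.mul_left z')]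
    | tmul a b => rw [idΔ_tmul, tmul_mul_tmul, one_mul, E_mul_Δ]
  change assoc (tmul H.E 1) * tmul 1 H.E * H.idΔ z = _ at h
  rwa [mul_assoc, e] at h

lemma idΔ_mul_E (z : A ⊗[ℂ] A) :
    H.idΔ z * assoc (tmul H.E 1) = H.idΔ (H.E.right z) := by
  have h := H.id_Δ_E.mul_right z
  have e : H.idΔ z * tmul 1 H.E = H.idΔ z := by
    induction z with
    | zero => rw [map_zero, zero_mul]
    | add z z' hz hz' =>
      rw [map_add, add_mul, hz (H.id_Δ_E.mul_right z), hz' (H.id_Δ_E.mul_right z')]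
    | tmul a b => rw [idΔ_tmul, tmul_mul_tmul, mul_one, Δ_mul_E]
  change H.idΔ z * (assoc (tmul H.E 1) * tmul 1 H.E) = _ at h
  rwa [H.E_comm, ← mul_assoc, e] at h

lemma idΔ_mul_left (d : A) (z : A ⊗[ℂ] A) :
    H.idΔ z * tmul 1 (tmul 1 (of d)) = of (onSecond H.T₁ d z) := by
  induction z with
  | zero => simp only [map_zero, zero_mul]
  | add z z' hz hz' => simp only [map_add, add_mul, hz, hz']
  | tmul a b =>
    change tmul (of a) (H.Δ b) * _ = of (a ⊗ₜ H.T₁ (b ⊗ₜ d))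
    rw [of_tmul, H.of_T₁, tmul_mul_tmul, mul_one]

lemma idΔ_mul_left' (d : A) (z : A ⊗[ℂ] A) :
    H.idΔ z * tmul 1 (tmul (of d) 1) = of (onSecond (H.T₄ ∘ₗ swap) d z) := by
  induction z with
  | zero => simp only [map_zero, zero_mul]
  | add z z' hz hz' => simp only [map_add, add_mul, hz, hz']
  | tmul a b =>
    change tmul (of a) (H.Δ b) * _ = of (a ⊗ₜ H.T₄ (d ⊗ₜ b))
    rw [of_tmul, H.of_T₄, tmul_mul_tmul, mul_one]

lemma mul_idΔ_left (d : A) (z : A ⊗[ℂ] A) :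
    tmul 1 (tmul 1 (of d)) * H.idΔ z = of (onSecond H.T₃ d z) := by
  induction z with
  | zero => simp only [map_zero, mul_zero]
  | add z z' hz hz' => simp only [map_add, mul_add, hz, hz']
  | tmul a b =>
    change _ * tmul (of a) (H.Δ b) = of (a ⊗ₜ H.T₃ (b ⊗ₜ d))
    rw [of_tmul, H.of_T₃, tmul_mul_tmul, one_mul]

lemma mul_idΔ_left' (d : A) (z : A ⊗[ℂ] A) :
    tmul 1 (tmul (of d) 1) * H.idΔ z = of (onSecond (H.T₂ ∘ₗ swap) d z) := by
  induction z with
  | zero => simp only [map_zero, mul_zero]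
  | add z z' hz hz' => simp only [map_add, mul_add, hz, hz']
  | tmul a b =>
    change _ * tmul (of a) (H.Δ b) = of (a ⊗ₜ H.T₂ (d ⊗ₜ b))
    rw [of_tmul, H.of_T₂, tmul_mul_tmul, one_mul]

lemma onFirstTwo_E_left (X : A ⊗[ℂ] A →ₗ[ℂ] A ⊗[ℂ] A) (d : A)
    (m : Multiplier (A ⊗[ℂ] (A ⊗[ℂ] A))) (h : ∀ z, H.idΔ z * m = of (onSecond X d z))
    (z : A ⊗[ℂ] A) :
    onFirstTwo H.E.left (onSecond X d z) = onSecond X d (H.E.left z) := by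
  refine H.of_inj₃ ?_
  change of ((assoc (tmul H.E 1)).left _) = _
  rw [of_left_eq, ← h, ← h, ← mul_assoc, E_mul_idΔ]

lemma onFirstTwo_E_right (X : A ⊗[ℂ] A →ₗ[ℂ] A ⊗[ℂ] A) (d : A)
    (m : Multiplier (A ⊗[ℂ] (A ⊗[ℂ] A))) (h : ∀ z, m * H.idΔ z = of (onSecond X d z))
    (z : A ⊗[ℂ] A) :
    onFirstTwo H.E.right (onSecond X d z) = onSecond X d (H.E.right z) := by
  refine H.of_inj₃ ?_
  change of ((assoc (tmul H.E 1)).right _) = _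
  rw [of_right_eq, ← h, ← h, mul_assoc, idΔ_mul_E]

lemma legsCommute_E_left_T₁ : LegsCommute H.E.left H.T₁ :=
  legsCommute_of_onFirstTwo fun d => H.onFirstTwo_E_left H.T₁ d _ (H.idΔ_mul_left d)

lemma legsCommute_E_right_T₃ : LegsCommute H.E.right H.T₃ :=
  legsCommute_of_onFirstTwo fun d => H.onFirstTwo_E_right H.T₃ d _ (H.mul_idΔ_left d)

lemma T₄_onRight_E_left (d : A) (ω : A →ₗ[ℂ] ℂ) (z : A ⊗[ℂ] A) :
    H.T₄ (onRight (legRight H.E.left d ω) z) = onLeft (legRight H.E.left d ω) (H.T₄ z) :=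
  onLeft_legRight_of_onFirstTwo
    (fun d => H.onFirstTwo_E_left (H.T₄ ∘ₗ swap) d _ (H.idΔ_mul_left' d)) d ω z

lemma T₂_onRight_E_right (d : A) (ω : A →ₗ[ℂ] ℂ) (z : A ⊗[ℂ] A) :
    H.T₂ (onRight (legRight H.E.right d ω) z) = onLeft (legRight H.E.right d ω) (H.T₂ z) :=
  onLeft_legRight_of_onFirstTwo
    (fun d => H.onFirstTwo_E_right (H.T₂ ∘ₗ swap) d _ (H.mul_idΔ_left' d)) d ω z

/-- Apply `ω` to the middle leg of the defining identity of `G₁`. -/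
lemma onLeft_legLeft_G₁ (b : A) (ω : A →ₗ[ℂ] ℂ) (z : A ⊗[ℂ] A) :
    onLeft (legLeft H.G₁ b ω) (H.T₁ z) = H.T₁ (onRight (legRight H.E.left b ω) z) := by
  refine eq_of_tmul (f := onLeft (legLeft H.G₁ b ω) ∘ₗ H.T₁)
    (g := H.T₁ ∘ₗ onRight (legRight H.E.left b ω)) (fun a d => ?_) z
  have h := congrArg (onRight (W := A) (sliceLeft (W := A) ω)) (H.G₁_spec a (b ⊗ₜ d))
  have h1 : ∀ z : A ⊗[ℂ] A, onRight (W := A) (sliceLeft (W := A) ω) (onFirstTwo H.G₁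
      (TensorProduct.leftComm ℂ A A A (b ⊗ₜ z))) = onLeft (legLeft H.G₁ b ω) z := by
    refine eq_of_tmul (f := onRight (W := A) (sliceLeft (W := A) ω) ∘ₗ onFirstTwo H.G₁ ∘ₗ
      (TensorProduct.leftComm ℂ A A A).toLinearMap ∘ₗ TensorProduct.mk ℂ A _ b)
      (g := onLeft (legLeft H.G₁ b ω)) fun p q => ?_
    exact eq_of_tmul (f := onRight (W := A) (sliceLeft (W := A) ω) ∘ₗ
      (TensorProduct.assoc ℂ A A A).toLinearMap ∘ₗ (TensorProduct.mk ℂ (A ⊗[ℂ] A) A).flip q)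
      (g := (TensorProduct.mk ℂ A A).flip q ∘ₗ sliceRight ω)
      (fun x y => by simp [TensorProduct.smul_tmul', TensorProduct.tmul_smul]) (H.G₁ (p ⊗ₜ b))
  have h2 : ∀ v : A ⊗[ℂ] A, onRight (W := A) (sliceLeft (W := A) ω)
      (TensorProduct.leftComm ℂ A A A (TensorProduct.map LinearMap.id H.T₁
        (TensorProduct.leftComm ℂ A A A (a ⊗ₜ v)))) = H.T₁ (a ⊗ₜ sliceLeft ω v) := by
    refine eq_of_tmul (f := onRight (W := A) (sliceLeft (W := A) ω) ∘ₗ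
      (TensorProduct.leftComm ℂ A A A).toLinearMap ∘ₗ TensorProduct.map LinearMap.id H.T₁ ∘ₗ
        (TensorProduct.leftComm ℂ A A A).toLinearMap ∘ₗ TensorProduct.mk ℂ A _ a)
      (g := H.T₁ ∘ₗ TensorProduct.mk ℂ A A a ∘ₗ sliceLeft ω) fun x y => ?_
    have h3 : ∀ w : A ⊗[ℂ] A, onRight (W := A) (sliceLeft (W := A) ω)
        (TensorProduct.leftComm ℂ A A A (x ⊗ₜ w)) = ω x • w :=
      eq_of_tmul (f := onRight (W := A) (sliceLeft (W := A) ω) ∘ₗ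
        (TensorProduct.leftComm ℂ A A A).toLinearMap ∘ₗ TensorProduct.mk ℂ A _ x)
        (g := ω x • (LinearMap.id : A ⊗[ℂ] A →ₗ[ℂ] A ⊗[ℂ] A)) (fun p q => by simp)
    simpa using h3 (H.T₁ (a ⊗ₜ y))
  rw [h2] at h
  exact (h1 _).symm.trans h

lemma onRight_legRight_G₂ (b : A) (ω : A →ₗ[ℂ] ℂ) (z : A ⊗[ℂ] A) :
    onRight (legRight H.G₂ b ω) (H.T₂ z) = H.T₂ (onLeft (legLeft H.E.right b ω) z) := by
  refine eq_of_tmul (f := onRight (legRight H.G₂ b ω) ∘ₗ H.T₂)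
    (g := H.T₂ ∘ₗ onLeft (legLeft H.E.right b ω)) (fun a c => ?_) z
  have h := congrArg (onRight (W := A) (sliceLeft (W := A) ω)) (H.G₂_spec (a ⊗ₜ b) c)
  have h1 : ∀ z : A ⊗[ℂ] A, onRight (W := A) (sliceLeft (W := A) ω) (TensorProduct.map LinearMap.id
      H.G₂ (TensorProduct.assoc ℂ A A A (TensorProduct.rightComm ℂ A A A (z ⊗ₜ b)))) =
      onRight (legRight H.G₂ b ω) z :=
    eq_of_tmul (f := onRight (W := A) (sliceLeft (W := A) ω) ∘ₗ TensorProduct.map LinearMap.id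
      H.G₂ ∘ₗ (TensorProduct.assoc ℂ A A A).toLinearMap ∘ₗ
      (TensorProduct.rightComm ℂ A A A).toLinearMap ∘ₗ (TensorProduct.mk ℂ (A ⊗[ℂ] A) A).flip b)
      (g := onRight (legRight H.G₂ b ω)) fun p q => rfl
  have h2 : ∀ v : A ⊗[ℂ] A, onRight (W := A) (sliceLeft (W := A) ω)
      (TensorProduct.assoc ℂ A A A (TensorProduct.rightComm ℂ A A A
        (TensorProduct.map H.T₂ LinearMap.id (TensorProduct.rightComm ℂ A A A (v ⊗ₜ c))))) =
        H.T₂ (sliceRight ω v ⊗ₜ c) := by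
    refine eq_of_tmul (f := onRight (W := A) (sliceLeft (W := A) ω) ∘ₗ
      (TensorProduct.assoc ℂ A A A).toLinearMap ∘ₗ (TensorProduct.rightComm ℂ A A A).toLinearMap ∘ₗ
      TensorProduct.map H.T₂ LinearMap.id ∘ₗ (TensorProduct.rightComm ℂ A A A).toLinearMap ∘ₗ
      (TensorProduct.mk ℂ (A ⊗[ℂ] A) A).flip c)
      (g := H.T₂ ∘ₗ (TensorProduct.mk ℂ A A).flip c ∘ₗ sliceRight ω) fun x y => ?_
    have h3 : ∀ w : A ⊗[ℂ] A, onRight (W := A) (sliceLeft (W := A) ω)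
        (TensorProduct.assoc ℂ A A A (TensorProduct.rightComm ℂ A A A (w ⊗ₜ y))) = ω y • w :=
      eq_of_tmul (f := onRight (W := A) (sliceLeft (W := A) ω) ∘ₗ
        (TensorProduct.assoc ℂ A A A).toLinearMap ∘ₗ
        (TensorProduct.rightComm ℂ A A A).toLinearMap ∘ₗ (TensorProduct.mk ℂ (A ⊗[ℂ] A) A).flip y)
        (g := ω y • (LinearMap.id : A ⊗[ℂ] A →ₗ[ℂ] A ⊗[ℂ] A)) (fun p q => by simp)
    simpa [← TensorProduct.smul_tmul'] using h3 (H.T₂ (x ⊗ₜ c))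
  rw [h2] at h
  exact (h1 _).symm.trans h

end Half

end RegularWeakMultiplierHopfAlgebra

open Multiplier

namespace RegularWeakMultiplierHopfAlgebra

variable {A : Type*} [NonUnitalRing A] [Module ℂ A] [IsScalarTower ℂ A A] [SMulCommClass ℂ A A]
variable (H : RegularWeakMultiplierHopfAlgebra A)

/-! ### The structure for the opposite coproduct has the same idempotent and counit -/

section Flipped

/-- The regular weak multiplier Hopf algebra with the opposite coproduct. -/
def flipped : RegularWeakMultiplierHopfAlgebra A where
  toWeakMultiplierHopfAlgebra := H.cop
  T₃ := flipConj H.T₂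
  T₄ := flipConj H.T₁
  of_T₃ a b := by
    rw [flipConj_apply, swap_tmul, of_swap, H.of_T₂, flip_mul, flip_tmul, H.cop_Δ]
  of_T₄ a b := by
    rw [flipConj_apply, swap_tmul, of_swap, H.of_T₁, flip_mul, flip_tmul, H.cop_Δ]
  cop := H.toWeakMultiplierHopfAlgebra
  cop_Δ a := by rw [H.cop_Δ, Multiplier.flip_flip]

lemma flipped_T₁ : H.flipped.T₁ = flipConj H.T₄ := TensorProduct.ext' fun a b => H.of_inj <| by
  rw [H.flipped.of_T₁, flipConj_apply, swap_tmul, of_swap, H.of_T₄, flip_mul, flip_tmul]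
  exact congrArg (· * _) (H.cop_Δ a)

lemma flipped_T₂ : H.flipped.T₂ = flipConj H.T₃ := TensorProduct.ext' fun a b => H.of_inj <| by
  rw [H.flipped.of_T₂, flipConj_apply, swap_tmul, of_swap, H.of_T₃, flip_mul, flip_tmul]
  exact congrArg (_ * ·) (H.cop_Δ b)

lemma flipped_T₃ : H.flipped.T₃ = flipConj H.T₂ := rfl

lemma flipped_T₄ : H.flipped.T₄ = flipConj H.T₁ := rfl

lemma flip_E_left_T₁ (z : A ⊗[ℂ] A) : (flip H.flipped.E).left (H.T₁ z) = H.T₁ z := by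
  have h := H.flipped.E_left_T₄ (swap z)
  rw [flipped_T₄, flipConj_apply, swap_swap] at h
  rw [flip_left, flipConj_apply, h, swap_swap]

lemma exists_flip_E_left (z : A ⊗[ℂ] A) : ∃ w, (flip H.flipped.E).left z = H.T₄ w := by
  obtain ⟨w, hw⟩ := H.flipped.exists_T₁_eq (swap z)
  refine ⟨swap w, ?_⟩
  rw [flip_left, flipConj_apply, hw, flipped_T₁, flipConj_apply, swap_swap]

lemma exists_flip_E_right (z : A ⊗[ℂ] A) : ∃ w, (flip H.flipped.E).right z = H.T₃ w := by
  obtain ⟨w, hw⟩ := H.flipped.exists_T₂_eq (swap z)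
  refine ⟨swap w, ?_⟩
  rw [flip_right, flipConj_apply, hw, flipped_T₂, flipConj_apply, swap_swap]

/-- The canonical idempotent of the opposite coproduct. -/
lemma flip_flipped_E : flip H.flipped.E = H.E := by
  have hnd := H.nondegenerate.tensor H.nondegenerate
  refine ext_left hnd fun z => ?_
  -- With `E'` the flipped idempotent, `E'E = E` because `E` maps into the range of `T₁`. Below,
  -- `E'E = E'` because right multiplication by `E'` maps into the range of `T₃`.
  have h1 : (flip H.flipped.E).left (H.E.left z) = H.E.left z := by
    obtain ⟨w, hw⟩ := H.exists_T₁_eq z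
    rw [hw, flip_E_left_T₁]
  rw [← h1]
  refine eq_of_nondeg_right hnd fun u => ?_
  rw [← right_mul_eq, ← right_mul_eq, ← right_mul_eq]
  congr 1
  obtain ⟨w, hw⟩ := H.exists_flip_E_right u
  rw [hw, E_right_T₃]

lemma flipped_E_left : H.flipped.E.left = flipConj H.E.left := by
  rw [← H.flip_flipped_E, flip_left, flipConj_flipConj]

lemma flipped_E_right : H.flipped.E.right = flipConj H.E.right := by
  rw [← H.flip_flipped_E, flip_right, flipConj_flipConj]

lemma sliceLeft_flipped_ε (a b : A) : sliceLeft H.flipped.ε (H.T₃ (a ⊗ₜ b)) = b * a := by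
  have h : sliceRight H.flipped.ε (H.flipped.T₂ (b ⊗ₜ a)) = b * a := H.flipped.counit_right b a
  rwa [flipped_T₂, flipConj_apply, swap_tmul, sliceRight_swap] at h

/-- Both counits give `ab` on `Δ(a)(1 ⊗ b)`; for the flipped one this is seen through `T₃`. Fullness
concludes. -/
lemma flipped_ε : H.flipped.ε = H.ε := by
  have h : ∀ z, sliceLeft H.flipped.ε (H.T₁ z) = sliceLeft H.ε (H.T₁ z) := by
    refine eq_of_tmul (f := sliceLeft H.flipped.ε ∘ₗ H.T₁) (g := sliceLeft H.ε ∘ₗ H.T₁)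
      fun a b => eq_of_nondeg_right H.nondegenerate fun c => ?_
    have h1 : sliceLeft H.ε (H.T₁ (a ⊗ₜ b)) = a * b := H.counit_left a b
    have h2 := congrArg (sliceLeft H.flipped.ε) (H.tmul_T₁_T₃ a b c)
    rw [sliceLeft_onRight, sliceLeft_onRight, sliceLeft_flipped_ε] at h2
    rw [LinearMap.comp_apply, LinearMap.comp_apply, h1, ← mul_assoc]
    exact h2
  have hV := H.full_left (LinearMap.eqLocus H.flipped.ε H.ε) <| by
    rintro _ ⟨z, rfl⟩
    refine mem_range_onLeft fun ω => ?_
    rw [LinearMap.mem_eqLocus, ← apply_sliceLeft, ← apply_sliceLeft, h]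
  exact LinearMap.ext fun a =>
    (hV ▸ Submodule.mem_top : a ∈ LinearMap.eqLocus H.flipped.ε H.ε)

end Flipped

/-- The operators on `A ⊗ A` given by a regular weak multiplier Hopf algebra. -/
@[simps mul ε DL DR T₁ T₂ T₃ T₄ G₁ G₂ L P] def toHopfData : HopfData A where
  mul := LinearMap.mul ℂ A
  ε := H.ε
  DL a := (H.Δ a).left
  DR a := (H.Δ a).right
  T₁ := H.T₁
  T₂ := H.T₂
  T₃ := H.T₃
  T₄ := H.T₄
  G₁ := H.G₁
  G₂ := H.G₂
  G₃ := flipConj H.flipped.G₂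
  G₄ := flipConj H.flipped.G₁
  L := H.E.left
  P := H.E.right
  mul_assoc := mul_assoc
  nondeg_left := H.nondegenerate.1
  nondeg_right := H.nondegenerate.2
  idem V h := by
    rw [eq_top_iff, ← show LinearMap.range (LinearMap.mul' ℂ A) = ⊤ from H.idempotent]
    rintro _ ⟨z, rfl⟩
    induction z with
    | zero => rw [map_zero]; exact V.zero_mem
    | add z z' hz hz' => rw [map_add]; exact V.add_mem hz hz'
    | tmul a b => exact h a b
  T₁_T₂ := H.tmul_T₁_T₂
  T₃_T₄ := H.tmul_T₃_T₄
  T₁_T₃ := H.tmul_T₁_T₃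
  T₂_T₄ := H.tmul_T₂_T₄
  DL_eq_T₁ := H.Δ_left_T₁
  DL_eq_T₄ := H.Δ_left_T₄
  DR_eq_T₃ := H.Δ_right_T₃
  DR_eq_T₂ := H.Δ_right_T₂
  DL_T₁ := H.Δ_mul_T₁
  DL_T₄ := H.Δ_mul_T₄
  DR_T₃ := H.Δ_mul_T₃
  DR_T₂ := H.Δ_mul_T₂
  L_P := H.E_left_right
  L_T₁ := H.E_left_T₁
  L_T₄ := H.E_left_T₄
  P_T₂ := H.E_right_T₂
  P_T₃ := H.E_right_T₃
  exists_T₁ := H.exists_T₁_eq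
  exists_T₄ z := by rw [← flip_flipped_E]; exact H.exists_flip_E_left z
  exists_T₂ := H.exists_T₂_eq
  exists_T₃ z := by rw [← flip_flipped_E]; exact H.exists_flip_E_right z
  T₁_G₁ := H.T₁_G₁
  T₂_G₂ := H.T₂_G₂
  T₃_G₃ z := by
    simpa [flipped_T₂, flipConj_apply] using congrArg swap (H.flipped.T₂_G₂ (swap z))
  T₄_G₄ z := by
    simpa [flipped_T₁, flipConj_apply] using congrArg swap (H.flipped.T₁_G₁ (swap z))
  ker_T₁ := H.exists_of_T₁_eq_zero
  ker_T₂ := H.exists_of_T₂_eq_zero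
  ker_T₃ z hz := by
    obtain ⟨w, hw⟩ := H.flipped.exists_of_T₂_eq_zero (swap z)
      (by rw [flipped_T₂, flipConj_apply, swap_swap, hz, map_zero])
    exact ⟨swap w, by simpa [flipConj_apply] using congrArg swap hw⟩
  ker_T₄ z hz := by
    obtain ⟨w, hw⟩ := H.flipped.exists_of_T₁_eq_zero (swap z)
      (by rw [flipped_T₁, flipConj_apply, swap_swap, hz, map_zero])
    exact ⟨swap w, by simpa [flipConj_apply] using congrArg swap hw⟩
  counit_T₁ := H.counit_left
  counit_T₂ := H.counit_right
  counit_T₃ a b := by rw [← flipped_ε]; exact H.sliceLeft_flipped_ε a b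
  counit_T₄ a b := by
    have h : sliceLeft H.flipped.ε (H.flipped.T₁ (b ⊗ₜ a)) = b * a := H.flipped.counit_left b a
    rwa [flipped_T₁, flipConj_apply, swap_tmul, sliceLeft_swap, flipped_ε] at h
  full_L_left := H.full_E_left
  full_P_right := H.full_E_right
  full_L_right V h := H.flipped.full_E_left V fun ω z => by
    rw [flipped_E_left, flipConj_apply, sliceRight_swap]; exact h ω _
  full_P_left V h := H.flipped.full_E_right V fun ω z => by
    rw [flipped_E_right, flipConj_apply, sliceLeft_swap]; exact h ω _
  comm_T₂_T₁ := H.legsCommute_T₂_T₁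
  comm_T₄_T₃ := by
    simpa [flipped_T₁, flipped_T₂] using H.flipped.legsCommute_T₂_T₁.flipConj
  comm_L_T₁ := H.legsCommute_E_left_T₁
  comm_P_T₃ := H.legsCommute_E_right_T₃
  comm_T₄_L := by
    simpa [flipped_T₁, flipped_E_left] using H.flipped.legsCommute_E_left_T₁.flipConj
  comm_T₂_P := by
    simpa [flipped_T₃, flipped_E_right] using H.flipped.legsCommute_E_right_T₃.flipConj
  comm_L_L := H.legsCommute_E_left
  comm_P_P := H.legsCommute_E_right
  T₁_L d ω z := by
    simpa [flipped_T₄, flipped_E_left, flipConj_apply, onLeft_swap, onRight_swap] using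
      congrArg swap (H.flipped.T₄_onRight_E_left d ω (swap z))
  T₃_P d ω z := by
    simpa [flipped_T₂, flipped_E_right, flipConj_apply, onLeft_swap, onRight_swap] using
      congrArg swap (H.flipped.T₂_onRight_E_right d ω (swap z))
  T₄_L := H.T₄_onRight_E_left
  T₂_P := H.T₂_onRight_E_right
  G₁_spec := H.onLeft_legLeft_G₁
  G₂_spec := H.onRight_legRight_G₂
  G₃_spec b ω z := by
    simpa [flipped_T₂, flipped_E_right, flipConj_apply, onLeft_swap, onRight_swap] using
      congrArg swap (H.flipped.onRight_legRight_G₂ b ω (swap z))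
  G₄_spec b ω z := by
    simpa [flipped_T₁, flipped_E_left, flipConj_apply, onLeft_swap, onRight_swap] using
      congrArg swap (H.flipped.onLeft_legLeft_G₁ b ω (swap z))

end RegularWeakMultiplierHopfAlgebra

open Multiplier

lemma range_eq_span {A : Type*} [AddCommGroup A] [Module ℂ A]
    (f : A ⊗[ℂ] A →ₗ[ℂ] A) :
    LinearMap.range f = Submodule.span ℂ {z | ∃ p q, z = f (p ⊗ₜ q)} := by
  apply le_antisymm
  · rintro _ ⟨z, rfl⟩
    induction z with
    | zero => rw [map_zero]; exact Submodule.zero_mem _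
    | add z z' hz hz' => rw [map_add]; exact Submodule.add_mem _ hz hz'
    | tmul p q => exact Submodule.subset_span ⟨p, q, rfl⟩
  · rw [Submodule.span_le]
    rintro _ ⟨p, q, rfl⟩
    exact ⟨_, rfl⟩

/-! ### Extending multipliers along a subalgebra with local units -/

section Extension

/-- `B` contains a left and a right local unit for every element of `A`. -/
def HasLocalUnits {A : Type*} [NonUnitalRing A] [Module ℂ A] (B : NonUnitalSubalgebra ℂ A) : Prop :=
  (∀ a : A, ∃ z ∈ B, z * a = a) ∧ ∀ a : A, ∃ z ∈ B, a * z = a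

namespace HasLocalUnits

variable {A : Type*} [NonUnitalRing A] [Module ℂ A] {B : NonUnitalSubalgebra ℂ A}

lemma eq_of_mul_left (h : HasLocalUnits B) {x y : A}
    (hxy : ∀ z : B, (z : A) * x = z * y) : x = y := by
  obtain ⟨z, hz, hz'⟩ := h.1 (x - y)
  rw [mul_sub, hxy ⟨z, hz⟩, sub_self] at hz'
  exact sub_eq_zero.1 hz'.symm

lemma eq_of_mul_right (h : HasLocalUnits B) {x y : A}
    (hxy : ∀ z : B, x * (z : A) = y * z) : x = y := by
  obtain ⟨z, hz, hz'⟩ := h.2 (x - y)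
  rw [sub_mul, hxy ⟨z, hz⟩, sub_self] at hz'
  exact sub_eq_zero.1 hz'.symm

lemma isNondegenerate (h : HasLocalUnits B) : IsNondegenerate A := by
  refine ⟨fun a ha => h.eq_of_mul_right fun z => ?_, fun a ha => h.eq_of_mul_left fun z => ?_⟩
  · rw [ha, zero_mul]
  · rw [ha, mul_zero]

lemma isNondegenerate_subalgebra (h : HasLocalUnits B) : IsNondegenerate B := by
  refine ⟨fun a ha => Subtype.ext ?_, fun a ha => Subtype.ext ?_⟩
  · refine h.eq_of_mul_right fun z => ?_
    rw [ZeroMemClass.coe_zero, zero_mul]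
    exact congrArg Subtype.val (ha z)
  · refine h.eq_of_mul_left fun z => ?_
    rw [ZeroMemClass.coe_zero, mul_zero]
    exact congrArg Subtype.val (ha z)

variable [IsScalarTower ℂ A A] [SMulCommClass ℂ A A]

lemma isIdempotentAlgebra (h : HasLocalUnits B) : IsIdempotentAlgebra B := by
  refine LinearMap.range_eq_top.2 fun x => ?_
  obtain ⟨z, hz, hz'⟩ := h.2 x
  exact ⟨x ⊗ₜ ⟨z, hz⟩, Subtype.ext hz'⟩

lemma map₂_left (h : HasLocalUnits B) : Submodule.map₂ (LinearMap.mul ℂ A) B.toSubmodule ⊤ = ⊤ := by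
  refine eq_top_iff.2 fun a _ => ?_
  obtain ⟨z, hz, hz'⟩ := h.1 a
  rw [← hz']
  exact Submodule.apply_mem_map₂ (LinearMap.mul ℂ A) hz Submodule.mem_top

lemma map₂_right (h : HasLocalUnits B) : Submodule.map₂ (LinearMap.mul ℂ A) ⊤ B.toSubmodule = ⊤ := by
  refine eq_top_iff.2 fun a _ => ?_
  obtain ⟨z, hz, hz'⟩ := h.2 a
  rw [← hz']
  exact Submodule.apply_mem_map₂ (LinearMap.mul ℂ A) Submodule.mem_top hz

/-- Set `na = (nz)a` for a left local unit `z` of `a`. The relation with all `x` in `B` determines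
the value, so `z` does not matter. -/
lemma exists_extendLeft (h : HasLocalUnits B) (n : Multiplier B) (a : A) :
    ∃ y, ∀ x : B, (x : A) * y = (n.right x : A) * a := by
  obtain ⟨z, hz, hz'⟩ := h.1 a
  refine ⟨(n.left ⟨z, hz⟩ : A) * a, fun x => ?_⟩
  have := congrArg Subtype.val (right_mul_eq n x ⟨z, hz⟩)
  simp only [NonUnitalSubalgebra.coe_mul] at this
  rw [← mul_assoc, ← this, mul_assoc, hz']

lemma exists_extendRight (h : HasLocalUnits B) (n : Multiplier B) (a : A) :
    ∃ y, ∀ x : B, y * (x : A) = a * (n.left x : A) := by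
  obtain ⟨z, hz, hz'⟩ := h.2 a
  refine ⟨a * (n.right ⟨z, hz⟩ : A), fun x => ?_⟩
  have := congrArg Subtype.val (right_mul_eq n ⟨z, hz⟩ x)
  simp only [NonUnitalSubalgebra.coe_mul] at this
  rw [mul_assoc, this, ← mul_assoc, hz']

/-- The left action of `n ∈ M(B)` on `A`. -/
def extendLeft (h : HasLocalUnits B) (n : Multiplier B) : A →ₗ[ℂ] A where
  toFun a := (h.exists_extendLeft n a).choose
  map_add' a b := h.eq_of_mul_left fun x => by
    rw [mul_add, (h.exists_extendLeft n _).choose_spec, (h.exists_extendLeft n _).choose_spec,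
      (h.exists_extendLeft n _).choose_spec, mul_add]
  map_smul' c a := h.eq_of_mul_left fun x => by
    rw [mul_smul_comm, (h.exists_extendLeft n _).choose_spec,
      (h.exists_extendLeft n _).choose_spec, mul_smul_comm, RingHom.id_apply]

/-- The right action of `n ∈ M(B)` on `A`. -/
def extendRight (h : HasLocalUnits B) (n : Multiplier B) : A →ₗ[ℂ] A where
  toFun a := (h.exists_extendRight n a).choose
  map_add' a b := h.eq_of_mul_right fun x => by
    rw [add_mul, (h.exists_extendRight n _).choose_spec, (h.exists_extendRight n _).choose_spec,
      (h.exists_extendRight n _).choose_spec, add_mul]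
  map_smul' c a := h.eq_of_mul_right fun x => by
    rw [smul_mul_assoc, (h.exists_extendRight n _).choose_spec,
      (h.exists_extendRight n _).choose_spec, smul_mul_assoc, RingHom.id_apply]

lemma mul_extendLeft (h : HasLocalUnits B) (n : Multiplier B) (x : B) (a : A) :
    (x : A) * h.extendLeft n a = (n.right x : A) * a := (h.exists_extendLeft n a).choose_spec x

lemma extendRight_mul (h : HasLocalUnits B) (n : Multiplier B) (x : B) (a : A) :
    h.extendRight n a * (x : A) = a * (n.left x : A) := (h.exists_extendRight n a).choose_spec x

/-- The extension of a multiplier of `B` to a multiplier of `A`. -/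
def extend (h : HasLocalUnits B) (n : Multiplier B) : Multiplier A :=
  ⟨(h.extendLeft n, MulOpposite.op (h.extendRight n)), by
    refine ⟨fun a b => ?_, fun a b => ?_, fun a b => ?_⟩
    · exact h.eq_of_mul_left fun x => by rw [← mul_assoc, mul_extendLeft, mul_extendLeft, mul_assoc]
    · exact h.eq_of_mul_right fun x => by
        rw [MulOpposite.unop_op, mul_assoc, extendRight_mul, extendRight_mul, mul_assoc]
    · obtain ⟨z, hz, hz'⟩ := h.2 a
      have hr : h.extendRight n a = a * (n.right ⟨z, hz⟩ : A) := h.eq_of_mul_right fun x => by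
        have := congrArg Subtype.val (right_mul_eq n ⟨z, hz⟩ x)
        simp only [NonUnitalSubalgebra.coe_mul] at this
        rw [extendRight_mul, mul_assoc, this, ← mul_assoc, hz']
      have hl := h.mul_extendLeft n ⟨z, hz⟩ b
      change h.extendRight n a * b = a * h.extendLeft n b
      rw [hr, mul_assoc, ← hl, ← mul_assoc, hz']⟩

lemma mul_extend (h : HasLocalUnits B) (n : Multiplier B) (x : B) (a : A) :
    (x : A) * (h.extend n).left a = (n.right x : A) * a := h.mul_extendLeft n x a

lemma extend_eq (h : HasLocalUnits B) {n : Multiplier B} {m : Multiplier A}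
    (hm : ∀ (x : B) a, (x : A) * m.left a = (n.right x : A) * a) : h.extend n = m :=
  ext_left h.isNondegenerate fun a => h.eq_of_mul_left fun x => by rw [mul_extend, hm]

lemma extend_left_coe (h : HasLocalUnits B) (n : Multiplier B) (x : B) :
    (h.extend n).left (x : A) = (n.left x : A) :=
  h.eq_of_mul_left fun z => by
    rw [mul_extend]
    exact congrArg Subtype.val (right_mul_eq n z x)

lemma extend_right_coe (h : HasLocalUnits B) (n : Multiplier B) (x : B) :
    (h.extend n).right (x : A) = (n.right x : A) :=
  eq_of_nondeg_left h.isNondegenerate fun b => by rw [right_mul_eq, mul_extend]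

/-- The embedding `M(B) → M(A)`. -/
def extendHom (h : HasLocalUnits B) : Multiplier B →ₐ[ℂ] Multiplier A :=
  AlgHom.ofLinearMap
    { toFun := h.extend
      map_add' := fun n n' => h.extend_eq fun x a => by
        change (x : A) * ((h.extend n).left a + (h.extend n').left a) =
          ((n.right x : A) + (n'.right x : A)) * a
        rw [mul_add, mul_extend, mul_extend, add_mul]
      map_smul' := fun c n => h.extend_eq fun x a => by
        change (x : A) * (c • (h.extend n).left a) = (c • (n.right x : A)) * a
        rw [mul_smul_comm, mul_extend, smul_mul_assoc] }
    (h.extend_eq fun x a => rfl)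
    fun n n' => h.extend_eq fun x a => by
      change (x : A) * (h.extend n).left ((h.extend n').left a) = (n'.right (n.right x) : A) * a
      rw [mul_extend, mul_extend]

lemma extendHom_apply (h : HasLocalUnits B) (n : Multiplier B) : h.extendHom n = h.extend n := rfl

lemma extendHom_injective (h : HasLocalUnits B) : Function.Injective h.extendHom := fun n n' hn =>
  ext_left h.isNondegenerate_subalgebra fun x => Subtype.ext <| by
    rw [← extend_left_coe h, ← extend_left_coe h, ← extendHom_apply, hn, extendHom_apply]

end HasLocalUnits

end Extension

namespace RegularWeakMultiplierHopfAlgebra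

variable {A : Type*} [NonUnitalRing A] [Module ℂ A] [IsScalarTower ℂ A A] [SMulCommClass ℂ A A]
variable (H : RegularWeakMultiplierHopfAlgebra A)

/-! ### The chosen antipode and source map are the constructed ones -/

section Antipode

lemma isAntipode_S : H.IsAntipode H.toHopfData.S := by
  refine ⟨H.toHopfData.R₁, H.toHopfData.R₂, ⟨?_, ?_, ?_⟩, ⟨?_, ?_, ?_⟩, fun a b => ?_,
    fun a b => ?_⟩
  · exact LinearMap.ext fun z => H.toHopfData.T₁_R₁ z
  · exact LinearMap.ext fun z => H.toHopfData.R₁_T₁ z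
  · exact LinearMap.ext fun z => (H.toHopfData.R₁_T₁ _).trans (H.toHopfData.G₁_R₁ z)
  · exact LinearMap.ext fun z => H.toHopfData.T₂_R₂ z
  · exact LinearMap.ext fun z => H.toHopfData.R₂_T₂ z
  · exact LinearMap.ext fun z => (H.toHopfData.R₂_T₂ _).trans (H.toHopfData.G₂_R₂ z)
  · exact H.toHopfData.S_mul a b
  · exact H.toHopfData.mul_S b a

lemma isAntipode_antipode : H.IsAntipode H.antipode := by
  have h : ∃ S, H.IsAntipode S := ⟨_, H.isAntipode_S⟩
  rw [antipode, dif_pos h]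
  exact h.choose_spec

variable {H} in
-- The requirements on a generalized inverse force it to be `R₁` by `R₁_eq`, and `R₁` determines the
-- antipode.
lemma IsAntipode.eq_S {S : A →ₗ[ℂ] A} (h : H.IsAntipode S) : S = H.toHopfData.S := by
  obtain ⟨R, -, hR, -, hS, -⟩ := h
  have e : H.toHopfData.R₁ = R := LinearMap.ext fun z => by
    refine H.toHopfData.R₁_eq (LinearMap.congr_fun hR.comp_right z) ?_
    have h1 := LinearMap.congr_fun hR.comp_left (R z)
    have h2 := LinearMap.congr_fun hR.reflexive z
    exact h1.symm.trans h2
  refine LinearMap.ext fun a => eq_of_nondeg_left H.nondegenerate fun b => ?_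
  rw [hS, ← e]
  exact (H.toHopfData.S_mul a b).symm

lemma antipode_eq : H.antipode = H.toHopfData.S := H.isAntipode_antipode.eq_S

lemma mulAntipode_eq : H.mulAntipode = H.toHopfData.s' := TensorProduct.ext' fun p q => by
  rw [HopfData.s'_tmul, mulAntipode, antipode_eq]
  rfl

lemma adj_eq (a x : A) : H.adj a x = H.toHopfData.adj a x := by
  rw [adj, mulAntipode_eq]; rfl

end Antipode

section SourceMap

/-- `ε_s(a)`. -/
def source (a : A) : Multiplier A :=
  ⟨(H.toHopfData.esMul a, MulOpposite.op
    (sliceRight H.ε ∘ₗ H.E.right ∘ₗ (TensorProduct.mk ℂ A A).flip a)), by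
    refine ⟨fun b c => H.toHopfData.es_mul a b c, fun b c => ?_,
      fun u b => (H.toHopfData.mul_es u a b).symm⟩
    have h := congrArg (sliceRight H.ε) (H.toHopfData.P_onLeft_mul b (c ⊗ₜ a))
    rwa [sliceRight_onLeft] at h⟩

/-- `ε_s` as a linear map. -/
def sourceHom : A →ₗ[ℂ] Multiplier A where
  toFun := H.source
  map_add' a b := ext_left H.nondegenerate fun c => by
    change H.toHopfData.esMul (a + b) c = H.toHopfData.esMul a c + H.toHopfData.esMul b c
    simp only [HopfData.esMul_apply, TensorProduct.add_tmul, map_add]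
  map_smul' k a := ext_left H.nondegenerate fun c => by
    change H.toHopfData.esMul (k • a) c = k • H.toHopfData.esMul a c
    simp only [HopfData.esMul_apply, ← TensorProduct.smul_tmul', map_smul]

lemma mul'_map_antipode (z : A ⊗[ℂ] A) :
    LinearMap.mul' ℂ A (TensorProduct.map H.antipode LinearMap.id z) = H.toHopfData.s z :=
  eq_of_tmul (f := LinearMap.mul' ℂ A ∘ₗ TensorProduct.map H.antipode LinearMap.id)
    (g := H.toHopfData.s) (fun p q => by rw [HopfData.s_tmul, antipode_eq]; rfl) z

lemma esMul_eq (a b : A) : H.toHopfData.esMul a b =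
    LinearMap.mul' ℂ A (TensorProduct.map H.antipode LinearMap.id (H.T₁ (a ⊗ₜ b))) := by
  rw [mul'_map_antipode]
  exact (H.toHopfData.s_T₁ (a ⊗ₜ b)).symm

lemma isSourceMap_sourceMap : H.IsSourceMap H.sourceMap := by
  have h : ∃ f, H.IsSourceMap f := ⟨H.sourceHom, H.esMul_eq⟩
  rw [sourceMap, dif_pos h]
  exact h.choose_spec

lemma sourceMap_left (a b : A) : (H.sourceMap a).left b = H.toHopfData.esMul a b := by
  rw [H.isSourceMap_sourceMap, esMul_eq]

end SourceMap

/-! ### The algebra `A₀`, its multipliers and its module structure -/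

section AdjointAlgebra

lemma adjSpace_eq : H.adjSpace = H.toHopfData.A₀ := by
  rw [HopfData.A₀, range_eq_span, adjSpace, mulAntipode_eq]
  rfl

lemma adjSpace_eq_span_adj : H.adjSpace = Submodule.span ℂ {z | ∃ a x : A, z = H.adj a x} := by
  rw [adjSpace_eq, HopfData.A₀, ← HopfData.range_s'_T₄, range_eq_span]
  congr 1
  ext z
  simp only [Set.mem_ofPred_eq, adj_eq]
  exact exists_comm

lemma isSandwich_π (a : A) : H.IsSandwich a (H.toHopfData.π a) := by
  intro q
  obtain ⟨t, ht⟩ := H.toHopfData.exists_isCover q a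
  refine ⟨t, ?_, ?_⟩
  · refine ext_left (H.nondegenerate.tensor H.nondegenerate) fun z => ?_
    refine eq_of_tmul (f := (of t).left) (g := (tmul 1 (of q) * H.E * tmul (of a) 1).left)
      (fun x d => ?_) z
    have h : onRight ((LinearMap.mul ℂ A).flip d) t =
      onRight (LinearMap.mul ℂ A q) (H.E.left (a ⊗ₜ d)) := ht d
    have h' : H.E.left (onLeft ((LinearMap.mul ℂ A).flip x) (a ⊗ₜ d)) =
      onLeft ((LinearMap.mul ℂ A).flip x) (H.E.left (a ⊗ₜ d)) :=
      H.toHopfData.L_onLeft_flip x (a ⊗ₜ d)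
    change t * (x ⊗ₜ d) = onRight (LinearMap.mul ℂ A q)
      (H.E.left (onLeft ((LinearMap.mul ℂ A).flip x) (a ⊗ₜ d)))
    rw [mul_tmul_eq, h, h', onLeft_onRight]
  · rw [antipode_eq, mulAntipode_eq]
    exact ht.mul_S

/-- The algebra `A₀`. -/
def adjAlgebra : NonUnitalSubalgebra ℂ A where
  __ := H.toHopfData.A₀
  mul_mem' hx hy := H.toHopfData.mul_mem_A₀ hx hy

lemma mem_adjAlgebra {z : A} : z ∈ H.adjAlgebra ↔ z ∈ H.toHopfData.A₀ := Iff.rfl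

lemma hasLocalUnits_adjAlgebra : HasLocalUnits H.adjAlgebra :=
  ⟨H.toHopfData.exists_mem_A₀_mul_eq, H.toHopfData.exists_mem_A₀_eq_mul⟩

lemma mem_adjAlgebra_iff (a : A) :
    a ∈ H.adjAlgebra ↔ ∀ b, of a * H.sourceMap b = H.sourceMap b * of a := by
  rw [mem_adjAlgebra, HopfData.mem_A₀_iff]
  refine forall_congr' fun b => ⟨fun h => ?_, fun h c => ?_⟩
  · refine ext_left H.nondegenerate fun c => ?_
    rw [mul_left_apply, mul_left_apply, sourceMap_left, sourceMap_left]
    exact h c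
  · have := congrArg (fun m => Multiplier.left m c) h
    simp only [mul_left_apply, sourceMap_left] at this
    exact this

lemma mul_sourceMap_left (x : H.adjAlgebra) (b c : A) :
    (x : A) * (H.sourceMap b).left c = (H.sourceMap b).left ((x : A) * c) :=
  congrArg (fun m => Multiplier.left m c) ((H.mem_adjAlgebra_iff x).1 x.2 b)

/-- The restriction to `A₀` of a multiplier that commutes with `ε_s(A)`. -/
def restrict (m : Multiplier A) (hm : ∀ b, H.sourceMap b * m = m * H.sourceMap b) :
    Multiplier H.adjAlgebra :=
  ⟨(m.left.restrict (p := H.adjAlgebra.toSubmodule) (q := H.adjAlgebra.toSubmodule)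
      fun x hx => (H.mem_adjAlgebra_iff _).2 fun b => by
        rw [of_left_eq, mul_assoc, (H.mem_adjAlgebra_iff x).1 hx, ← mul_assoc, ← hm, mul_assoc],
    MulOpposite.op (m.right.restrict (p := H.adjAlgebra.toSubmodule)
      (q := H.adjAlgebra.toSubmodule) fun x hx => (H.mem_adjAlgebra_iff _).2 fun b => by
        rw [of_right_eq, mul_assoc, ← hm, ← mul_assoc, (H.mem_adjAlgebra_iff x).1 hx,
          mul_assoc])), by
    refine ⟨fun a b => Subtype.ext ?_, fun a b => Subtype.ext ?_, fun a b => Subtype.ext ?_⟩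
    · exact left_mul m a b
    · exact right_mul m a b
    · exact right_mul_eq m a b⟩

lemma restrict_right (m : Multiplier A) (hm : ∀ b, H.sourceMap b * m = m * H.sourceMap b)
    (x : H.adjAlgebra) : ((H.restrict m hm).right x : A) = m.right x := rfl

/-- A multiplier in the commutant preserves `A₀`, which is itself a commutant, and so restricts.
Conversely, for `x` in `A₀` both `x` and `xn` commute with source values, which is tested after left
factors from `A₀`. -/
lemma range_extendHom : H.hasLocalUnits_adjAlgebra.extendHom.range =
    Subalgebra.centralizer ℂ (Set.range H.sourceMap) := by
  ext m
  rw [Subalgebra.mem_centralizer_iff, Set.forall_mem_range, AlgHom.mem_range]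
  constructor
  · rintro ⟨n, rfl⟩ b
    rw [HasLocalUnits.extendHom_apply]
    refine ext_left H.nondegenerate fun a =>
      H.hasLocalUnits_adjAlgebra.eq_of_mul_left fun x => ?_
    rw [mul_left_apply, mul_left_apply, HasLocalUnits.mul_extend, mul_sourceMap_left,
      HasLocalUnits.mul_extend, mul_sourceMap_left]
  · intro hm
    refine ⟨H.restrict m hm, H.hasLocalUnits_adjAlgebra.extend_eq fun x a => ?_⟩
    rw [restrict_right, right_mul_eq]

/-- The adjoint action of `A` on `A₀`. -/
def adjAction : A →ₗ[ℂ] H.adjAlgebra →ₗ[ℂ] H.adjAlgebra :=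
  LinearMap.mk₂ ℂ (fun a x => ⟨H.toHopfData.adj a x, H.toHopfData.adj_mem a x⟩)
    (fun a b x => Subtype.ext (LinearMap.map_add₂ H.toHopfData.adjMap a b (x : A)))
    (fun c a x => Subtype.ext (LinearMap.map_smul₂ H.toHopfData.adjMap c a (x : A)))
    (fun a x y => Subtype.ext (map_add (H.toHopfData.adjMap a) (x : A) (y : A)))
    (fun c a x => Subtype.ext (map_smul (H.toHopfData.adjMap a) c (x : A)))

/-- `α_{bc}(x) = b ▹ (c ▹ x)`, where `c ▹ x` lies in `A₀` even for `x` outside it. Products span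
`A`, and the `α_a(x)` span `A₀`. -/
lemma map₂_adjAction : Submodule.map₂ H.adjAction ⊤ ⊤ = ⊤ := by
  set V := (Submodule.map₂ H.adjAction ⊤ ⊤).map
    (H.adjAlgebra.toSubmodule.subtype : H.adjAlgebra →ₗ[ℂ] A) with hV
  have h : ∀ a x, H.toHopfData.adj a x ∈ V := by
    intro a x
    have := H.toHopfData.idem (V.comap (H.toHopfData.adjMap.flip x)) fun b c => by
      refine ⟨H.adjAction b ⟨H.toHopfData.adj c x, H.toHopfData.adj_mem c x⟩,
        Submodule.apply_mem_map₂ _ Submodule.mem_top Submodule.mem_top, ?_⟩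
      exact (H.toHopfData.adj_mul_left b c x).symm
    exact (this ▸ Submodule.mem_top : a ∈ V.comap (H.toHopfData.adjMap.flip x))
  refine eq_top_iff.2 fun x _ => ?_
  have hx : (x : A) ∈ V := by
    have h' : H.adjSpace ≤ V := by
      rw [adjSpace_eq_span_adj, Submodule.span_le]
      rintro _ ⟨a, x, rfl⟩
      rw [adj_eq]
      exact h a x
    exact h' (by rw [adjSpace_eq]; exact x.2)
  obtain ⟨y, hy, hyx⟩ := hx
  rwa [← Subtype.ext hyx]

lemma coe_mul'_tensorAction (x y : H.adjAlgebra) (w : A ⊗[ℂ] A) :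
    (LinearMap.mul' ℂ H.adjAlgebra (tensorAction H.adjAction w (x ⊗ₜ y)) : A) =
      TensorProduct.lift (LinearMap.mul ℂ A) (TensorProduct.map
        (H.toHopfData.adjMap.flip x) (H.toHopfData.adjMap.flip y) w) := by
  induction w with
  | zero => simp
  | add w w' hw hw' => simp only [map_add, LinearMap.add_apply, NonUnitalSubalgebra.coe_add, hw, hw']
  | tmul p q => rfl

lemma isModuleAlgebra_adjAction :
    IsModuleAlgebra H.toWeakMultiplierHopfAlgebra H.adjAction where
  nondegenerate := H.hasLocalUnits_adjAlgebra.isNondegenerate_subalgebra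
  idempotent := H.hasLocalUnits_adjAlgebra.isIdempotentAlgebra
  mul_act a b r := Subtype.ext (H.toHopfData.adj_mul_left a b r)
  unital := H.map₂_adjAction
  act_mul a b c x y := Subtype.ext <| by
    have h : ∀ z : A ⊗[ℂ] A, TensorProduct.map (H.toHopfData.adjMap.flip (x : A))
        (H.toHopfData.adjMap.flip (y : A)) (onRight ((LinearMap.mul ℂ A).flip b) z) =
        TensorProduct.map (H.toHopfData.adjMap.flip (x : A))
          (H.toHopfData.adjMap.flip (H.toHopfData.adj b y)) z :=
      eq_of_tmul (f := TensorProduct.map (H.toHopfData.adjMap.flip (x : A))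
          (H.toHopfData.adjMap.flip (y : A)) ∘ₗ onRight ((LinearMap.mul ℂ A).flip b))
        (g := TensorProduct.map (H.toHopfData.adjMap.flip (x : A))
          (H.toHopfData.adjMap.flip (H.toHopfData.adj b y)))
        fun p q => congrArg (H.toHopfData.adj p x ⊗ₜ[ℂ] ·) (H.toHopfData.adj_mul_left q b y)
    rw [coe_mul'_tensorAction, ← Δ_left_T₄, h]
    exact (H.toHopfData.adj_mul_right a c x (H.toHopfData.adj b y)).symm

end AdjointAlgebra

end RegularWeakMultiplierHopfAlgebra

end WMHA

end

theorem mainTheorem11 {A : Type*} [NonUnitalRing A] [Module ℂ A] [IsScalarTower ℂ A A]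
    [SMulCommClass ℂ A A] (H : WMHA.RegularWeakMultiplierHopfAlgebra A) :
    -- the antipode and the source map are well defined
    H.IsAntipode H.antipode ∧ H.IsSourceMap H.sourceMap ∧
    -- `A₀` is the span of the elements `E₁ a S(E₂)`, and of the elements `α_a(x)`
    (∃ π : A →ₗ[ℂ] A, (∀ a, H.IsSandwich a (π a)) ∧ H.adjSpace = LinearMap.range π) ∧
    H.adjSpace = Submodule.span ℂ {z | ∃ a x : A, z = H.adj a x} ∧
    -- `A₀` is a non-degenerate subalgebra with `A₀A = AA₀ = A`
    ∃ A₀ : NonUnitalSubalgebra ℂ A, A₀.toSubmodule = H.adjSpace ∧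
      WMHA.IsNondegenerate A₀ ∧
      Submodule.map₂ (LinearMap.mul ℂ A) A₀.toSubmodule ⊤ = ⊤ ∧
      Submodule.map₂ (LinearMap.mul ℂ A) ⊤ A₀.toSubmodule = ⊤ ∧
      -- `A₀` is the commutant of `ε_s(A)` in `A`
      (∀ a : A, a ∈ A₀ ↔ ∀ b : A, WMHA.Multiplier.of a * H.sourceMap b =
        H.sourceMap b * WMHA.Multiplier.of a) ∧
      -- `M(A₀)` embeds in `M(A)`, compatibly with the actions on `A₀`, and its image is the
      -- commutant of `ε_s(A)` in `M(A)`
      (∃ j : WMHA.Multiplier A₀ →ₐ[ℂ] WMHA.Multiplier A, Function.Injective j ∧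
        (∀ (n : WMHA.Multiplier A₀) (x : A₀),
          (j n).left (x : A) = (n.left x : A) ∧ (j n).right (x : A) = (n.right x : A)) ∧
        j.range = Subalgebra.centralizer ℂ (Set.range H.sourceMap)) ∧
      -- `A₀` is an `A`-module algebra under the adjoint action
      (∃ act : A →ₗ[ℂ] A₀ →ₗ[ℂ] A₀, (∀ (a : A) (x : A₀), (act a x : A) = H.adj a x) ∧
        WMHA.IsModuleAlgebra H.toWeakMultiplierHopfAlgebra act) := by
  have hu := H.hasLocalUnits_adjAlgebra
  refine ⟨H.isAntipode_antipode, H.isSourceMap_sourceMap,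
    ⟨H.toHopfData.π, H.isSandwich_π, H.adjSpace_eq.trans H.toHopfData.range_π.symm⟩,
    H.adjSpace_eq_span_adj, H.adjAlgebra, H.adjSpace_eq.symm, hu.isNondegenerate_subalgebra,
    hu.map₂_left, hu.map₂_right, H.mem_adjAlgebra_iff,
    ⟨hu.extendHom, hu.extendHom_injective,
      fun n x => ⟨hu.extend_left_coe n x, hu.extend_right_coe n x⟩, H.range_extendHom⟩,
    ⟨H.adjAction, fun a x => (H.adj_eq a x).symm, H.isModuleAlgebra_adjAction⟩⟩
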